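/- Let $\mathfrak g$ be a complex (finite-dimensional) semisimple Lie algebra with Cartan subalgebra $\mathfrak h$, root system $\Delta$, base $\Pi$ and positive roots $\Delta^+$. Let $\Sigma\subset\Pi$, let $\Delta_\Sigma=\Delta\cap\mathbb Z\Sigma$ be the root subsystem generated by $\Sigma$, and put $\Delta^+_{\mathfrak u}=\Delta^+\setminus\Delta_\Sigma$. Let $\mathfrak l=\mathfrak h\oplus\bigoplus_{\gamma\in\Delta_\Sigma}\mathfrak g_\gamma$, $\mathfrak u=\bigoplus_{\gamma\in\Delta^+_{\mathfrak u}}\mathfrak g_\gamma$, $\overline{\mathfrak u}=\bigoplus_{\gamma\in\Delta^+_{\mathfrak u}}\mathfrak g_{-\gamma}$ and $\mathfrak p=\mathfrak l\oplus\mathfrak u$, so that $\mathfrak g=\overline{\mathfrak u}\oplus\mathfrak p$; write $a=a_{\overline{\mathfrak u}}+a_{\mathfrak p}$ for the corresponding decomposition of $a\in\mathfrak g$. Choose nonzero root vectors $f_\gamma\in\mathfrak g_{-\gamma}$, $\gamma\in\Delta^+_{\mathfrak u}$. Let $\Lambda^+(\mathfrak p)=\{\mu\in\mathfrak h^*:\mu(\gamma^\vee)\in\mathbb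 N_0\text{ for all }\gamma\in\Sigma\}$ and $\rho_{\mathfrak u}=\frac12\sum_{\gamma\in\Delta^+_{\mathfrak u}}\gamma$. For $\mu\in\Lambda^+(\mathfrak p)$ let $\sigma_\mu\colon\mathfrak p\to\operatorname{End}\mathbb F_\mu$ be the simple finite-dimensional $\mathfrak p$-module with highest weight $\mu$, and $M^{\mathfrak g}_{\mathfrak p}(\mu)=U(\mathfrak g)\otimes_{U(\mathfrak p)}\mathbb F_\mu$. For $\alpha\in\Delta^+_{\mathfrak u}$ let $U(\mathfrak g)_{(f_\alpha)}$ be the left ring of fractions of $U(\mathfrak g)$ with respect to $\{f_\alpha^n:n\in\mathbb N_0\}$, and $$W^{\mathfrak g}_{\mathfrak p}(\mu,\alpha)=\bigl(U(\mathfrak g)_{(f_\alpha)}/U(\mathfrak g)\bigr)\otimes_{U(\mathfrak g)}M^{\mathfrak g}_{\mathfrak p}(\mu).$$ Let $x_\gamma$, $\gamma\in\Delta^+_{\mathfrak u}$, be the coordinate functions on $\overline{\mathfrak u}$ with respect to the basis $\{f_\gamma\}$, let $\mathcal A$ be the Weyl algebra of $\overline{\mathfrak u}$, generated by the $x_\gamma,\partial_{x_\gamma}$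 with the canonical commutation relations, and put $u(x)=\sum_\gamma x_\gamma f_\gamma\in\mathbb C[\overline{\mathfrak u}]\otimes\mathfrak g$. Consider the left ideals $$\mathcal I_{\mathrm V}=(x_\gamma:\gamma\in\Delta^+_{\mathfrak u}),\qquad \mathcal I_{\mathrm{GT},\alpha}=(\partial_{x_\alpha},\,x_\gamma:\gamma\in\Delta^+_{\mathfrak u},\ \gamma\neq\alpha)$$ of $\mathcal A$. **Theorem.** Let $\lambda\in\Lambda^+(\mathfrak p)$. (1) There is a homomorphism of $\mathbb C$-algebras $\pi=\pi_{\lambda+\rho_{\mathfrak u}}\colon U(\mathfrak g)\to\mathcal A\otimes_{\mathbb C}\operatorname{End}\mathbb F_{\lambda+2\rho_{\mathfrak u}}$ such that, for all $a\in\mathfrak g$, $$\pi(a)=-\sum_{\gamma\in\Delta^+_{\mathfrak u}}\Bigl[\frac{\operatorname{ad}(u(x))\,e^{\operatorname{ad}(u(x))}}{e^{\operatorname{ad}(u(x))}-\mathrm{id}}\,\bigl(e^{-\operatorname{ad}(u(x))}a\bigr)_{\overline{\mathfrak u}}\Bigr]_\gamma\,\partial_{x_\gamma}+\sigma_{\lambda+2\rho_{\mathfrak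 u}}\bigl((e^{-\operatorname{ad}(u(x))}a)_{\mathfrak p}\bigr),$$ where $[\,\cdot\,]_\gamma$ is the coordinate with respect to $f_\gamma$. (2) With the $U(\mathfrak g)$-module structures on the last two modules given through $\pi$, there are isomorphisms of $U(\mathfrak g)$-modules $$M^{\mathfrak g}_{\mathfrak p}(\lambda)\simeq\mathcal A/\mathcal I_{\mathrm V}\otimes_{\mathbb C}\mathbb F_{\lambda+2\rho_{\mathfrak u}}\simeq\mathbb C[\partial_{x_\gamma},\gamma\in\Delta^+_{\mathfrak u}]\otimes_{\mathbb C}\mathbb F_{\lambda+2\rho_{\mathfrak u}}.$$ (3) Likewise, for every $\alpha\in\Delta^+_{\mathfrak u}$, $$W^{\mathfrak g}_{\mathfrak p}(\lambda,\alpha)\simeq\mathcal A/\mathcal I_{\mathrm{GT},\alpha}\otimes_{\mathbb C}\mathbb F_{\lambda+2\rho_{\mathfrak u}}\simeq\mathbb C[x_\alpha,\partial_{x_\gamma},\gamma\neq\alpha]\otimes_{\mathbb C}\mathbb F_{\lambda+2\rho_{\mathfrak u}}.$$ Here $\mathbb C[\partial_{x_\gamma}]$ and $\mathbb C[x_\alpha,\partial_{x_\gamma},\gamma\neq\alpha]$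 are the $\mathcal A$-modules on which the variables of the polynomial ring act by multiplication, $x_\gamma$ acts as $-\partial/\partial(\partial_{x_\gamma})$ if $\partial_{x_\gamma}$ is one of the variables, and $\partial_{x_\alpha}$ acts as $\partial/\partial x_\alpha$ if $x_\alpha$ is one of the variables; the canonical map sending a polynomial to its class in $\mathcal A/\mathcal I_{\mathrm V}$, respectively $\mathcal A/\mathcal I_{\mathrm{GT},\alpha}$, is an isomorphism of $\mathcal A$-modules. -/

import Mathlib

open scoped TensorProduct
open Module

noncomputable section

/-- The canonical commutation relations between `x i = ι (inl i)` and `∂ i = ι (inr i)`. -/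
inductive WeylRel (σ : Type*) : FreeAlgebra ℂ (σ ⊕ σ) → FreeAlgebra ℂ (σ ⊕ σ) → Prop
  | x_comm (i j : σ) : WeylRel σ
      (FreeAlgebra.ι ℂ (.inl i) * FreeAlgebra.ι ℂ (.inl j))
      (FreeAlgebra.ι ℂ (.inl j) * FreeAlgebra.ι ℂ (.inl i))
  | d_comm (i j : σ) : WeylRel σ
      (FreeAlgebra.ι ℂ (.inr i) * FreeAlgebra.ι ℂ (.inr j))
      (FreeAlgebra.ι ℂ (.inr j) * FreeAlgebra.ι ℂ (.inr i))
  | d_x_self (i : σ) : WeylRel σ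
      (FreeAlgebra.ι ℂ (.inr i) * FreeAlgebra.ι ℂ (.inl i))
      (FreeAlgebra.ι ℂ (.inl i) * FreeAlgebra.ι ℂ (.inr i) + 1)
  | d_x_of_ne (i j : σ) (h : i ≠ j) : WeylRel σ
      (FreeAlgebra.ι ℂ (.inr i) * FreeAlgebra.ι ℂ (.inl j))
      (FreeAlgebra.ι ℂ (.inl j) * FreeAlgebra.ι ℂ (.inr i))

/-- The Weyl algebra over `ℂ` in the variables `x i`, `i : σ`. -/
def Weyl (σ : Type*) : Type _ := RingQuot (WeylRel σ)

namespace Weyl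
variable {σ : Type*}

instance : Ring (Weyl σ) := inferInstanceAs (Ring (RingQuot (WeylRel σ)))
instance : Algebra ℂ (Weyl σ) := inferInstanceAs (Algebra ℂ (RingQuot (WeylRel σ)))

/-- The generator `x i`. -/
def x (i : σ) : Weyl σ := RingQuot.mkAlgHom ℂ (WeylRel σ) (FreeAlgebra.ι ℂ (.inl i))

/-- The generator `∂ i`, the partial derivative with respect to `x i`. -/
def d (i : σ) : Weyl σ := RingQuot.mkAlgHom ℂ (WeylRel σ) (FreeAlgebra.ι ℂ (.inr i))

theorem x_mul_x (i j : σ) : x i * x j = x j * x i := by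
  simpa only [map_mul] using! RingQuot.mkAlgHom_rel ℂ (WeylRel.x_comm i j)

theorem d_mul_d (i j : σ) : d i * d j = d j * d i := by
  simpa only [map_mul] using! RingQuot.mkAlgHom_rel ℂ (WeylRel.d_comm i j)

theorem d_mul_x_self (i : σ) : d i * x i = x i * d i + 1 := by
  simpa only [map_mul, map_add, map_one] using! RingQuot.mkAlgHom_rel ℂ (WeylRel.d_x_self i)

theorem d_mul_x_of_ne {i j : σ} (h : i ≠ j) : d i * x j = x j * d i := by
  simpa only [map_mul] using! RingQuot.mkAlgHom_rel ℂ (WeylRel.d_x_of_ne i j h)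

open scoped IsMulCommutative in
/-- The algebra homomorphism `ℂ[y i, i : σ] → A` sending `y i` to `c i`, for a family `c` of
pairwise commuting elements of a noncommutative algebra `A`. -/
def aevalComm {A : Type*} [Ring A] [Algebra ℂ A] (c : σ → A) (hc : ∀ i j, c i * c j = c j * c i) :
    MvPolynomial σ ℂ →ₐ[ℂ] A :=
  haveI : IsMulCommutative (Algebra.adjoin ℂ (Set.range c)) :=
    Algebra.isMulCommutative_adjoin ℂ (by
      rintro _ ⟨i, rfl⟩ _ ⟨j, rfl⟩
      exact hc i j)
  (Algebra.adjoin ℂ (Set.range c)).val.comp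
    (MvPolynomial.aeval fun i => ⟨c i, Algebra.subset_adjoin ⟨i, rfl⟩⟩)

theorem aevalComm_X {A : Type*} [Ring A] [Algebra ℂ A] (c : σ → A)
    (hc : ∀ i j, c i * c j = c j * c i) (i : σ) : aevalComm c hc (MvPolynomial.X i) = c i := by
  simp [aevalComm]

/-- The inclusion of the polynomial functions `ℂ[x i, i : σ]` into the Weyl algebra. -/
def ofPoly : MvPolynomial σ ℂ →ₐ[ℂ] Weyl σ := aevalComm x x_mul_x

open Classical in
/-- The commuting generators `y i` of the Weyl algebra attached to `T ⊆ σ`: `y i = x i` for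
`i ∈ T`, and `y i = ∂ i` for `i ∉ T`. -/
def creator (T : Set σ) (i : σ) : Weyl σ := if i ∈ T then x i else d i

theorem creator_comm (T : Set σ) (i j : σ) :
    creator T i * creator T j = creator T j * creator T i := by
  unfold creator
  split_ifs with hi hj hj
  · exact x_mul_x i j
  · exact (d_mul_x_of_ne (by rintro rfl; exact hj hi)).symm
  · exact d_mul_x_of_ne (by rintro rfl; exact hi hj)
  · exact d_mul_d i j

/-- The inclusion `ℂ[x i (i ∈ T), ∂ j (j ∉ T)] → A` into the Weyl algebra; the polynomial variable
of index `i` stands for `creator T i`. -/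
def ofFock (T : Set σ) : MvPolynomial σ ℂ →ₐ[ℂ] Weyl σ := aevalComm (creator T) (creator_comm T)

open Classical in
/-- The operator of `x i` on `ℂ[x i (i ∈ T), ∂ j (j ∉ T)]`: multiplication if `i ∈ T`, and
minus the derivative with respect to `∂ i` if `i ∉ T`. -/
def fockX (T : Set σ) (i : σ) : End ℂ (MvPolynomial σ ℂ) :=
  if i ∈ T then LinearMap.mulLeft ℂ (MvPolynomial.X i) else -(MvPolynomial.pderiv i).toLinearMap

open Classical in
/-- The operator of `∂ i` on `ℂ[x i (i ∈ T), ∂ j (j ∉ T)]`: the derivative with respect to `x i` if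
`i ∈ T`, and multiplication if `i ∉ T`. -/
def fockD (T : Set σ) (i : σ) : End ℂ (MvPolynomial σ ℂ) :=
  if i ∈ T then (MvPolynomial.pderiv i).toLinearMap else LinearMap.mulLeft ℂ (MvPolynomial.X i)

theorem pderiv_comm (i j : σ) (p : MvPolynomial σ ℂ) :
    MvPolynomial.pderiv i (MvPolynomial.pderiv j p) =
      MvPolynomial.pderiv j (MvPolynomial.pderiv i p) := by
  classical
  induction p using MvPolynomial.induction_on with
  | C a => simp
  | add p q hp hq => simp [hp, hq]
  | mul_X p k hp =>
    simp only [Derivation.leibniz, MvPolynomial.pderiv_X, smul_eq_mul, map_add, hp, Pi.single_apply]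
    split_ifs <;> simp <;> ring

/-- The Weyl algebra module `ℂ[x i (i ∈ T), ∂ j (j ∉ T)]`. -/
def fockRep (T : Set σ) : Weyl σ →ₐ[ℂ] End ℂ (MvPolynomial σ ℂ) :=
  RingQuot.liftAlgHom ℂ ⟨FreeAlgebra.lift ℂ (Sum.elim (fockX T) (fockD T)), by
    classical
    rintro _ _ (⟨i, j⟩ | ⟨i, j⟩ | ⟨i⟩ | ⟨i, j, h⟩)
    all_goals
      refine LinearMap.ext fun p => ?_
      simp only [map_mul, map_add, map_one, FreeAlgebra.lift_ι_apply, Sum.elim_inl, Sum.elim_inr,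
        fockX, fockD, Module.End.mul_apply, LinearMap.add_apply, Module.End.one_apply]
      split_ifs <;>
        simp [Derivation.leibniz, MvPolynomial.pderiv_X, Pi.single_apply, pderiv_comm i] <;>
        first | ring_nf; done | grind⟩

theorem fockRep_x (T : Set σ) (i : σ) : fockRep T (x i) = fockX T i := by
  unfold fockRep x
  erw [RingQuot.liftAlgHom_mkAlgHom_apply]
  simp

theorem fockRep_d (T : Set σ) (i : σ) : fockRep T (d i) = fockD T i := by
  unfold fockRep d
  erw [RingQuot.liftAlgHom_mkAlgHom_apply]
  simp

/-- The left ideal `(x i, i : σ)`. -/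
def idealV (σ : Type*) : Submodule (Weyl σ) (Weyl σ) :=
  Submodule.span (Weyl σ) (Set.range x)

/-- The left ideal `(∂ a, x i, i ≠ a)`. -/
def idealGT (a : σ) : Submodule (Weyl σ) (Weyl σ) :=
  Submodule.span (Weyl σ) ({d a} ∪ {z | ∃ i, i ≠ a ∧ z = x i})

end Weyl

section Localization

/-- Local ad-nilpotency of an element of a ring. -/
def IsLocallyAdNilpotent {R : Type*} [Ring R] (t : R) : Prop :=
  ∀ r : R, ∃ n : ℕ, (fun s : R => t * s - s * t)^[n] r = 0

variable {R : Type*} [Ring R] {t : R}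

theorem IsLocallyAdNilpotent.exists_mul_eq (ht : IsLocallyAdNilpotent t) (r : R) :
    ∃ (n : ℕ) (r' : R), t ^ n * r = r' * t := by
  obtain ⟨n, hn⟩ := ht r
  induction n generalizing r with
  | zero => exact ⟨0, 0, by simpa using hn⟩
  | succ n ih =>
    obtain ⟨m, r', h⟩ := ih (t * r - r * t) hn
    refine ⟨m + 1, r' + t ^ m * r, ?_⟩
    rw [add_mul, ← h, pow_succ]
    noncomm_ring

theorem IsLocallyAdNilpotent.exists_mul_eq_zero (ht : IsLocallyAdNilpotent t) (r : R)
    (hr : r * t = 0) : ∃ n : ℕ, t ^ n * r = 0 := by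
  obtain ⟨n, hn⟩ := ht r
  induction n generalizing r with
  | zero => exact ⟨0, by simpa using hn⟩
  | succ n ih =>
    rw [Function.iterate_succ_apply, hr, sub_zero] at hn
    obtain ⟨m, hm⟩ := ih (t * r) (by rw [mul_assoc, hr, mul_zero]) hn
    exact ⟨m + 1, by rw [pow_succ, mul_assoc, hm]⟩

theorem IsLocallyAdNilpotent.nonempty_oreSet (ht : IsLocallyAdNilpotent t) :
    Nonempty (OreLocalization.OreSet (Submonoid.powers t)) := by
  rw [OreLocalization.nonempty_oreSet_iff]
  constructor
  · have key : ∀ (k : ℕ) (r : R), r * t ^ k = 0 → ∃ n : ℕ, t ^ n * r = 0 := by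
      intro k
      induction k with
      | zero => intro r hr; exact ⟨0, by simpa using hr⟩
      | succ k ih =>
        intro r hr
        rw [pow_succ, ← mul_assoc] at hr
        obtain ⟨n, hn⟩ := ht.exists_mul_eq_zero _ hr
        rw [← mul_assoc] at hn
        obtain ⟨m, hm⟩ := ih _ hn
        exact ⟨m + n, by rw [pow_add, mul_assoc, hm]⟩
    rintro r₁ r₂ ⟨_, k, rfl⟩ h
    obtain ⟨n, hn⟩ := key k (r₁ - r₂) (by rw [sub_mul]; exact sub_eq_zero.2 h)
    exact ⟨⟨t ^ n, n, rfl⟩, sub_eq_zero.1 (by rw [← mul_sub]; exact hn)⟩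
  · rintro r ⟨_, k, rfl⟩
    suffices ∃ (n : ℕ) (r' : R), t ^ n * r = r' * t ^ k by
      obtain ⟨n, r', h⟩ := this
      exact ⟨r', ⟨t ^ n, n, rfl⟩, h⟩
    induction k generalizing r with
    | zero => exact ⟨0, r, by simp⟩
    | succ k ih =>
      obtain ⟨n, r', h⟩ := ih r
      obtain ⟨m, r'', h'⟩ := ht.exists_mul_eq r'
      exact ⟨m + n, r'', by rw [pow_add, mul_assoc, h, ← mul_assoc, h', mul_assoc, ← pow_succ']⟩

/-- The tensor product `X ⊗_A M` over a noncommutative ring `A`, as a left `B`-module. Here `X` is a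
`(B, A)`-bimodule, its right `A`-action being given by `ρ`, and `M` is a left `A`-module, its
action being given by `τ`. -/
abbrev BalancedTensor {A B X M : Type*} [Ring A] [Ring B] [AddCommGroup X] [Module B X]
    [AddCommGroup M] (ρ : Aᵐᵒᵖ →+* End B X) (τ : A →+* AddMonoid.End M) : Type _ :=
  (X ⊗[ℤ] M) ⧸ Submodule.span B
    {z | ∃ (x : X) (a : A) (m : M), z = ρ (.op a) x ⊗ₜ[ℤ] m - x ⊗ₜ[ℤ] τ a m}

/-- The ring `R_(t)` of left fractions of `R` with respect to the powers of `t`. -/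
abbrev LocAt (t : R) [OreLocalization.OreSet (Submonoid.powers t)] : Type _ :=
  OreLocalization (Submonoid.powers t) R

variable (t) [OreLocalization.OreSet (Submonoid.powers t)]

/-- The image of `R` in `R_(t)`, as a left `R`-submodule. -/
def imageInLoc : Submodule R (LocAt t) :=
  LinearMap.range (LinearMap.toSpanSingleton R (LocAt t) 1)

/-- Right multiplication by elements of `R` on the left `R`-module `R_(t)`. -/
def locRight : Rᵐᵒᵖ →+* End R (LocAt t) where
  toFun r :=
    { toFun := fun z => z * OreLocalization.numeratorRingHom r.unop
      map_add' := fun _ _ => add_mul _ _ _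
      map_smul' := fun _ _ => smul_mul_assoc _ _ _ }
  map_one' := by
    refine LinearMap.ext fun z => ?_
    simp only [MulOpposite.unop_one, map_one, mul_one, LinearMap.coe_mk, AddHom.coe_mk,
      Module.End.one_apply]
  map_mul' a b := by
    refine LinearMap.ext fun z => ?_
    simp only [MulOpposite.unop_mul, map_mul, LinearMap.coe_mk, AddHom.coe_mk, Module.End.mul_apply,
      mul_assoc]
  map_zero' := by
    refine LinearMap.ext fun z => ?_
    simp only [MulOpposite.unop_zero, map_zero, mul_zero, LinearMap.coe_mk, AddHom.coe_mk,
      LinearMap.zero_apply]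
  map_add' a b := by
    refine LinearMap.ext fun z => ?_
    simp only [MulOpposite.unop_add, map_add, mul_add, LinearMap.coe_mk, AddHom.coe_mk,
      LinearMap.add_apply]

theorem numerator_eq_smul_one (r : R) :
    (OreLocalization.numeratorRingHom r : LocAt t) = r • (1 : LocAt t) := by
  rw [← OreLocalization.smul_one_oreDiv_one_smul, smul_eq_mul, mul_one, smul_eq_mul, mul_one]
  rfl

theorem imageInLoc_le_comap (r : Rᵐᵒᵖ) :
    imageInLoc t ≤ (imageInLoc t).comap (locRight t r) := by
  rintro _ ⟨s, rfl⟩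
  refine ⟨s * r.unop, ?_⟩
  change (s * r.unop) • (1 : LocAt t) = (s • (1 : LocAt t)) * _
  rw [← numerator_eq_smul_one, ← numerator_eq_smul_one, map_mul]

/-- The right `R`-action on the `(R, R)`-bimodule `R_(t) / R`. -/
def locQuotRight : Rᵐᵒᵖ →+* End R (LocAt t ⧸ imageInLoc t) where
  toFun r := (imageInLoc t).mapQ (imageInLoc t) (locRight t r) (imageInLoc_le_comap t r)
  map_one' := by
    refine Submodule.linearMap_qext _ (LinearMap.ext fun z => ?_)
    simp
  map_mul' a b := by
    refine Submodule.linearMap_qext _ (LinearMap.ext fun z => ?_)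
    simp
  map_zero' := by
    refine Submodule.linearMap_qext _ (LinearMap.ext fun z => ?_)
    simp
  map_add' a b := by
    refine Submodule.linearMap_qext _ (LinearMap.ext fun z => ?_)
    simp

/-- The twisting functor on objects: `T_t(M) = (R_(t) / R) ⊗_R M`. -/
abbrev Twist (M : Type*) [AddCommGroup M] [Module R M] : Type _ :=
  BalancedTensor (locQuotRight t) (Module.toAddMonoidEnd R M)

end Localization

section Parabolic

open LieAlgebra LieAlgebra.IsKilling LieModule

variable {L : Type*} [LieRing L] [LieAlgebra ℂ L] [FiniteDimensional ℂ L]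
  [LieAlgebra.IsSemisimple ℂ L] {H : LieSubalgebra ℂ L} [H.IsCartanSubalgebra]
  (b : (rootSystem H).Base) (S : Set b.support)

/-- The root subsystem `Δ_Σ` generated by a set `Σ` of simple roots. -/
def leviRoots : Set H.root :=
  {γ | (rootSystem H).root γ ∈
    Submodule.span ℤ ((fun i : b.support => (rootSystem H).root i) '' S)}

/-- The positive roots outside `Δ_Σ`, that is, the roots of the nilradical. -/
def nilRoots : Set H.root := {γ | b.IsPos γ ∧ γ ∉ leviRoots b S}

/-- The underlying space of the standard parabolic subalgebra: the sum of the Cartan subalgebra, of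
the root spaces for `Δ_Σ` and of the root spaces for the roots of the nilradical. -/
def parabolicSpace : LieSubmodule ℂ H L :=
  H.toLieSubmodule ⊔ (⨆ γ ∈ leviRoots b S, rootSpace H (γ : Weight ℂ H L)) ⊔
    ⨆ γ ∈ nilRoots b S, rootSpace H (γ : Weight ℂ H L)

/-- The opposite nilradical. -/
def oppNilradical : LieSubmodule ℂ H L :=
  ⨆ γ ∈ nilRoots b S, rootSpace H (-((γ : Weight ℂ H L) : H → ℂ))

open Classical in
/-- The sum of the coefficients at the simple roots outside `Σ`. -/
def level : Dual ℂ H →ₗ[ℂ] ℂ := ∑ i : b.support, if i ∈ S then 0 else b.toWeightBasis.coord i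

theorem level_simple (i : b.support) (hi : i ∈ S) : level b S ((rootSystem H).root i) = 0 := by
  classical
  rw [level, LinearMap.sum_apply]
  refine Finset.sum_eq_zero fun j _ => ?_
  split_ifs with hj
  · rfl
  · rw [Basis.coord_apply, RootPairing.Base.toWeightBasis_repr_root, Finsupp.single_apply, if_neg]
    rintro rfl
    exact hj hi

theorem level_simple' (i : b.support) (hi : i ∉ S) : level b S ((rootSystem H).root i) = 1 := by
  classical
  rw [level, LinearMap.sum_apply, Finset.sum_eq_single i]
  · rw [if_neg hi, Basis.coord_apply, RootPairing.Base.toWeightBasis_repr_root,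
      Finsupp.single_eq_same]
  · intro j _ hj
    split_ifs
    · rfl
    · rw [Basis.coord_apply, RootPairing.Base.toWeightBasis_repr_root, Finsupp.single_apply,
        if_neg hj.symm]
  · simp

theorem level_levi {γ : H.root} (h : γ ∈ leviRoots b S) :
    level b S ((rootSystem H).root γ) = 0 := by
  have : Submodule.span ℤ ((fun i : b.support => (rootSystem H).root i) '' S) ≤
      (LinearMap.ker (level b S)).restrictScalars ℤ := by
    rw [Submodule.span_le]
    rintro _ ⟨i, hi, rfl⟩
    exact level_simple b S i hi
  exact this h

theorem level_pos {γ : H.root} (h : b.IsPos γ) :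
    ∃ n : ℕ, level b S ((rootSystem H).root γ) = n ∧ (n = 0 → γ ∈ leviRoots b S) := by
  classical
  obtain ⟨f, hf, hs⟩ : ∃ f : H.root → ℕ, f.support ⊆ b.support ∧
      (rootSystem H).root γ = ∑ j ∈ b.support, f j • (rootSystem H).root j := by
    obtain ⟨f, hf, hs | hs⟩ := b.exists_root_eq_sum_nat_or_neg γ
    · exact ⟨f, hf, hs⟩
    · exfalso
      have := b.height_eq_sum (i := γ) (f := fun j => -(f j : ℤ)) (by simpa using hs)
      rw [RootPairing.Base.isPos_iff, this] at h
      have h2 : ∑ j ∈ b.support, -(f j : ℤ) ≤ 0 := Finset.sum_nonpos fun j _ => by simp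
      omega
  rw [← Finset.sum_coe_sort] at hs
  refine ⟨∑ j : b.support, if j ∈ S then 0 else f j, ?_, fun h0 => ?_⟩
  · rw [hs, map_sum, Nat.cast_sum]
    refine Finset.sum_congr rfl fun j _ => ?_
    rw [map_nsmul]
    split_ifs with hj
    · rw [level_simple b S j hj]; simp
    · rw [level_simple' b S j hj]; simp
  · rw [Finset.sum_eq_zero_iff] at h0
    change _ ∈ Submodule.span _ _
    rw [hs]
    refine Submodule.sum_mem _ fun j _ => ?_
    by_cases hj : j ∈ S
    · exact Submodule.smul_of_tower_mem _ _ (Submodule.subset_span ⟨j, hj, rfl⟩)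
    · have := h0 j (Finset.mem_univ _)
      rw [if_neg hj] at this
      rw [this, zero_smul]
      exact Submodule.zero_mem _

/-- The linear forms of non-negative integral level. -/
def nonnegForms : Set (H → ℂ) := {χ | ∃ φ : Dual ℂ H, χ = φ ∧ ∃ n : ℕ, level b S φ = n}

/-- The negatives of the roots of the nilradical. -/
def negForms : Set (H → ℂ) := {χ | ∃ γ ∈ nilRoots b S, χ = -((γ : Weight ℂ H L) : H → ℂ)}

theorem disjoint_forms : Disjoint (negForms b S) (nonnegForms b S) := by
  rw [Set.disjoint_left]
  rintro _ ⟨γ, hγ, rfl⟩ ⟨φ, h, n, hn⟩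
  obtain ⟨m, hm, hm'⟩ := level_pos b S hγ.1
  have : φ = -(rootSystem H).root γ := by
    ext x
    rw [← h]
    rfl
  rw [this, map_neg, hm] at hn
  have h3 : ((m + n : ℕ) : ℂ) = 0 := by push_cast; rw [← hn]; ring
  have h4 : m + n = 0 := by exact_mod_cast h3
  exact hγ.2 (hm' (by omega))

theorem weight_cases (χ : Weight ℂ H L) :
    χ.IsZero ∨ (∃ γ ∈ leviRoots b S, (γ : Weight ℂ H L) = χ) ∨
      (∃ γ ∈ nilRoots b S, (γ : Weight ℂ H L) = χ) ∨ (χ : H → ℂ) ∈ negForms b S := by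
  by_cases h0 : χ.IsZero
  · exact .inl h0
  right
  let γ : H.root := ⟨χ, by simpa using h0⟩
  by_cases hl : γ ∈ leviRoots b S
  · exact .inl ⟨γ, hl, rfl⟩
  right
  let _ := (rootSystem H).indexNeg
  rcases RootPairing.Base.IsPos.or_neg b γ with hp | hp
  · exact .inl ⟨γ, ⟨hp, hl⟩, rfl⟩
  · right
    have hr : (rootSystem H).root (-γ) = -(rootSystem H).root γ := by
      change (rootSystem H).root ((rootSystem H).reflectionPerm γ γ) = _
      rw [RootPairing.root_reflectionPerm, RootPairing.reflection_apply_self]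
    refine ⟨-γ, ⟨hp, fun h => hl ?_⟩, ?_⟩
    · change _ ∈ Submodule.span _ _ at h
      rw [hr] at h
      exact neg_mem_iff.1 h
    · funext x
      have := LinearMap.congr_fun hr x
      change ((-γ : H.root) : Weight ℂ H L) x = -χ x at this
      change χ x = -((-γ : H.root) : Weight ℂ H L) x
      rw [this, neg_neg]

theorem levi_mem {γ : H.root} (h : γ ∈ leviRoots b S) :
    ((γ : Weight ℂ H L) : H → ℂ) ∈ nonnegForms b S :=
  ⟨(rootSystem H).root γ, rfl, 0, by rw [level_levi b S h]; simp⟩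

theorem nil_mem {γ : H.root} (h : γ ∈ nilRoots b S) :
    ((γ : Weight ℂ H L) : H → ℂ) ∈ nonnegForms b S := by
  obtain ⟨n, hn, -⟩ := level_pos b S h.1
  exact ⟨(rootSystem H).root γ, rfl, n, hn⟩

theorem parabolicSpace_eq :
    parabolicSpace b S = ⨆ χ, ⨆ (_ : χ ∈ nonnegForms b S), rootSpace H χ := by
  apply le_antisymm
  · refine sup_le (sup_le ?_ ?_) ?_
    · rw [← LieAlgebra.rootSpace_zero_eq ℂ L H]
      exact le_iSup₂_of_le (f := fun χ _ => rootSpace H χ) 0 ⟨0, rfl, 0, by simp⟩ le_rfl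
    · exact iSup₂_le fun γ h =>
        le_iSup₂_of_le (f := fun χ _ => rootSpace H χ) _ (levi_mem b S h) le_rfl
    · exact iSup₂_le fun γ h =>
        le_iSup₂_of_le (f := fun χ _ => rootSpace H χ) _ (nil_mem b S h) le_rfl
  · refine iSup₂_le fun χ hχ => ?_
    by_cases hb : rootSpace H χ = ⊥
    · rw [hb]; exact bot_le
    rcases weight_cases b S ⟨χ, hb⟩ with h | ⟨γ, hγ, h⟩ | ⟨γ, hγ, h⟩ | h
    · have : χ = 0 := h
      rw [this, LieAlgebra.rootSpace_zero_eq ℂ L H]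
      exact le_sup_of_le_left le_sup_left
    · obtain rfl : ((γ : Weight ℂ H L) : H → ℂ) = χ := by rw [h]; rfl
      exact le_sup_of_le_left (le_sup_of_le_right
        (le_iSup₂_of_le (f := fun (γ : H.root) (_ : γ ∈ leviRoots b S) =>
          rootSpace H ((γ : Weight ℂ H L) : H → ℂ)) γ hγ le_rfl))
    · obtain rfl : ((γ : Weight ℂ H L) : H → ℂ) = χ := by rw [h]; rfl
      exact le_sup_of_le_right
        (le_iSup₂_of_le (f := fun (γ : H.root) (_ : γ ∈ nilRoots b S) =>
          rootSpace H ((γ : Weight ℂ H L) : H → ℂ)) γ hγ le_rfl)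
    · exact absurd hχ (Set.disjoint_left.1 (disjoint_forms b S) h)

theorem oppNilradical_eq :
    oppNilradical b S = ⨆ χ, ⨆ (_ : χ ∈ negForms b S), rootSpace H χ := by
  apply le_antisymm
  · exact iSup₂_le fun γ h =>
      le_iSup₂_of_le (f := fun χ _ => rootSpace H χ) _ ⟨γ, h, rfl⟩ le_rfl
  · refine iSup₂_le ?_
    rintro _ ⟨γ, h, rfl⟩
    exact le_iSup₂_of_le (f := fun (γ : H.root) (_ : γ ∈ nilRoots b S) =>
          rootSpace H (-((γ : Weight ℂ H L) : H → ℂ))) γ h le_rfl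

/-- The standard parabolic subalgebra attached to a set `Σ` of simple roots. -/
def parabolic : LieSubalgebra ℂ L where
  __ := (parabolicSpace b S).toSubmodule
  lie_mem' {x y} hx hy := by
    change x ∈ parabolicSpace b S at hx
    change y ∈ parabolicSpace b S at hy
    change ⁅x, y⁆ ∈ parabolicSpace b S
    rw [parabolicSpace_eq] at hx hy ⊢
    refine mem_biSup_genWeightSpace_of ?_ hx hy
    rintro _ ⟨φ, rfl, m, hm⟩ _ ⟨ψ, rfl, n, hn⟩
    exact ⟨φ + ψ, rfl, m + n, by rw [map_add, hm, hn]; push_cast; rfl⟩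

theorem isCompl_oppNilradical_parabolic :
    IsCompl (oppNilradical b S).toSubmodule (parabolic b S).toSubmodule := by
  change IsCompl _ (parabolicSpace b S).toSubmodule
  rw [LieSubmodule.isCompl_toSubmodule]
  constructor
  · rw [parabolicSpace_eq, oppNilradical_eq]
    exact (iSupIndep_genWeightSpace ℂ H L).disjoint_biSup_biSup (disjoint_forms b S)
  · rw [codisjoint_iff, eq_top_iff, ← iSup_genWeightSpace_eq_top' ℂ H L]
    refine iSup_le fun χ => ?_
    rcases weight_cases b S χ with h | ⟨γ, hγ, h⟩ | ⟨γ, hγ, h⟩ | h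
    · refine le_sup_of_le_right ?_
      rw [parabolicSpace_eq]
      exact le_iSup₂_of_le (f := fun χ _ => rootSpace H χ) _ ⟨0, h, 0, by simp⟩ le_rfl
    · refine le_sup_of_le_right ?_
      rw [parabolicSpace_eq, ← h]
      exact le_iSup₂_of_le (f := fun χ _ => rootSpace H χ) _ (levi_mem b S hγ) le_rfl
    · refine le_sup_of_le_right ?_
      rw [parabolicSpace_eq, ← h]
      exact le_iSup₂_of_le (f := fun χ _ => rootSpace H χ) _ (nil_mem b S hγ) le_rfl
    · refine le_sup_of_le_left ?_
      rw [oppNilradical_eq]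
      exact le_iSup₂_of_le (f := fun χ _ => rootSpace H χ) _ h le_rfl

/-- A choice of root vectors `f γ` of weight `-γ`, for the roots `γ` of the nilradical. -/
structure NegRootVectors where
  /-- The root vectors. -/
  vec : nilRoots b S → L
  mem : ∀ γ : nilRoots b S, vec γ ∈ rootSpace H (-(((γ : H.root) : Weight ℂ H L) : H → ℂ))
  ne_zero : ∀ γ, vec γ ≠ 0

variable {b S} (f : NegRootVectors b S)

theorem NegRootVectors.linearIndependent : LinearIndependent ℂ f.vec := by
  have h1 : iSupIndep fun χ : H → ℂ => (rootSpace H χ).toSubmodule :=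
    LieSubmodule.iSupIndep_toSubmodule.2 (iSupIndep_genWeightSpace ℂ H L)
  have hinj : Function.Injective
      (fun γ : nilRoots b S => -(((γ : H.root) : Weight ℂ H L) : H → ℂ)) := by
    intro γ δ h
    apply Subtype.ext
    apply Subtype.ext
    exact DFunLike.coe_injective (neg_injective h)
  exact (h1.comp hinj).linearIndependent _ f.mem f.ne_zero

theorem NegRootVectors.span_eq :
    Submodule.span ℂ (Set.range f.vec) = (oppNilradical b S).toSubmodule := by
  apply le_antisymm
  · rw [Submodule.span_le]
    rintro _ ⟨γ, rfl⟩
    have : rootSpace H (-(((γ : H.root) : Weight ℂ H L) : H → ℂ)) ≤ oppNilradical b S :=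
      le_iSup₂_of_le (f := fun (γ : H.root) (_ : γ ∈ nilRoots b S) =>
          rootSpace H (-((γ : Weight ℂ H L) : H → ℂ))) γ γ.2 le_rfl
    exact this (f.mem γ)
  · rw [oppNilradical]
    simp only [LieSubmodule.iSup_toSubmodule]
    refine iSup₂_le fun γ hγ x hx => ?_
    have hnz : (-(γ : Weight ℂ H L)).IsNonZero := by
      have := LieSubalgebra.isNonZero_coe_root γ
      simpa using this
    have h1 := finrank_rootSpace_eq_one (-(γ : Weight ℂ H L)) hnz
    have hv : (⟨f.vec ⟨γ, hγ⟩, f.mem ⟨γ, hγ⟩⟩ : rootSpace H (-(γ : Weight ℂ H L))) ≠ 0 := by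
      intro h
      exact f.ne_zero ⟨γ, hγ⟩ (congrArg Subtype.val h)
    obtain ⟨c, hc⟩ := (finrank_eq_one_iff_of_nonzero' _ hv).1 h1 ⟨x, hx⟩
    have : c • f.vec ⟨γ, hγ⟩ = x := congrArg Subtype.val hc
    rw [← this]
    exact Submodule.smul_mem _ _ (Submodule.subset_span ⟨_, rfl⟩)

/-- The root vectors `f γ` as a basis of the opposite nilradical. -/
def NegRootVectors.basis : Basis (nilRoots b S) ℂ (oppNilradical b S).toSubmodule :=
  (Basis.span f.linearIndependent).map (LinearEquiv.ofEq _ _ f.span_eq)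

theorem NegRootVectors.basis_apply (γ : nilRoots b S) : (f.basis γ : L) = f.vec γ := by
  simp [NegRootVectors.basis, Basis.span_apply]

end Parabolic

section Enveloping

attribute [local instance 100] LieRing.ofAssociativeRing

variable {L : Type*} [LieRing L] [LieAlgebra ℂ L]

/-- The universal enveloping algebra over `ℂ`. -/
abbrev Env (L : Type*) [LieRing L] [LieAlgebra ℂ L] : Type _ := UniversalEnvelopingAlgebra ℂ L

/-- The canonical map from a Lie algebra to its enveloping algebra. -/
abbrev envι (a : L) : Env L := UniversalEnvelopingAlgebra.ι ℂ a

theorem ad_iterate_add (R : Type*) [Ring R] (t r s : R) (n : ℕ) :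
    (fun z : R => t * z - z * t)^[n] (r + s) =
      (fun z : R => t * z - z * t)^[n] r + (fun z : R => t * z - z * t)^[n] s := by
  induction n generalizing r s with
  | zero => rfl
  | succ n ih =>
    simp only [Function.iterate_succ_apply]
    rw [← ih]
    congr 1
    noncomm_ring

theorem ad_iterate_zero (R : Type*) [Ring R] (t : R) (n : ℕ) :
    (fun z : R => t * z - z * t)^[n] 0 = 0 :=
  Function.iterate_fixed (by simp) n

theorem ad_iterate_of_le {R : Type*} [Ring R] {t r : R} {m n : ℕ} (h : m ≤ n)
    (hm : (fun z : R => t * z - z * t)^[m] r = 0) : (fun z : R => t * z - z * t)^[n] r = 0 := by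
  obtain ⟨k, rfl⟩ := Nat.exists_eq_add_of_le h
  rw [add_comm, Function.iterate_add_apply, hm, ad_iterate_zero]

theorem ad_iterate_mul {R : Type*} [Ring R] {t : R} (N : ℕ) : ∀ (m n : ℕ) (r s : R), m + n = N →
    (fun z : R => t * z - z * t)^[m] r = 0 → (fun z : R => t * z - z * t)^[n] s = 0 →
    (fun z : R => t * z - z * t)^[N] (r * s) = 0 := by
  induction N with
  | zero =>
    intro m n r s h hm _
    obtain rfl : m = 0 := by omega
    have : r = 0 := hm
    simp [this]
  | succ N ih =>
    intro m n r s h hm hn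
    rcases m with _ | m
    · have : r = 0 := hm
      rw [this, zero_mul, ad_iterate_zero]
    rcases n with _ | n
    · have : s = 0 := hn
      rw [this, mul_zero, ad_iterate_zero]
    have key : t * (r * s) - r * s * t = (t * r - r * t) * s + r * (t * s - s * t) := by
      noncomm_ring
    rw [Function.iterate_succ_apply, key, ad_iterate_add,
      ih m (n + 1) _ _ (by omega) hm hn, ih (m + 1) n _ _ (by omega) hm hn, add_zero]

theorem isLocallyAdNilpotent_envι (a : L) (ha : IsNilpotent (LieAlgebra.ad ℂ L a)) :
    IsLocallyAdNilpotent (envι a) := by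
  obtain ⟨N, hN⟩ := ha
  intro r
  obtain ⟨r, rfl⟩ : ∃ r', UniversalEnvelopingAlgebra.mkAlgHom ℂ L r' = r :=
    RingCon.mkₐ_surjective _ r
  induction r using TensorAlgebra.induction with
  | algebraMap c =>
    refine ⟨1, ?_⟩
    simp only [AlgHom.commutes, Function.iterate_one]
    rw [Algebra.commutes, sub_self]
  | ι y =>
    refine ⟨N, ?_⟩
    change (fun z : Env L => envι a * z - z * envι a)^[N] (envι y) = 0
    have : ∀ (k : ℕ) (y : L), (fun z : Env L => envι a * z - z * envι a)^[k] (envι y) =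
        envι ((LieAlgebra.ad ℂ L a ^ k) y) := by
      intro k
      induction k with
      | zero => intro y; rfl
      | succ k ih =>
        intro y
        rw [Function.iterate_succ_apply, pow_succ, Module.End.mul_apply, ← ih, LieAlgebra.ad_apply]
        congr 1
        exact (LieHom.map_lie (UniversalEnvelopingAlgebra.ι ℂ) a y).symm
    rw [this, hN]
    exact map_zero (UniversalEnvelopingAlgebra.ι ℂ : L →ₗ⁅ℂ⁆ Env L)
  | mul r s hr hs =>
    obtain ⟨m, hm⟩ := hr
    obtain ⟨n, hn⟩ := hs
    exact ⟨m + n, by rw [map_mul]; exact ad_iterate_mul _ m n _ _ rfl hm hn⟩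
  | add r s hr hs =>
    obtain ⟨m, hm⟩ := hr
    obtain ⟨n, hn⟩ := hs
    refine ⟨m + n, ?_⟩
    rw [map_add, ad_iterate_add, ad_iterate_of_le (by omega) hm, ad_iterate_of_le (by omega) hn,
      add_zero]

/-- The left module over `R` on the space of a representation `φ` of `R`. -/
def Via {R V : Type*} [Ring R] [AddCommGroup V] [Module ℂ V] (_φ : R →+* End ℂ V) : Type _ := V

namespace Via
variable {R V : Type*} [Ring R] [AddCommGroup V] [Module ℂ V] (φ : R →+* End ℂ V)

instance : AddCommGroup (Via φ) := inferInstanceAs (AddCommGroup V)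
instance : Module R (Via φ) := Module.compHom V φ

/-- The identification of the underlying spaces. -/
def of : V ≃+ Via φ := AddEquiv.refl V

theorem smul_of (r : R) (v : V) : r • of φ v = of φ (φ r v) := rfl

end Via

/-- The algebra `A ⊗ End F` acting on `V ⊗ F`, for a representation `V` of `A`. -/
def tensorRep {A V : Type*} [Ring A] [Algebra ℂ A] [AddCommGroup V] [Module ℂ V]
    (ρ : A →ₐ[ℂ] End ℂ V) (F : Type*) [AddCommGroup F] [Module ℂ F] :
    A ⊗[ℂ] End ℂ F →ₐ[ℂ] End ℂ (V ⊗[ℂ] F) :=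
  Module.endTensorEndAlgHom.comp (Algebra.TensorProduct.map ρ (AlgHom.id ℂ (End ℂ F)))

theorem tensorRep_tmul {A V : Type*} [Ring A] [Algebra ℂ A] [AddCommGroup V] [Module ℂ V]
    (ρ : A →ₐ[ℂ] End ℂ V) (F : Type*) [AddCommGroup F] [Module ℂ F] (a : A) (T : End ℂ F)
    (v : V) (w : F) : tensorRep ρ F (a ⊗ₜ T) (v ⊗ₜ w) = ρ a v ⊗ₜ T w := rfl

/-- The value at a nilpotent endomorphism `T` of a formal power series `q`. -/
def nilEval {V : Type*} [AddCommGroup V] [Module ℂ V] (q : PowerSeries ℂ) (T : End ℂ V) :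
    End ℂ V :=
  ∑ n ∈ Finset.range (nilpotencyClass T), PowerSeries.coeff n q • T ^ n

/-- The power series `z e ^ z / (e ^ z - 1)`; see `todd_mul`. -/
def todd : PowerSeries ℂ := bernoulli'PowerSeries ℂ

theorem todd_mul : todd * (PowerSeries.exp ℂ - 1) = PowerSeries.X * PowerSeries.exp ℂ :=
  bernoulli'PowerSeries_mul_exp_sub_one ℂ

end Enveloping

section Modules

attribute [local instance 100] LieRing.ofAssociativeRing

open LieAlgebra LieAlgebra.IsKilling LieModule

variable {L : Type*} [LieRing L] [LieAlgebra ℂ L] [FiniteDimensional ℂ L]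
  [LieAlgebra.IsSemisimple ℂ L] {H : LieSubalgebra ℂ L} [H.IsCartanSubalgebra]
  (b : (rootSystem H).Base) (S : Set b.support)

instance : Fintype (nilRoots b S) := Fintype.ofFinite _

/-- The weights that are dominant and algebraically integral for the parabolic subalgebra. -/
def dominantWeights : Set (Dual ℂ H) :=
  {lam | ∀ i ∈ S, ∃ n : ℕ, lam ((rootSystem H).coroot i) = n}

/-- Half the sum of the roots of the nilradical. -/
def rhoU : Dual ℂ H :=
  (1 / 2 : ℂ) • ∑ γ : nilRoots b S, (rootSystem H).root γ

/-- `F` is a simple finite-dimensional module over the parabolic subalgebra, with highest weight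
`lam`. -/
structure IsSimpleHighestWeight (lam : Dual ℂ H) (F : Type*) [AddCommGroup F] [Module ℂ F]
    [LieRingModule (parabolic b S) F] [LieModule ℂ (parabolic b S) F] : Prop where
  finiteDimensional : FiniteDimensional ℂ F
  irreducible : LieModule.IsIrreducible ℂ (parabolic b S) F
  exists_highest : ∃ v : F, v ≠ 0 ∧
    (∀ (a : parabolic b S) (ha : (a : L) ∈ H), ⁅a, v⁆ = lam ⟨a, ha⟩ • v) ∧
    ∀ γ : H.root, b.IsPos γ → ∀ a : parabolic b S,
      (a : L) ∈ rootSpace H ((γ : Weight ℂ H L) : H → ℂ) → ⁅a, v⁆ = 0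

section Induced

variable (F : Type*) [AddCommGroup F] [Module ℂ F] [LieRingModule (parabolic b S) F]
  [LieModule ℂ (parabolic b S) F]

/-- The homomorphism `U(𝔭) → U(𝔤)`. -/
def envIncl : Env (parabolic b S) →ₐ[ℂ] Env L :=
  UniversalEnvelopingAlgebra.lift ℂ ((UniversalEnvelopingAlgebra.ι ℂ).comp (parabolic b S).incl)

/-- The right action of `U(𝔭)` on `U(𝔤)`. -/
def envRight : (Env (parabolic b S))ᵐᵒᵖ →+* End (Env L) (Env L) :=
  (RingEquiv.moduleEndSelf (Env L)).toRingHom.comp (envIncl b S).toRingHom.op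

/-- The left action of `U(𝔭)` on a `𝔭`-module. -/
def envLeft : Env (parabolic b S) →+* AddMonoid.End F :=
  (Module.toAddMonoidEnd (End ℂ F) F).comp
    (UniversalEnvelopingAlgebra.lift ℂ (LieModule.toEnd ℂ (parabolic b S) F)).toRingHom

/-- The `𝔤`-module `U(𝔤) ⊗_{U(𝔭)} F` induced from a `𝔭`-module `F`. -/
abbrev GenVerma : Type _ := BalancedTensor (envRight b S) (envLeft b S F)

end Induced

variable {b S} (f : NegRootVectors b S)

instance (γ : nilRoots b S) : OreLocalization.OreSet (Submonoid.powers (envι (f.vec γ))) :=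
  (isLocallyAdNilpotent_envι _ (isNilpotent_ad_of_mem_rootSpace H (by
    have := LieSubalgebra.isNonZero_coe_root (γ : H.root)
    exact fun h => this (neg_eq_zero.1 h)) (f.mem γ))).nonempty_oreSet.some

/-- The `𝔤`-module obtained by applying the twisting functor attached to `f γ` to the module induced
from `F`. -/
abbrev GTModule (γ : nilRoots b S) (F : Type*) [AddCommGroup F] [Module ℂ F]
    [LieRingModule (parabolic b S) F] [LieModule ℂ (parabolic b S) F] : Type _ :=
  Twist (envι (f.vec γ)) (GenVerma b S F)

/-- The polynomial functions on the opposite nilradical. -/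
abbrev PolyFun (b : (rootSystem H).Base) (S : Set b.support) : Type _ :=
  MvPolynomial (nilRoots b S) ℂ

/-- The Weyl algebra of the opposite nilradical. -/
abbrev WeylU (b : (rootSystem H).Base) (S : Set b.support) : Type _ := Weyl (nilRoots b S)

/-- The generic element `u(x) = ∑ x γ ⊗ f γ`. -/
def genericElt : PolyFun b S ⊗[ℂ] L := ∑ γ, MvPolynomial.X γ ⊗ₜ[ℂ] f.vec γ

/-- The endomorphism `ad u(x)`. -/
def adGeneric : End ℂ (PolyFun b S ⊗[ℂ] L) :=
  (LieAlgebra.ad (PolyFun b S) (PolyFun b S ⊗[ℂ] L) (genericElt f)).restrictScalars ℂ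

/-- The projection of `𝔤` onto the opposite nilradical along the parabolic subalgebra. -/
def projOpp (b : (rootSystem H).Base) (S : Set b.support) :
    L →ₗ[ℂ] (oppNilradical b S).toSubmodule :=
  Submodule.projectionOnto _ _ (isCompl_oppNilradical_parabolic b S)

/-- The projection of `𝔤` onto the parabolic subalgebra along the opposite nilradical. -/
def projPar (b : (rootSystem H).Base) (S : Set b.support) : L →ₗ[ℂ] parabolic b S :=
  Submodule.projectionOnto _ _ (isCompl_oppNilradical_parabolic b S).symm

/-- The coordinate of index `γ` of the component in the opposite nilradical, with polynomial
coefficients. -/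
def polyCoord (γ : nilRoots b S) : PolyFun b S ⊗[ℂ] L →ₗ[ℂ] PolyFun b S :=
  (TensorProduct.rid ℂ (PolyFun b S)).toLinearMap ∘ₗ
    LinearMap.lTensor (PolyFun b S) (f.basis.coord γ ∘ₗ projOpp b S)

/-- The component in the opposite nilradical, with polynomial coefficients. -/
def polyProjOpp (b : (rootSystem H).Base) (S : Set b.support) : End ℂ (PolyFun b S ⊗[ℂ] L) :=
  LinearMap.lTensor (PolyFun b S) ((oppNilradical b S).toSubmodule.subtype ∘ₗ projOpp b S)

/-- The operator `e ^ (- ad u(x)) a` with polynomial coefficients. -/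
def expTwist (a : L) : PolyFun b S ⊗[ℂ] L :=
  nilEval (PowerSeries.exp ℂ) (-adGeneric f) (1 ⊗ₜ a)

variable (F : Type*) [AddCommGroup F] [Module ℂ F] [LieRingModule (parabolic b S) F]
  [LieModule ℂ (parabolic b S) F]

/-- For the representation `σ` of `𝔭` on `F`, the map sending `q ⊗ a` to `q ⊗ σ(a_𝔭)`. -/
def polySigma : PolyFun b S ⊗[ℂ] L →ₗ[ℂ] WeylU b S ⊗[ℂ] End ℂ F :=
  TensorProduct.map Weyl.ofPoly.toLinearMap
    ((LieModule.toEnd ℂ (parabolic b S) F : parabolic b S →ₗ[ℂ] End ℂ F) ∘ₗ projPar b S)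

/-- The element of `A ⊗ End F` by which `a ∈ 𝔤` acts:
`- ∑ γ [ (ad u(x) e ^ ad u(x) / (e ^ ad u(x) - 1)) (e ^ (- ad u(x)) a)_opp ]_γ ∂ γ
  + σ ((e ^ (- ad u(x)) a)_𝔭)`. -/
def piFormula (a : L) : WeylU b S ⊗[ℂ] End ℂ F :=
  -(∑ γ, (Weyl.ofPoly (polyCoord f γ
      (nilEval todd (adGeneric f) (polyProjOpp b S (expTwist f a)))) * Weyl.d γ) ⊗ₜ[ℂ] 1) +
    polySigma F (expTwist f a)

end Modules

end

/-! Write E_a = e^{-ad u(x)} a, a polynomial with values in 𝔤, and E_a = E_a^- + E_a^+ for its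
components in the opposite nilradical and in 𝔭. Then π(a) = D_a ⊗ 1 + σ(E_a^+), where D_a is the
vector field with D_a u = -todd(ad u) E_a^-. Differentiating the exponential gives D E_c = -[((1 -
e^{-ad u}) / ad u)(D u), E_c] for every derivation D of the coefficients, so the Todd factor is
exactly what makes D_a E_c = [E_a^-, E_c] (`polyDer_field_expTwist`). Since e^{-ad u} is an
automorphism, [E_a, E_c] = E_[a,c]; expand this by components (`lie_components`). The opposite part
yields D_[a,c] = [D_a, D_c] (`field_lie`), because a derivation is determined by its effect on all
E_c, 𝔤 being centreless. The parabolic part supplies the remaining terms of `piFormula_lie`.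

Both quotients of the Weyl algebra are Fock modules (`exists_quotient_equiv`). On the vacuum 1 of
ℂ[∂], which every x_γ kills, an element of 𝔭 acts on 1 ⊗ F' by σ minus a trace character
(`tensorRep_piFormula_one`). The character is 2ρ_𝔲 on the Cartan subalgebra and zero on root
vectors, so it turns highest weight λ + 2ρ_𝔲 into λ, and 1 ⊗ F' is a copy of F. This induces a map
from the induced module to ℂ[∂] ⊗ F'. Each f_γ acts as -∂_γ plus terms that do not raise degree, so
normally ordered words in the f_γ, applied to the vacuum, have the monomials as leading terms up to
sign. These words span the induced module, hence the map is bijective (`nonempty_genVerma_equiv`);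
only the spanning half of the Poincaré-Birkhoff-Witt theorem is needed.

For the twist, ℂ[∂] is embedded in its localization at ∂_α, whose quotient is the Fock module ℂ[x_α,
∂_γ, γ ≠ α]. For a suitable weighted filtration, bounded below, f_α acts as -∂_α plus strictly
lowering terms. Hence it is bijective on the localization and locally nilpotent on the quotient, and
these two properties identify the quotient with the twist (`nonempty_twist_equiv`). -/

noncomputable section

/-! ### The Weyl algebra and polynomial vector fields. -/

namespace Weyl
variable {σ : Type*}

/-- Induction on the elements of the Weyl algebra, through left multiplication by generators. -/
theorem induction_left {P : Weyl σ → Prop} (one : P 1) (add : ∀ a b, P a → P b → P (a + b))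
    (smul : ∀ (c : ℂ) a, P a → P (c • a)) (x_mul : ∀ i a, P a → P (x i * a))
    (d_mul : ∀ i a, P a → P (d i * a)) (a : Weyl σ) : P a := by
  obtain ⟨m, hm, hx, hd⟩ : ∃ m : FreeAlgebra ℂ (σ ⊕ σ) →ₐ[ℂ] Weyl σ, Function.Surjective m ∧
      (∀ i, m (FreeAlgebra.ι ℂ (.inl i)) = x i) ∧ ∀ i, m (FreeAlgebra.ι ℂ (.inr i)) = d i :=
    ⟨RingQuot.mkAlgHom ℂ (WeylRel σ), RingQuot.mkAlgHom_surjective ℂ (WeylRel σ),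
      fun _ => rfl, fun _ => rfl⟩
  suffices ∀ (r : FreeAlgebra ℂ (σ ⊕ σ)) (a : Weyl σ), P a → P (m r * a) by
    obtain ⟨r, rfl⟩ := hm a
    have h := this r 1 one
    rwa [mul_one] at h
  intro r
  induction r using FreeAlgebra.induction with
  | grade0 c =>
    intro a ha
    rw [AlgHom.commutes, ← Algebra.smul_def]
    exact smul c a ha
  | grade1 i =>
    intro a ha
    rcases i with i | i
    · rw [hx]; exact x_mul i a ha
    · rw [hd]; exact d_mul i a ha
  | mul r s hr hs =>
    intro a ha
    rw [map_mul, mul_assoc]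
    exact hr _ (hs _ ha)
  | add r s hr hs =>
    intro a ha
    rw [map_add, add_mul]
    exact add _ _ (hr _ ha) (hs _ ha)

/-- A linear map that commutes with the generators of the Weyl algebra commutes with all of it. -/
theorem intertwine {V W : Type*} [AddCommGroup V] [Module ℂ V] [AddCommGroup W] [Module ℂ W]
    (ρ : Weyl σ →ₐ[ℂ] End ℂ V) (τ : Weyl σ →ₐ[ℂ] End ℂ W) (φ : V →ₗ[ℂ] W)
    (hx : ∀ i v, φ (ρ (x i) v) = τ (x i) (φ v)) (hd : ∀ i v, φ (ρ (d i) v) = τ (d i) (φ v))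
    (a : Weyl σ) (v : V) : φ (ρ a v) = τ a (φ v) := by
  induction a using induction_left generalizing v with
  | one => simp
  | add a b ha hb => simp [ha, hb]
  | smul c a ha => simp [ha]
  | x_mul i a ha => simp [ha, hx]
  | d_mul i a ha => simp [ha, hd]

theorem ofPoly_X (i : σ) : ofPoly (MvPolynomial.X i : MvPolynomial σ ℂ) = x i :=
  aevalComm_X _ _ _

theorem ofFock_X (T : Set σ) (i : σ) : ofFock T (MvPolynomial.X i) = creator T i :=
  aevalComm_X _ _ _

theorem d_mul_ofPoly (i : σ) (p : MvPolynomial σ ℂ) :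
    d i * ofPoly p = ofPoly p * d i + ofPoly (MvPolynomial.pderiv i p) := by
  classical
  induction p using MvPolynomial.induction_on with
  | C a =>
    rw [MvPolynomial.pderiv_C, map_zero, add_zero, ← MvPolynomial.algebraMap_eq, AlgHom.commutes,
      Algebra.commutes]
  | add p q hp hq => simp only [map_add, mul_add, add_mul, hp, hq]; abel
  | mul_X p j hp =>
    rw [map_mul, ← mul_assoc, hp, Derivation.leibniz, map_add, smul_eq_mul, smul_eq_mul, map_mul,
      map_mul, ofPoly_X, MvPolynomial.pderiv_X, add_mul, mul_assoc _ (d i), mul_assoc _ (x j)]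
    have hc : x j * ofPoly (MvPolynomial.pderiv i p) = ofPoly (MvPolynomial.pderiv i p) * x j := by
      rw [← ofPoly_X, ← map_mul, ← map_mul, mul_comm]
    rw [hc]
    by_cases h : i = j
    · subst h
      rw [d_mul_x_self, Pi.single_eq_same, map_one]
      noncomm_ring
    · rw [d_mul_x_of_ne h, Pi.single_eq_of_ne (Ne.symm h), map_zero]
      noncomm_ring

/-- The vector field attached to a derivation of the polynomial ring. -/
def vecField [Fintype σ] (D : Derivation ℂ (MvPolynomial σ ℂ) (MvPolynomial σ ℂ)) : Weyl σ :=
  ∑ i, ofPoly (D (MvPolynomial.X i)) * d i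

section Fintype

variable [Fintype σ]

theorem derivation_sum_apply (D : σ → Derivation ℂ (MvPolynomial σ ℂ) (MvPolynomial σ ℂ))
    (p : MvPolynomial σ ℂ) : (∑ i, D i) p = ∑ i, D i p := by
  have : ⇑(∑ i, D i) = ∑ i, ⇑(D i) := map_sum Derivation.coeFnAddMonoidHom _ _
  rw [this, Finset.sum_apply]

theorem derivation_eq_sum (D : Derivation ℂ (MvPolynomial σ ℂ) (MvPolynomial σ ℂ))
    (p : MvPolynomial σ ℂ) :
    D p = ∑ i, D (MvPolynomial.X i) * MvPolynomial.pderiv i p := by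
  classical
  have : D = ∑ i, D (MvPolynomial.X i) • MvPolynomial.pderiv i := by
    refine MvPolynomial.derivation_ext fun j => ?_
    rw [derivation_sum_apply, Finset.sum_eq_single j]
    · simp
    · intro i _ hi
      simp [MvPolynomial.pderiv_X, Ne.symm hi]
    · simp
  conv_lhs => rw [this]
  rw [derivation_sum_apply]
  rfl

theorem vecField_mul_ofPoly (D : Derivation ℂ (MvPolynomial σ ℂ) (MvPolynomial σ ℂ))
    (p : MvPolynomial σ ℂ) :
    vecField D * ofPoly p = ofPoly p * vecField D + ofPoly (D p) := by
  rw [vecField, Finset.sum_mul, Finset.mul_sum, derivation_eq_sum D p, map_sum,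
    ← Finset.sum_add_distrib]
  refine Finset.sum_congr rfl fun i _ => ?_
  rw [mul_assoc, d_mul_ofPoly, mul_add, ← mul_assoc, ← mul_assoc, ← map_mul, ← map_mul, mul_comm _ p,
    map_mul]

/-- The second-order parts of the two products agree, since the ∂ i commute; only the first-order
part, where one derivation hits the coefficients of the other, survives in the commutator. -/
theorem vecField_lie (D₁ D₂ : Derivation ℂ (MvPolynomial σ ℂ) (MvPolynomial σ ℂ)) :
    vecField D₁ * vecField D₂ - vecField D₂ * vecField D₁ = vecField ⁅D₁, D₂⁆ := by
  have h (D₁ D₂ : Derivation ℂ (MvPolynomial σ ℂ) (MvPolynomial σ ℂ)) :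
      vecField D₁ * vecField D₂ =
        ∑ i, ∑ j, ofPoly (D₂ (MvPolynomial.X i) * D₁ (MvPolynomial.X j)) * d i * d j +
        ∑ i, ofPoly (D₁ (D₂ (MvPolynomial.X i))) * d i := by
    conv_lhs => rw [vecField.eq_1 D₂]
    rw [Finset.mul_sum, ← Finset.sum_add_distrib]
    refine Finset.sum_congr rfl fun i _ => ?_
    rw [← mul_assoc, vecField_mul_ofPoly, add_mul, vecField, Finset.mul_sum, Finset.sum_mul]
    congr 1
    refine Finset.sum_congr rfl fun j _ => ?_
    rw [map_mul]
    simp only [mul_assoc]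
    rw [d_mul_d]
  have h2 : ∑ i, ∑ j, ofPoly (D₂ (MvPolynomial.X i) * D₁ (MvPolynomial.X j)) * d i * d j =
      ∑ i, ∑ j, ofPoly (D₁ (MvPolynomial.X i) * D₂ (MvPolynomial.X j)) * d i * d j := by
    rw [Finset.sum_comm]
    refine Finset.sum_congr rfl fun i _ => Finset.sum_congr rfl fun j _ => ?_
    rw [mul_comm, mul_assoc, mul_assoc, d_mul_d]
  rw [h, h, h2, add_sub_add_left_eq_sub, vecField, ← Finset.sum_sub_distrib]
  refine Finset.sum_congr rfl fun i _ => ?_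
  rw [Derivation.commutator_apply, map_sub, sub_mul]

end Fintype

/-! ### Fock modules as quotients of the Weyl algebra. -/

open Classical in
/-- The left ideal generated by the `∂ i`, `i ∈ T`, and the `x j`, `j ∉ T`. -/
def idealFock (T : Set σ) : Submodule (Weyl σ) (Weyl σ) :=
  Submodule.span (Weyl σ) (Set.range fun i => if i ∈ T then d i else x i)

/-- With the singleton case below, this lets one normal ordering argument serve both ideals of the
theorem. -/
theorem idealFock_empty : idealFock (∅ : Set σ) = idealV σ := by
  simp only [idealFock, idealV, Set.mem_empty_iff_false, if_false]

theorem idealFock_singleton (a : σ) : idealFock ({a} : Set σ) = idealGT a := by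
  rw [idealFock, idealGT]
  congr 1
  ext z
  simp only [Set.mem_range, Set.mem_singleton_iff, Set.singleton_union, Set.mem_insert_iff,
    Set.mem_ofPred_eq]
  constructor
  · rintro ⟨i, rfl⟩
    split_ifs with h
    · exact .inl (by rw [h])
    · exact .inr ⟨i, h, rfl⟩
  · rintro (rfl | ⟨i, h, rfl⟩)
    · exact ⟨a, by simp⟩
    · exact ⟨i, by simp [h]⟩

theorem fockRep_creator (T : Set σ) (i : σ) (p : MvPolynomial σ ℂ) :
    fockRep T (creator T i) p = MvPolynomial.X i * p := by
  unfold creator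
  split_ifs with h
  · rw [fockRep_x, fockX, if_pos h]; rfl
  · rw [fockRep_d, fockD, if_neg h]; rfl

theorem fockRep_ofFock (T : Set σ) (q p : MvPolynomial σ ℂ) :
    fockRep T (ofFock T q) p = q * p := by
  induction q using MvPolynomial.induction_on generalizing p with
  | C a =>
    rw [← MvPolynomial.algebraMap_eq, AlgHom.commutes, AlgHom.commutes, Module.algebraMap_end_apply,
      Algebra.smul_def]
  | add q r hq hr => simp [hq, hr, add_mul]
  | mul_X q j hq => rw [map_mul, map_mul, Module.End.mul_apply, hq, ofFock_X, fockRep_creator, mul_assoc]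

-- An annihilator commutes with every creator except its partner, where the commutator is a scalar;
-- hence its commutator with polynomials in the creators is a derivation, a signed partial
-- derivative.
open Classical in
theorem annihilator_mul_ofFock (T : Set σ) (i : σ) (q : MvPolynomial σ ℂ) :
    (if i ∈ T then d i else x i) * ofFock T q - ofFock T q * (if i ∈ T then d i else x i) =
      (if i ∈ T then 1 else -1 : ℂ) • ofFock T (MvPolynomial.pderiv i q) := by
  set z : Weyl σ := if i ∈ T then d i else x i with hz
  induction q using MvPolynomial.induction_on with
  | C a =>
    rw [MvPolynomial.pderiv_C, map_zero, smul_zero, ← MvPolynomial.algebraMap_eq, AlgHom.commutes,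
      Algebra.commutes, sub_self]
  | add p q hp hq =>
    rw [map_add, map_add, map_add, smul_add, ← hp, ← hq]
    noncomm_ring
  | mul_X p j hp =>
    have h1 : z * creator T j - creator T j * z =
        (if i ∈ T then 1 else -1 : ℂ) • (if i = j then 1 else 0) := by
      simp only [hz, creator]
      by_cases hij : i = j
      · subst hij
        by_cases h : i ∈ T
        · simp [h, d_mul_x_self]
        · simp [h, d_mul_x_self]
      · rw [if_neg hij, smul_zero, sub_eq_zero]
        split_ifs with h h' h'
        · exact d_mul_x_of_ne hij
        · exact d_mul_d _ _
        · exact x_mul_x _ _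
        · exact (d_mul_x_of_ne (Ne.symm hij)).symm
    have h2 : z * (ofFock T p * creator T j) - ofFock T p * creator T j * z =
        (z * ofFock T p - ofFock T p * z) * creator T j +
          ofFock T p * (z * creator T j - creator T j * z) := by noncomm_ring
    rw [map_mul, ofFock_X, h2, hp, h1, Derivation.leibniz, MvPolynomial.pderiv_X, map_add,
      smul_eq_mul, smul_eq_mul, map_mul, map_mul, ofFock_X, smul_add, add_comm, Pi.single_apply]
    congr 1
    · rw [mul_smul_comm]
      congr 2
      by_cases hij : i = j <;> simp [hij, eq_comm]
    · rw [smul_mul_assoc, ← ofFock_X, ← map_mul, ← map_mul, mul_comm]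

/-- Normal ordering: an annihilator multiplying a polynomial in the creators can be moved to the
right, where it lies in the left ideal, at the cost of a derivative of that polynomial. -/
theorem exists_ofFock_add (T : Set σ) (a : Weyl σ) :
    ∃ q, a - ofFock T q ∈ idealFock T := by
  classical
  have hann (i : σ) (q : MvPolynomial σ ℂ) :
      ∃ q', (if i ∈ T then d i else x i) * ofFock T q - ofFock T q' ∈ idealFock T := by
    refine ⟨(if i ∈ T then 1 else -1 : ℂ) • MvPolynomial.pderiv i q, ?_⟩
    rw [map_smul, ← annihilator_mul_ofFock, sub_sub_cancel]
    exact Submodule.smul_mem _ _ (Submodule.subset_span ⟨i, rfl⟩)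
  have hcre (i : σ) (q : MvPolynomial σ ℂ) :
      ∃ q', creator T i * ofFock T q - ofFock T q' ∈ idealFock T :=
    ⟨MvPolynomial.X i * q, by rw [map_mul, ofFock_X, sub_self]; exact zero_mem _⟩
  have hstep (z a : Weyl σ) (hz : ∀ q, ∃ q', z * ofFock T q - ofFock T q' ∈ idealFock T)
      (ha : ∃ q, a - ofFock T q ∈ idealFock T) : ∃ q, z * a - ofFock T q ∈ idealFock T := by
    obtain ⟨q, hq⟩ := ha
    obtain ⟨q', hq'⟩ := hz q
    refine ⟨q', ?_⟩
    have := add_mem (Submodule.smul_mem _ z hq) hq'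
    rwa [smul_eq_mul, mul_sub, sub_add_sub_cancel] at this
  induction a using induction_left with
  | one => exact ⟨1, by rw [map_one, sub_self]; exact zero_mem _⟩
  | add a b ha hb =>
    obtain ⟨p, hp⟩ := ha
    obtain ⟨q, hq⟩ := hb
    exact ⟨p + q, by rw [map_add, add_sub_add_comm]; exact add_mem hp hq⟩
  | smul c a ha =>
    obtain ⟨p, hp⟩ := ha
    exact ⟨c • p, by rw [map_smul, ← smul_sub]; exact Submodule.smul_of_tower_mem _ c hp⟩
  | x_mul i a ha =>
    refine hstep _ _ (fun q => ?_) ha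
    by_cases h : i ∈ T
    · simpa [creator, h] using hcre i q
    · simpa [h] using hann i q
  | d_mul i a ha =>
    refine hstep _ _ (fun q => ?_) ha
    by_cases h : i ∈ T
    · simpa [h] using hann i q
    · simpa [creator, h] using hcre i q

theorem fockRep_idealFock (T : Set σ) {a : Weyl σ} (ha : a ∈ idealFock T) : fockRep T a 1 = 0 := by
  classical
  induction ha using Submodule.span_induction with
  | mem z hz =>
    obtain ⟨i, rfl⟩ := hz
    dsimp only
    split_ifs with h
    · rw [fockRep_d, fockD, if_pos h]; simp
    · rw [fockRep_x, fockX, if_neg h]; simp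
  | zero => simp
  | add a b _ _ ha hb => rw [map_add, LinearMap.add_apply, ha, hb, add_zero]
  | smul z a _ ha => rw [smul_eq_mul, map_mul, Module.End.mul_apply, ha, map_zero]

/-- The canonical identification of `A ⧸ (∂ i (i ∈ T), x j (j ∉ T))` with the Fock module. -/
theorem exists_quotient_equiv (T : Set σ) :
    ∃ c : (Weyl σ ⧸ idealFock T) ≃ₗ[Weyl σ] Via (fockRep T).toRingHom,
      ∀ q, c (Submodule.Quotient.mk (ofFock T q)) = Via.of _ q := by
  let φ : Weyl σ →ₗ[Weyl σ] Via (fockRep T).toRingHom :=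
    LinearMap.toSpanSingleton _ _ (Via.of _ 1)
  have hφ (a : Weyl σ) : φ a = Via.of _ (fockRep T a 1) := rfl
  have hφq (q) : φ (ofFock T q) = Via.of _ q := by rw [hφ, fockRep_ofFock, mul_one]
  have hle : idealFock T ≤ LinearMap.ker φ := fun a ha => by
    rw [LinearMap.mem_ker, hφ, fockRep_idealFock T ha, map_zero]
  refine ⟨LinearEquiv.ofBijective ((idealFock T).liftQ φ hle) ⟨?_, ?_⟩, fun q => ?_⟩
  -- Modulo the ideal, a kernel element is a polynomial `q` in the creators; its value on the vacuum
  -- is `q` itself, so `q = 0`.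
  · rw [← LinearMap.ker_eq_bot, Submodule.ker_liftQ_eq_bot]
    intro a ha
    obtain ⟨q, hq⟩ := exists_ofFock_add T a
    have h1 := hle hq
    rw [LinearMap.mem_ker, map_sub, LinearMap.mem_ker.1 ha, hφq, zero_sub, neg_eq_zero] at h1
    have : q = 0 := (Via.of _).injective (h1.trans (map_zero _).symm)
    rwa [this, map_zero, sub_zero] at hq
  · intro y
    exact ⟨Submodule.Quotient.mk (ofFock T ((Via.of _).symm y)), by
      rw [Submodule.liftQ_apply, hφq, AddEquiv.apply_symm_apply]⟩
  · exact hφq q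

end Weyl

/-! ### Perturbation of operators on filtered spaces. -/

section FilteredMaps

variable {Y : Type*} [AddCommGroup Y] [Module ℂ Y] {Fil : ℤ → Submodule ℂ Y}

/-- `D` strictly lowers a filtration that is bounded below, so successive correction by preimages
under `B`, taken within the same filtration step, terminates. -/
theorem bijective_add_of_lowering (hbot : ∀ k < 0, Fil k = ⊥) (hex : ∀ y, ∃ k, y ∈ Fil k)
    {B D : End ℂ Y} (hinj : Function.Injective B)
    (hsurj : ∀ k, ∀ y ∈ Fil k, ∃ z ∈ Fil k, B z = y) (hD : ∀ k, ∀ y ∈ Fil k, D y ∈ Fil (k - 1)) :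
    Function.Bijective (B + D) := by
  have hex' (y : Y) : ∃ n : ℕ, y ∈ Fil (n - 1) ∨ y ∈ Fil n := by
    obtain ⟨k, hk⟩ := hex y
    rcases lt_or_ge k 0 with h | h
    · rw [hbot k h, Submodule.mem_bot] at hk
      exact ⟨0, .inl (by rw [hk]; exact zero_mem _)⟩
    · exact ⟨k.toNat, .inr (by rwa [Int.toNat_of_nonneg h])⟩
  -- The shift by one makes `n = 0` correspond to the zero space, the base case of both inductions.
  have hex'' (y : Y) : ∃ n : ℕ, y ∈ Fil (n - 1) := by
    obtain ⟨n, h | h⟩ := hex' y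
    · exact ⟨n, h⟩
    · exact ⟨n + 1, by simpa using h⟩
  constructor
  · rw [injective_iff_map_eq_zero]
    intro y hy
    obtain ⟨n, hn⟩ := hex'' y
    induction n with
    | zero => rwa [hbot _ (by simp), Submodule.mem_bot] at hn
    | succ n ih =>
      apply ih
      rw [LinearMap.add_apply, add_eq_zero_iff_eq_neg] at hy
      push_cast at hn
      rw [add_sub_cancel_right] at hn
      -- `B y = -D y` lies one step lower and has a preimage there; by injectivity of `B` this
      -- preimage is `y`.
      obtain ⟨z, hz, hzy⟩ := hsurj _ _ (neg_mem (hD _ _ hn))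
      rw [← hy] at hzy
      rwa [← hinj hzy]
  · intro y
    obtain ⟨n, hn⟩ := hex'' y
    induction n generalizing y with
    | zero =>
      rw [hbot _ (by simp), Submodule.mem_bot] at hn
      exact ⟨0, by rw [hn, map_zero]⟩
    | succ n ih =>
      push_cast at hn
      rw [add_sub_cancel_right] at hn
      obtain ⟨z, hz, hzy⟩ := hsurj _ _ hn
      obtain ⟨z', hz'⟩ := ih (-D z) (neg_mem (hD _ _ hz))
      exact ⟨z + z', by rw [map_add, hz', LinearMap.add_apply, hzy, add_neg_cancel_right]⟩

/-- Modulo the next lower step, powers of `B + D` agree with powers of `B`. A power of `B` killing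
`y` therefore pushes `y` down one step, and finitely many steps reach zero. -/
theorem exists_pow_add_apply_eq_zero (hmono : Monotone Fil) (hbot : ∀ k < 0, Fil k = ⊥)
    (hex : ∀ y, ∃ k, y ∈ Fil k) {B D : End ℂ Y} (hB : ∀ k, ∀ y ∈ Fil k, B y ∈ Fil k)
    (hD : ∀ k, ∀ y ∈ Fil k, D y ∈ Fil (k - 1)) (hnil : ∀ y, ∃ n : ℕ, (B ^ n) y = 0) (y : Y) :
    ∃ n : ℕ, ((B + D) ^ n) y = 0 := by
  have hB' (k : ℤ) (n : ℕ) (y : Y) (hy : y ∈ Fil k) : (B ^ n) y ∈ Fil k := by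
    induction n with
    | zero => simpa using hy
    | succ n ih => rw [pow_succ']; exact hB _ _ ih
  have key (k : ℤ) (n : ℕ) (y : Y) (hy : y ∈ Fil k) :
      ((B + D) ^ n) y - (B ^ n) y ∈ Fil (k - 1) := by
    induction n with
    | zero => simp
    | succ n ih =>
      have h : ((B + D) ^ (n + 1)) y - (B ^ (n + 1)) y =
          B (((B + D) ^ n) y - (B ^ n) y) + D (((B + D) ^ n) y - (B ^ n) y) + D ((B ^ n) y) := by
        simp only [pow_succ', Module.End.mul_apply, LinearMap.add_apply, map_sub]
        abel
      rw [h]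
      exact add_mem (add_mem (hB _ _ ih) (hmono (by omega) (hD _ _ ih))) (hD _ _ (hB' _ _ _ hy))
  have main (n : ℕ) : ∀ y ∈ Fil (n - 1), ∃ m : ℕ, ((B + D) ^ m) y = 0 := by
    induction n with
    | zero =>
      intro y hy
      rw [hbot _ (by simp), Submodule.mem_bot] at hy
      exact ⟨0, by simpa using hy⟩
    | succ n ih =>
      intro y hy
      obtain ⟨m, hm⟩ := hnil y
      have h := key _ m y hy
      rw [hm, sub_zero, Nat.cast_succ, add_sub_cancel_right] at h
      obtain ⟨m', hm'⟩ := ih _ h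
      exact ⟨m' + m, by rw [pow_add, Module.End.mul_apply, hm']⟩
  obtain ⟨k, hk⟩ := hex y
  exact main (k + 1).toNat y (hmono (by omega) hk)

end FilteredMaps

/-! ### Weighted filtrations of Weyl algebra modules. -/

namespace Weyl

variable {σ : Type*}

/-- The polynomials of weighted degree at most `k`. -/
def polyFil (w : σ → ℤ) (k : ℤ) : Submodule ℂ (MvPolynomial σ ℂ) :=
  Submodule.span ℂ {p | ∃ m : σ →₀ ℕ, Finsupp.weight w m ≤ k ∧ p = MvPolynomial.monomial m 1}

/-- The polynomials all of whose monomials have weighted degree at least `k`. -/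
def polyHigh (w : σ → ℤ) (k : ℤ) : Submodule ℂ (MvPolynomial σ ℂ) :=
  Submodule.span ℂ {p | ∃ m : σ →₀ ℕ, k ≤ Finsupp.weight w m ∧ p = MvPolynomial.monomial m 1}

theorem monomial_mem_polyFil {w : σ → ℤ} {k : ℤ} {m : σ →₀ ℕ} (h : Finsupp.weight w m ≤ k) (c : ℂ) :
    MvPolynomial.monomial m c ∈ polyFil w k := by
  have : MvPolynomial.monomial m c = c • MvPolynomial.monomial m (1 : ℂ) := by
    rw [MvPolynomial.smul_monomial, smul_eq_mul, mul_one]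
  rw [this]
  exact Submodule.smul_mem _ _ (Submodule.subset_span ⟨m, h, rfl⟩)

theorem polyFil_induction {Y : Type*} [AddCommGroup Y] [Module ℂ Y] {w : σ → ℤ} {k : ℤ}
    {φ : MvPolynomial σ ℂ →ₗ[ℂ] Y} {N : Submodule ℂ Y}
    (h : ∀ m, Finsupp.weight w m ≤ k → φ (MvPolynomial.monomial m 1) ∈ N) {p : MvPolynomial σ ℂ}
    (hp : p ∈ polyFil w k) : φ p ∈ N := by
  have : polyFil w k ≤ N.comap φ := by
    rw [polyFil, Submodule.span_le]
    rintro _ ⟨m, hm, rfl⟩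
    exact h m hm
  exact this hp

theorem polyFil_mono (w : σ → ℤ) : Monotone (polyFil w) := fun _ _ h =>
  Submodule.span_mono fun _ ⟨m, hm, hp⟩ => ⟨m, hm.trans h, hp⟩

theorem weight_nonneg {w : σ → ℤ} (hw : ∀ i, 0 ≤ w i) (m : σ →₀ ℕ) : 0 ≤ Finsupp.weight w m := by
  rw [Finsupp.weight_apply]
  exact Finset.sum_nonneg fun i _ => nsmul_nonneg (hw i) _

theorem polyFil_eq_bot {w : σ → ℤ} (hw : ∀ i, 0 ≤ w i) {k : ℤ} (hk : k < 0) : polyFil w k = ⊥ := by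
  rw [polyFil, Submodule.span_eq_bot]
  rintro _ ⟨m, hm, -⟩
  have := weight_nonneg hw m
  omega

theorem exists_mem_polyFil (w : σ → ℤ) (p : MvPolynomial σ ℂ) : ∃ k, p ∈ polyFil w k := by
  induction p using MvPolynomial.induction_on' with
  | monomial m c => exact ⟨_, monomial_mem_polyFil le_rfl c⟩
  | add p q hp hq =>
    obtain ⟨k, hk⟩ := hp
    obtain ⟨l, hl⟩ := hq
    exact ⟨max k l, add_mem (polyFil_mono w (le_max_left _ _) hk)
      (polyFil_mono w (le_max_right _ _) hl)⟩

theorem X_mul_mem_polyFil {w : σ → ℤ} {k : ℤ} (i : σ) {p : MvPolynomial σ ℂ} (hp : p ∈ polyFil w k) :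
    MvPolynomial.X i * p ∈ polyFil w (k + w i) := by
  refine polyFil_induction (φ := LinearMap.mulLeft ℂ (MvPolynomial.X i)) (fun m hm => ?_) hp
  rw [LinearMap.mulLeft_apply, MvPolynomial.X, MvPolynomial.monomial_mul]
  refine monomial_mem_polyFil ?_ _
  rw [map_add, Finsupp.weight_single, one_smul]
  omega

theorem pderiv_mem_polyFil {w : σ → ℤ} {k : ℤ} (i : σ) {p : MvPolynomial σ ℂ}
    (hp : p ∈ polyFil w k) : MvPolynomial.pderiv i p ∈ polyFil w (k - w i) := by
  refine polyFil_induction (φ := (MvPolynomial.pderiv i).toLinearMap) (fun m hm => ?_) hp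
  change MvPolynomial.pderiv i _ ∈ _
  rw [MvPolynomial.pderiv_monomial]
  by_cases h : m i = 0
  · simp [h]
  · refine monomial_mem_polyFil ?_ _
    have := Finsupp.weight_sub_single_add (w := w) h
    omega

/-- A filtration of a representation of the Weyl algebra for which `x i` has degree `- w i` and
`∂ i` has degree `w i`. -/
structure IsFiltered {Y : Type*} [AddCommGroup Y] [Module ℂ Y] (ρ : Weyl σ →ₐ[ℂ] End ℂ Y)
    (w : σ → ℤ) (Fil : ℤ → Submodule ℂ Y) : Prop where
  mono : Monotone Fil
  eq_bot : ∀ k < 0, Fil k = ⊥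
  exists_mem : ∀ y, ∃ k, y ∈ Fil k
  x_mem : ∀ i k, ∀ y ∈ Fil k, ρ (x i) y ∈ Fil (k - w i)
  d_mem : ∀ i k, ∀ y ∈ Fil k, ρ (d i) y ∈ Fil (k + w i)

/-- For `i ∈ T` the operator of `x i` is multiplication, which raises degree by `w i` where a drop
by `w i` is demanded; this forces weight zero on `T`. -/
theorem isFiltered_fockRep (T : Set σ) {w : σ → ℤ} (hw : ∀ i, 0 ≤ w i) (hT : ∀ i ∈ T, w i = 0) :
    IsFiltered (fockRep T) w (polyFil w) where
  mono := polyFil_mono w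
  eq_bot _ := polyFil_eq_bot hw
  exists_mem := exists_mem_polyFil w
  x_mem i k y hy := by
    rw [fockRep_x, fockX]
    split_ifs with h
    · have := X_mul_mem_polyFil i hy
      rw [hT i h] at this ⊢
      simpa using this
    · exact neg_mem (pderiv_mem_polyFil i hy)
  d_mem i k y hy := by
    rw [fockRep_d, fockD]
    split_ifs with h
    · have := pderiv_mem_polyFil i hy
      rw [hT i h] at this ⊢
      simpa using this
    · exact X_mul_mem_polyFil i hy

section Filtered

variable {Y : Type*} [AddCommGroup Y] [Module ℂ Y] {ρ : Weyl σ →ₐ[ℂ] End ℂ Y} {w : σ → ℤ}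
  {Fil : ℤ → Submodule ℂ Y}

theorem IsFiltered.monomial_mem (h : IsFiltered ρ w Fil) (m : σ →₀ ℕ) (k : ℤ) (y : Y)
    (hy : y ∈ Fil k) :
    ρ (ofPoly (MvPolynomial.monomial m 1)) y ∈ Fil (k - Finsupp.weight w m) := by
  induction m using Finsupp.induction_linear generalizing k y with
  | zero =>
    have h1 : (MvPolynomial.monomial (0 : σ →₀ ℕ) (1 : ℂ)) = 1 := rfl
    rw [h1]
    simpa using hy
  | add m n hm hn =>
    have h1 : MvPolynomial.monomial (m + n) (1 : ℂ) =
        MvPolynomial.monomial m 1 * MvPolynomial.monomial n 1 := by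
      rw [MvPolynomial.monomial_mul, one_mul]
    rw [h1, map_mul, map_mul, Module.End.mul_apply, map_add, add_comm, ← sub_sub]
    exact hm _ _ (hn _ _ hy)
  | single i n =>
    rw [Finsupp.weight_single, ← MvPolynomial.X_pow_eq_monomial, map_pow, map_pow, ofPoly_X]
    induction n with
    | zero => simpa using hy
    | succ n ih =>
      rw [pow_succ', Module.End.mul_apply, succ_nsmul, ← sub_sub]
      exact h.x_mem _ _ _ ih

theorem IsFiltered.ofPoly_mem (h : IsFiltered ρ w Fil) {j : ℤ} {p : MvPolynomial σ ℂ}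
    (hp : p ∈ polyHigh w j) (k : ℤ) (y : Y) (hy : y ∈ Fil k) : ρ (ofPoly p) y ∈ Fil (k - j) := by
  induction hp using Submodule.span_induction with
  | mem p hp =>
    obtain ⟨m, hm, rfl⟩ := hp
    exact h.mono (by omega) (h.monomial_mem m k y hy)
  | zero => rw [map_zero, map_zero]; exact zero_mem _
  | add p q _ _ hp hq => rw [map_add, map_add]; exact add_mem hp hq
  | smul c p _ hp => rw [map_smul, map_smul]; exact Submodule.smul_mem _ _ hp

/-- The coefficient of `d i` lowers by at least `w i + j`, which outweighs the rise by `w i` caused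
by `d i`. This is how the lower-order terms of a vector field are controlled. -/
theorem IsFiltered.sum_mem [Fintype σ] (h : IsFiltered ρ w Fil) {j : ℤ} {p : σ → MvPolynomial σ ℂ}
    (hp : ∀ i, p i ∈ polyHigh w (w i + j)) (k : ℤ) (y : Y) (hy : y ∈ Fil k) :
    ρ (∑ i, ofPoly (p i) * d i) y ∈ Fil (k - j) := by
  rw [map_sum, LinearMap.sum_apply]
  refine Submodule.sum_mem _ fun i _ => ?_
  rw [map_mul, Module.End.mul_apply]
  convert h.ofPoly_mem (hp i) _ _ (h.d_mem i k y hy) using 2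
  ring

end Filtered

/-! ### The localization of ℂ[∂] at one derivative. -/

section Extension

variable (α : σ)

open Classical in
/-- The restriction of a polynomial to the hyperplane `x α = 0`. -/
def restrictZero : MvPolynomial σ ℂ →ₐ[ℂ] MvPolynomial σ ℂ :=
  MvPolynomial.aeval fun i => if i = α then 0 else MvPolynomial.X i

theorem restrictZero_X_self : restrictZero α (MvPolynomial.X α) = 0 := by simp [restrictZero]

theorem restrictZero_X_of_ne {i : σ} (h : i ≠ α) :
    restrictZero α (MvPolynomial.X i) = MvPolynomial.X i := by simp [restrictZero, h]

theorem restrictZero_monomial (m : σ →₀ ℕ) :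
    restrictZero α (MvPolynomial.monomial m 1) =
      if m α = 0 then MvPolynomial.monomial m 1 else 0 := by
  classical
  rw [restrictZero, MvPolynomial.aeval_monomial, map_one, one_mul]
  split_ifs with h
  · rw [MvPolynomial.monomial_eq, MvPolynomial.C_1, one_mul]
    refine Finset.prod_congr rfl fun i hi => ?_
    have : i ≠ α := by
      rintro rfl
      exact Finsupp.mem_support_iff.1 hi h
    simp [this]
  · exact Finset.prod_eq_zero (Finsupp.mem_support_iff.2 h) (by simp [h])

theorem pderiv_restrictZero_self (p : MvPolynomial σ ℂ) :
    MvPolynomial.pderiv α (restrictZero α p) = 0 := by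
  classical
  induction p using MvPolynomial.induction_on with
  | C a => rw [← MvPolynomial.algebraMap_eq, AlgHom.commutes, MvPolynomial.algebraMap_eq]; simp
  | add p q hp hq => simp [hp, hq]
  | mul_X p i hp =>
    by_cases h : i = α
    · subst h; simp [restrictZero_X_self]
    · simp [restrictZero_X_of_ne α h, hp, MvPolynomial.pderiv_X_of_ne h]

theorem pderiv_restrictZero_of_ne {i : σ} (hi : i ≠ α) (p : MvPolynomial σ ℂ) :
    MvPolynomial.pderiv i (restrictZero α p) = restrictZero α (MvPolynomial.pderiv i p) := by
  classical
  induction p using MvPolynomial.induction_on with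
  | C a => rw [← MvPolynomial.algebraMap_eq, AlgHom.commutes, MvPolynomial.algebraMap_eq]; simp
  | add p q hp hq => simp [hp, hq]
  | mul_X p j hp =>
    by_cases h : j = α
    · subst h
      simp [restrictZero_X_self, MvPolynomial.pderiv_X_of_ne (Ne.symm hi)]
    · by_cases hij : j = i
      · subst hij
        simp [restrictZero_X_of_ne α h, hp]
      · simp [restrictZero_X_of_ne α h, hp, MvPolynomial.pderiv_X_of_ne hij]

theorem fockX_comm (T : Set σ) (i j : σ) (p : MvPolynomial σ ℂ) :
    fockX T i (fockX T j p) = fockX T j (fockX T i p) := by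
  simp only [← fockRep_x, ← Module.End.mul_apply, ← map_mul, x_mul_x i j]

theorem fockD_comm (T : Set σ) (i j : σ) (p : MvPolynomial σ ℂ) :
    fockD T i (fockD T j p) = fockD T j (fockD T i p) := by
  simp only [← fockRep_d, ← Module.End.mul_apply, ← map_mul, d_mul_d i j]

theorem fockD_fockX_self (T : Set σ) (i : σ) (p : MvPolynomial σ ℂ) :
    fockD T i (fockX T i p) = fockX T i (fockD T i p) + p := by
  simp only [← fockRep_d, ← fockRep_x, ← Module.End.mul_apply, ← map_mul, d_mul_x_self i]
  simp

theorem fockD_fockX_of_ne (T : Set σ) {i j : σ} (h : i ≠ j) (p : MvPolynomial σ ℂ) :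
    fockD T i (fockX T j p) = fockX T j (fockD T i p) := by
  simp only [← fockRep_d, ← fockRep_x, ← Module.End.mul_apply, ← map_mul, d_mul_x_of_ne h]

/-- Together with `restrictZero_fockD`, this is the compatibility needed for the off-diagonal term
of `extD` to respect the Weyl relations. For `j = α` both sides vanish: a multiple of the variable
restricts to zero, and a restricted polynomial does not involve it. -/
theorem restrictZero_fockX (j : σ) (p : MvPolynomial σ ℂ) :
    restrictZero α (fockX {α} j p) = fockX ∅ j (restrictZero α p) := by
  simp only [fockX, Set.mem_singleton_iff, Set.mem_empty_iff_false, if_false]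
  by_cases h : j = α
  · subst h
    simp [restrictZero_X_self, pderiv_restrictZero_self]
  · simp [h, pderiv_restrictZero_of_ne α h]

theorem restrictZero_fockD {j : σ} (h : j ≠ α) (p : MvPolynomial σ ℂ) :
    restrictZero α (fockD {α} j p) = fockD ∅ j (restrictZero α p) := by
  simp [fockD, h, restrictZero_X_of_ne]

/-- The operator of `x i` on the localization at `∂ α` of the Fock module `ℂ[∂]`. -/
def extX (i : σ) : End ℂ (MvPolynomial σ ℂ × MvPolynomial σ ℂ) :=
  (fockX ∅ i).prodMap (fockX {α} i)

open Classical in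
/-- The operator of `∂ i` on the localization at `∂ α` of the Fock module `ℂ[∂]`. -/
def extD (i : σ) : End ℂ (MvPolynomial σ ℂ × MvPolynomial σ ℂ) :=
  (fockD ∅ i).prodMap (fockD {α} i) +
    if i = α then LinearMap.inl ℂ _ _ ∘ₗ (restrictZero α).toLinearMap ∘ₗ LinearMap.snd ℂ _ _ else 0

theorem extX_apply (i : σ) (p : MvPolynomial σ ℂ × MvPolynomial σ ℂ) :
    extX α i p = (fockX ∅ i p.1, fockX {α} i p.2) := rfl

/-- The second component records the polar part in ∂_α, with X_α^k standing for k! ∂_α^{-k-1}.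
Multiplication by ∂_α lowers the pole order, which is differentiation in X_α, and turns a simple
pole, extracted by `restrictZero`, into a regular term. -/
theorem extD_self (p : MvPolynomial σ ℂ × MvPolynomial σ ℂ) :
    extD α α p = (MvPolynomial.X α * p.1 + restrictZero α p.2, MvPolynomial.pderiv α p.2) := by
  simp [extD, fockD]

theorem extD_of_ne {i : σ} (h : i ≠ α) (p : MvPolynomial σ ℂ × MvPolynomial σ ℂ) :
    extD α i p = (fockD ∅ i p.1, fockD {α} i p.2) := by
  simp [extD, h]

theorem extD_self' (p : MvPolynomial σ ℂ × MvPolynomial σ ℂ) :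
    extD α α p = (fockD ∅ α p.1 + restrictZero α p.2, fockD {α} α p.2) := by
  simp [extD]

/-- The localization at `∂ α` of the Fock module `ℂ[∂ i, i : σ]`, as an extension of the Fock module
`ℂ[x α, ∂ i, i ≠ α]` by the Fock module `ℂ[∂ i, i : σ]`. -/
def extRep : Weyl σ →ₐ[ℂ] End ℂ (MvPolynomial σ ℂ × MvPolynomial σ ℂ) :=
  RingQuot.liftAlgHom ℂ ⟨FreeAlgebra.lift ℂ (Sum.elim (extX α) (extD α)), by
    rintro _ _ (⟨i, j⟩ | ⟨i, j⟩ | ⟨i⟩ | ⟨i, j, h⟩)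
    all_goals
      refine LinearMap.ext fun p => ?_
      simp only [map_mul, map_add, map_one, FreeAlgebra.lift_ι_apply, Sum.elim_inl, Sum.elim_inr,
        Module.End.mul_apply, LinearMap.add_apply, Module.End.one_apply]
    · simp only [extX_apply]
      rw [fockX_comm, fockX_comm {α}]
    · by_cases hi : i = α <;> by_cases hj : j = α
      · rw [hi, hj]
      · subst hi
        simp only [extD_self', extD_of_ne _ hj, map_add, restrictZero_fockD _ hj]
        rw [fockD_comm, fockD_comm {i}]
      · subst hj
        simp only [extD_self', extD_of_ne _ hi, map_add, restrictZero_fockD _ hi]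
        rw [fockD_comm, fockD_comm {j}]
      · simp only [extD_of_ne _ hi, extD_of_ne _ hj]
        rw [fockD_comm, fockD_comm {α}]
    · by_cases hi : i = α
      · subst hi
        simp only [extD_self', extX_apply, map_add, restrictZero_fockX, fockD_fockX_self]
        refine Prod.ext ?_ ?_ <;> simp only [Prod.fst_add, Prod.snd_add]
        abel
      · simp only [extD_of_ne _ hi, extX_apply, fockD_fockX_self]
        rfl
    · by_cases hi : i = α
      · subst hi
        simp only [extD_self', extX_apply, map_add, restrictZero_fockX, fockD_fockX_of_ne _ h]
      · simp only [extD_of_ne _ hi, extX_apply, fockD_fockX_of_ne _ h]⟩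

theorem extRep_x (i : σ) : extRep α (x i) = extX α i := by
  unfold extRep x
  erw [RingQuot.liftAlgHom_mkAlgHom_apply]
  simp

theorem extRep_d (i : σ) : extRep α (d i) = extD α i := by
  unfold extRep d
  erw [RingQuot.liftAlgHom_mkAlgHom_apply]
  simp

theorem extRep_inl (a : Weyl σ) (v : MvPolynomial σ ℂ) :
    extRep α a (LinearMap.inl ℂ _ (MvPolynomial σ ℂ) v) =
      LinearMap.inl ℂ _ _ (fockRep ∅ a v) := by
  refine (intertwine _ _ _ (fun i v => ?_) (fun i v => ?_) a v).symm
  · rw [extRep_x, fockRep_x, extX_apply]; simp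
  · rw [extRep_d, fockRep_d]
    by_cases h : i = α
    · subst h; rw [extD_self']; simp
    · rw [extD_of_ne _ h]; simp

theorem snd_extRep (a : Weyl σ) (e : MvPolynomial σ ℂ × MvPolynomial σ ℂ) :
    LinearMap.snd ℂ _ _ (extRep α a e) = fockRep {α} a (LinearMap.snd ℂ _ _ e) := by
  refine intertwine _ _ _ (fun i v => ?_) (fun i v => ?_) a e
  · rw [extRep_x, fockRep_x, extX_apply]; simp
  · rw [extRep_d, fockRep_d]
    by_cases h : i = α
    · subst h; rw [extD_self']; simp
    · rw [extD_of_ne _ h]; simp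

theorem restrictZero_mem_polyFil {w : σ → ℤ} {k : ℤ} {p : MvPolynomial σ ℂ}
    (hp : p ∈ polyFil w k) : restrictZero α p ∈ polyFil w k := by
  refine polyFil_induction (φ := (restrictZero α).toLinearMap) (fun m hm => ?_) hp
  rw [AlgHom.toLinearMap_apply, restrictZero_monomial]
  split_ifs
  · exact monomial_mem_polyFil hm _
  · exact zero_mem _

theorem isFiltered_extRep {w : σ → ℤ} (hw : ∀ i, 0 ≤ w i) (hα : w α = 0) :
    IsFiltered (extRep α) w fun k => (polyFil w k).prod (polyFil w k) := by
  have h1 := isFiltered_fockRep ∅ hw (by simp)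
  have h2 := isFiltered_fockRep {α} hw (by simpa using hα)
  refine ⟨fun k l h => Submodule.prod_mono (polyFil_mono w h) (polyFil_mono w h), fun k hk => ?_,
    fun y => ?_, fun i k y hy => ?_, fun i k y hy => ?_⟩
  · simp only [polyFil_eq_bot hw hk, Submodule.prod_bot]
  · obtain ⟨k, hk⟩ := exists_mem_polyFil w y.1
    obtain ⟨l, hl⟩ := exists_mem_polyFil w y.2
    exact ⟨max k l, polyFil_mono w (le_max_left _ _) hk, polyFil_mono w (le_max_right _ _) hl⟩
  · have h3 := h1.x_mem i k _ hy.1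
    have h4 := h2.x_mem i k _ hy.2
    rw [fockRep_x] at h3 h4
    rw [extRep_x, extX_apply]
    exact ⟨h3, h4⟩
  · have h3 := h1.d_mem i k _ hy.1
    have h4 := h2.d_mem i k _ hy.2
    rw [fockRep_d] at h3 h4
    rw [extRep_d]
    by_cases h : i = α
    · subst h
      rw [extD_self']
      refine ⟨add_mem h3 (restrictZero_mem_polyFil _ ?_), h4⟩
      rw [hα, add_zero]
      exact hy.2
    · rw [extD_of_ne _ h]
      exact ⟨h3, h4⟩

/-- If `(v, u)` is killed, then `u` has zero derivative in `X α`, so it does not involve that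
variable. In `X α * v + u = 0` the two terms then have no common monomials, and both vanish. -/
theorem extD_injective : Function.Injective (extD α α) := by
  rw [injective_iff_map_eq_zero]
  rintro ⟨v, u⟩ h
  rw [extD_self, Prod.mk_eq_zero] at h
  obtain ⟨h1, h2⟩ := h
  dsimp only at h1 h2
  have hu : restrictZero α u = u := by
    conv_lhs => rw [u.as_sum]
    conv_rhs => rw [u.as_sum]
    rw [map_sum]
    refine Finset.sum_congr rfl fun m hm => ?_
    have hmα : m α = 0 := by
      by_contra hne
      have h3 := congrArg (MvPolynomial.coeff (m - Finsupp.single α 1)) h2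
      rw [MvPolynomial.coeff_pderiv, Finsupp.sub_add_single_one_cancel hne] at h3
      have hne1 : (((m - Finsupp.single α 1 : σ →₀ ℕ) α : ℂ) + 1) ≠ 0 := Nat.cast_add_one_ne_zero _
      rw [MvPolynomial.coeff_zero] at h3
      exact MvPolynomial.mem_support_iff.1 hm ((mul_eq_zero.1 h3).resolve_right hne1)
    have : MvPolynomial.monomial m (MvPolynomial.coeff m u) =
        MvPolynomial.coeff m u • MvPolynomial.monomial m (1 : ℂ) := by
      rw [MvPolynomial.smul_monomial, smul_eq_mul, mul_one]
    rw [this, map_smul, restrictZero_monomial, if_pos hmα]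
  have h0 : restrictZero α (MvPolynomial.X α * v + restrictZero α u) = 0 := by rw [h1, map_zero]
  rw [map_add, map_mul, restrictZero_X_self, zero_mul, zero_add, hu, hu] at h0
  rw [h0, map_zero, add_zero] at h1
  rw [h0, (mul_eq_zero.1 h1).resolve_left (MvPolynomial.X_ne_zero α), Prod.mk_zero_zero]

/-- Preimages of monomials are explicit, and the weight zero of `α` keeps them in the same
filtration step. -/
theorem exists_extD_eq {w : σ → ℤ} (hα : w α = 0) (k : ℤ)
    (y : MvPolynomial σ ℂ × MvPolynomial σ ℂ) (hy : y ∈ (polyFil w k).prod (polyFil w k)) :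
    ∃ z ∈ (polyFil w k).prod (polyFil w k), extD α α z = y := by
  suffices (polyFil w k).prod (polyFil w k) ≤
      ((polyFil w k).prod (polyFil w k)).map (extD α α) from this hy
  have h1 : polyFil w k ≤ (((polyFil w k).prod (polyFil w k)).map (extD α α)).comap
      (LinearMap.inl ℂ _ _) := by
    intro p hp
    rw [Submodule.mem_comap]
    refine polyFil_induction (φ := LinearMap.inl ℂ _ (MvPolynomial σ ℂ)) (fun m hm => ?_) hp
    -- A regular monomial free of `X α` comes from a simple pole; any other is divided by `X α`.
    by_cases h : m α = 0
    · refine ⟨(0, MvPolynomial.monomial m 1), ⟨zero_mem _, monomial_mem_polyFil hm _⟩, ?_⟩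
      rw [extD_self, restrictZero_monomial, if_pos h, MvPolynomial.pderiv_monomial, h]
      simp
    · refine ⟨(MvPolynomial.monomial (m - Finsupp.single α 1) 1, 0),
        ⟨monomial_mem_polyFil ?_ _, zero_mem _⟩, ?_⟩
      · have := Finsupp.weight_sub_single_add (w := w) h
        omega
      · rw [extD_self, MvPolynomial.X, MvPolynomial.monomial_mul, add_comm (Finsupp.single α 1),
          Finsupp.sub_add_single_one_cancel h]
        simp
  have h2 : polyFil w k ≤ (((polyFil w k).prod (polyFil w k)).map (extD α α)).comap
      (LinearMap.inr ℂ _ _) := by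
    intro p hp
    rw [Submodule.mem_comap]
    refine polyFil_induction (φ := LinearMap.inr ℂ (MvPolynomial σ ℂ) _) (fun m hm => ?_) hp
    -- A polar monomial is integrated in `X α`; the integral is divisible by `X α`, so it
    -- contributes nothing to the regular part.
    refine ⟨(0, MvPolynomial.monomial (m + Finsupp.single α 1) ((m α + 1 : ℂ)⁻¹)),
      ⟨zero_mem _, monomial_mem_polyFil ?_ _⟩, ?_⟩
    · rw [map_add, Finsupp.weight_single, hα, smul_zero, add_zero]
      exact hm
    · have hne : (m α + 1 : ℂ) ≠ 0 := Nat.cast_add_one_ne_zero _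
      have h3 : MvPolynomial.monomial (m + Finsupp.single α 1) ((m α + 1 : ℂ)⁻¹) =
          (m α + 1 : ℂ)⁻¹ • MvPolynomial.monomial (m + Finsupp.single α 1) (1 : ℂ) := by
        rw [MvPolynomial.smul_monomial, smul_eq_mul, mul_one]
      rw [extD_self, MvPolynomial.pderiv_monomial, h3, map_smul, restrictZero_monomial]
      simp [hne]
  rintro ⟨p, q⟩ ⟨hp, hq⟩
  have h3 : (p, q) = LinearMap.inl ℂ _ (MvPolynomial σ ℂ) p + LinearMap.inr ℂ _ _ q := by simp
  rw [h3]
  exact add_mem (h1 hp) (h2 hq)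

theorem exists_fockD_pow_eq_zero (p : MvPolynomial σ ℂ) :
    ∃ n : ℕ, ((fockD {α} α) ^ n) p = 0 := by
  have hp : fockD {α} α = (MvPolynomial.pderiv α).toLinearMap := by simp [fockD]
  have hz (n : ℕ) (p) (h : ((fockD {α} α) ^ n) p = 0) (m : ℕ) :
      ((fockD {α} α) ^ (m + n)) p = 0 := by rw [pow_add, Module.End.mul_apply, h, map_zero]
  induction p using MvPolynomial.induction_on' with
  | monomial m c =>
    obtain ⟨N, hN⟩ : ∃ N, m α = N := ⟨_, rfl⟩
    induction N generalizing m c with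
    | zero => exact ⟨1, by rw [pow_one, hp]; change MvPolynomial.pderiv α _ = 0; simp [hN]⟩
    | succ N ih =>
      obtain ⟨n, hn⟩ := ih (m - Finsupp.single α 1) (c * m α) (by simp [hN])
      refine ⟨n + 1, ?_⟩
      rw [pow_succ, Module.End.mul_apply]
      conv_lhs => enter [2]; rw [hp]
      change ((fockD {α} α) ^ n) (MvPolynomial.pderiv α _) = 0
      rw [MvPolynomial.pderiv_monomial, hn]
  | add p q hp hq =>
    obtain ⟨m, hm⟩ := hp
    obtain ⟨n, hn⟩ := hq
    refine ⟨m + n, ?_⟩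
    rw [map_add, hz _ _ hn, add_comm m, hz _ _ hm, add_zero]

end Extension

end Weyl

/-! ### Recognizing the twist of a module from an exact sequence. -/

section TwistExact

variable {R : Type*} [Ring R] (t : R)

theorem isUnit_toAddMonoidEnd_of_bijective {E : Type*} [AddCommGroup E] [Module R E]
    (ht : Function.Bijective fun e : E => t • e) (s : Submonoid.powers t) :
    IsUnit (Module.toAddMonoidEnd R E s) := by
  obtain ⟨_, n, rfl⟩ := s
  dsimp only
  rw [map_pow]
  refine IsUnit.pow n ?_
  let e : E ≃+ E := AddEquiv.ofBijective (Module.toAddMonoidEnd R E t) ht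
  refine ⟨⟨e.toAddMonoidHom, e.symm.toAddMonoidHom, ?_, ?_⟩, rfl⟩
  · ext y; exact e.apply_symm_apply y
  · ext y; exact e.symm_apply_apply y

variable [OreLocalization.OreSet (Submonoid.powers t)]

/-- The action of `R_(t)` on an `R`-module on which `t` acts bijectively. -/
def locAct {E : Type*} [AddCommGroup E] [Module R E]
    (ht : Function.Bijective fun e : E => t • e) : LocAt t →+* AddMonoid.End E :=
  OreLocalization.universalHom (Module.toAddMonoidEnd R E)
    (IsUnit.liftRight
      ((Module.toAddMonoidEnd R E : R →* AddMonoid.End E).comp (Submonoid.powers t).subtype)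
      (isUnit_toAddMonoidEnd_of_bijective t ht)) (fun _ => rfl)

theorem locAct_numerator {E : Type*} [AddCommGroup E] [Module R E]
    (ht : Function.Bijective fun e : E => t • e) (r : R) (e : E) :
    locAct t ht (OreLocalization.numeratorRingHom r) e = r • e := by
  have h : locAct t ht (OreLocalization.numeratorHom r) = Module.toAddMonoidEnd R E r :=
    OreLocalization.universalHom_commutes _ _ _
  exact DFunLike.congr_fun h e

theorem locAct_smul {E : Type*} [AddCommGroup E] [Module R E]
    (ht : Function.Bijective fun e : E => t • e) (r : R) (z : LocAt t) (e : E) :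
    locAct t ht (r • z) e = r • locAct t ht z e := by
  have h : r • z = OreLocalization.numeratorRingHom r * z := by
    rw [numerator_eq_smul_one, smul_mul_assoc, one_mul]
  rw [h, map_mul]
  exact locAct_numerator t ht r _

theorem smul_locAct_one_div {E : Type*} [AddCommGroup E] [Module R E]
    (ht : Function.Bijective fun e : E => t • e) (s : Submonoid.powers t) (e : E) :
    (s : R) • locAct t ht (1 /ₒ s) e = e := by
  have h : (OreLocalization.numeratorRingHom (s : R) : LocAt t) * (1 /ₒ s) = 1 := by
    change ((s : R) /ₒ 1) * (1 /ₒ s) = 1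
    exact OreLocalization.mul_inv s 1
  have h' := locAct_numerator t ht (s : R) (locAct t ht (1 /ₒ s) e)
  rw [← h']
  have h'' := map_mul (locAct t ht) (OreLocalization.numeratorRingHom (s : R)) (1 /ₒ s)
  rw [h, map_one] at h''
  exact (DFunLike.congr_fun h'' e).symm

variable {M : Type*} [AddCommGroup M] [Module R M]

/-- The class of `z ⊗ m` in `(R_(t) / R) ⊗_R M`. -/
def twistMk (z : LocAt t) : M →+ Twist t M :=
  (Submodule.mkQ _).toAddMonoidHom.comp
    (TensorProduct.mk ℤ (LocAt t ⧸ imageInLoc t) M (Submodule.Quotient.mk z)).toAddMonoidHom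

theorem twistMk_mul (z : LocAt t) (r : R) (m : M) :
    twistMk t (z * OreLocalization.numeratorRingHom r) m = twistMk t z (r • m) := by
  refine (Submodule.Quotient.eq _).2 (Submodule.subset_span ⟨Submodule.Quotient.mk z, r, m, rfl⟩)

theorem one_div_mul_numerator (r : R) (s : Submonoid.powers t) :
    (1 /ₒ s : LocAt t) * OreLocalization.numeratorRingHom r = r /ₒ s := by
  change (1 /ₒ s) * (r /ₒ 1) = r /ₒ s
  simp

theorem one_div_eq (s s' : Submonoid.powers t) :
    (1 /ₒ s : LocAt t) = (1 /ₒ (s' * s)) * OreLocalization.numeratorRingHom (s' : R) := by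
  rw [one_div_mul_numerator]
  have := OreLocalization.expand' (1 : R) s s'
  rw [this, Submonoid.smul_def, smul_eq_mul, mul_one]

/-- Common denominators: powers of `t` commute with each other, so two fractions with numerator 1
can be expanded to the same denominator, and numerators move into `M` across the tensor sign. -/
theorem exists_twistMk_eq (y : Twist t M) :
    ∃ (s : Submonoid.powers t) (m : M), y = twistMk t (1 /ₒ s) m := by
  obtain ⟨y, rfl⟩ := Submodule.Quotient.mk_surjective _ y
  induction y using TensorProduct.induction_on with
  | zero => exact ⟨1, 0, by rw [map_zero]; rfl⟩
  | tmul z m =>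
    obtain ⟨z, rfl⟩ := Submodule.Quotient.mk_surjective _ z
    induction z using OreLocalization.ind with
    | _ r s =>
      refine ⟨s, r • m, ?_⟩
      rw [← twistMk_mul, one_div_mul_numerator]
      rfl
  | add y y' h h' =>
    obtain ⟨s, m, h⟩ := h
    obtain ⟨s', m', h'⟩ := h'
    have hc : s' * s = s * s' := by
      obtain ⟨_, n, rfl⟩ := s
      obtain ⟨_, n', rfl⟩ := s'
      exact Subtype.ext ((Commute.refl t).pow_pow n' n)
    refine ⟨s' * s, (s' : R) • m + (s : R) • m', ?_⟩
    rw [Submodule.Quotient.mk_add, h, h', map_add, ← twistMk_mul, ← twistMk_mul, ← one_div_eq, hc,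
      ← one_div_eq]

/-- If `0 → M → E → W → 0` is exact, `t` acts bijectively on `E` and locally nilpotently on `W`,
then `W` is the twist of `M`. -/
theorem nonempty_twist_equiv {E W : Type*} [AddCommGroup E] [Module R E] [AddCommGroup W]
    [Module R W] (i : M →ₗ[R] E) (p : E →ₗ[R] W) (hi : Function.Injective i)
    (hp : Function.Surjective p) (hip : Function.Exact i p)
    (ht : Function.Bijective fun e : E => t • e) (hnil : ∀ w : W, ∃ n : ℕ, t ^ n • w = 0) :
    Nonempty (Twist t M ≃ₗ[R] W) := by
  -- Since `t` is invertible on `E`, fractions act there: the candidate map sends `z ⊗ m` to `p (z ·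
  -- i m)`, and `p ∘ i = 0` makes it vanish on the image of `R`.
  let g : LocAt t →ₗ[R] M →ₗ[ℤ] W :=
    { toFun z := (p.toAddMonoidHom.comp ((locAct t ht z).comp i.toAddMonoidHom)).toIntLinearMap
      map_add' z z' := by
        ext m
        change p (locAct t ht (z + z') (i m)) = p _ + p _
        rw [map_add]
        exact map_add p (locAct t ht z (i m)) (locAct t ht z' (i m))
      map_smul' r z := by
        ext m
        change p (locAct t ht (r • z) (i m)) = r • p _
        rw [locAct_smul, map_smul]
        rfl }
  have hg (z m) : g z m = p (locAct t ht z (i m)) := rfl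
  have hg0 : imageInLoc t ≤ LinearMap.ker g := by
    rintro _ ⟨r, rfl⟩
    rw [LinearMap.mem_ker]
    ext m
    rw [LinearMap.toSpanSingleton_apply, ← numerator_eq_smul_one, hg, locAct_numerator, ← map_smul]
    exact hip.apply_apply_eq_zero _
  let g' := (imageInLoc t).liftQ g hg0
  let G : Twist t M →ₗ[R] W := Submodule.liftQ _ (TensorProduct.AlgebraTensorModule.lift g') <| by
    rw [Submodule.span_le]
    rintro _ ⟨x, r, m, rfl⟩
    obtain ⟨z, rfl⟩ := Submodule.Quotient.mk_surjective _ x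
    rw [SetLike.mem_coe, LinearMap.mem_ker, map_sub, sub_eq_zero]
    change g (z * OreLocalization.numeratorRingHom r) m = g z (r • m)
    rw [hg, hg, map_mul, map_smul]
    exact congrArg p (congrArg (locAct t ht z) (locAct_numerator t ht r (i m)))
  have hG (z m) : G (twistMk t z m) = p (locAct t ht z (i m)) := rfl
  refine ⟨LinearEquiv.ofBijective G ⟨?_, fun w => ?_⟩⟩
  -- If `s⁻¹ · i m` lies in the image of `M`, then `m = s m'`, and `s⁻¹ ⊗ s m' = 1 ⊗ m'` is zero
  -- because `1` dies in the quotient by `R`.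
  · rw [injective_iff_map_eq_zero]
    intro y hy
    obtain ⟨s, m, rfl⟩ := exists_twistMk_eq t y
    rw [hG] at hy
    obtain ⟨m', hm'⟩ := (hip _).1 hy
    have h1 : m = (s : R) • m' := by
      apply hi
      rw [map_smul, hm', smul_locAct_one_div]
    rw [h1, ← twistMk_mul, one_div_mul_numerator]
    have h2 : ((s : R) /ₒ s : LocAt t) = 1 := OreLocalization.div_eq_one
    have h3 : (Submodule.Quotient.mk (1 : LocAt t) : LocAt t ⧸ imageInLoc t) = 0 :=
      (Submodule.Quotient.mk_eq_zero _).2 ⟨1, one_smul _ _⟩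
    rw [h2, twistMk, h3]
    simp
  -- Local nilpotency puts some `t ^ n • e` into the image of `M`, so `e` is a fraction of an
  -- element of `M`.
  · obtain ⟨e, rfl⟩ := hp w
    obtain ⟨n, hn⟩ := hnil (p e)
    rw [← map_smul] at hn
    obtain ⟨m, hm⟩ := (hip _).1 hn
    refine ⟨twistMk t (1 /ₒ ⟨t ^ n, n, rfl⟩) m, ?_⟩
    rw [hG, hm]
    congr 1
    have h1 := smul_locAct_one_div t ht ⟨t ^ n, n, rfl⟩ (t ^ n • e)
    have h2 := ht.1.iterate n
    rw [smul_iterate] at h2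
    exact h2 h1

end TwistExact

/-! ### Power series in nilpotent operators and the derivative of the exponential. -/

section NilEval

variable {V : Type*} [AddCommGroup V] [Module ℂ V]

/-- Any vanishing power may serve as truncation bound, which allows sums with different bounds to be
compared. -/
theorem nilEval_eq_sum (q : PowerSeries ℂ) {T : End ℂ V} {N : ℕ} (hN : T ^ N = 0) :
    nilEval q T = ∑ n ∈ Finset.range N, PowerSeries.coeff n q • T ^ n := by
  rw [nilEval]
  refine Finset.sum_subset (Finset.range_subset_range.2 (Nat.sInf_le hN)) fun n _ hn => ?_
  rw [pow_eq_zero_of_le (by simpa using hn) (pow_nilpotencyClass ⟨N, hN⟩), smul_zero]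

theorem nilEval_one {T : End ℂ V} (hT : IsNilpotent T) : nilEval 1 T = 1 := by
  obtain ⟨N, hN⟩ := hT
  have hN' : T ^ (N + 1) = 0 := by rw [pow_succ, hN, zero_mul]
  rw [nilEval_eq_sum _ hN', Finset.sum_eq_single 0]
  · simp
  · intro n _ hn
    rw [PowerSeries.coeff_one, if_neg hn, zero_smul]
  · simp

/-- All nonzero terms lie in the square `k, m < N`, which the antidiagonals below `2 * N` cover. -/
theorem sum_range_antidiagonal {Y : Type*} [AddCommMonoid Y] (N : ℕ) (F : ℕ → ℕ → Y)
    (h₁ : ∀ k m, N ≤ k → F k m = 0) (h₂ : ∀ k m, N ≤ m → F k m = 0) :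
    ∑ n ∈ Finset.range (2 * N), ∑ p ∈ Finset.HasAntidiagonal.antidiagonal n, F p.1 p.2 =
      ∑ k ∈ Finset.range N, ∑ m ∈ Finset.range N, F k m := by
  classical
  rw [← Finset.sum_product', ← Finset.sum_fiberwise_of_maps_to (t := Finset.range (2 * N))
    (g := fun p : ℕ × ℕ => p.1 + p.2)]
  · refine Finset.sum_congr rfl fun n _ => ?_
    symm
    refine Finset.sum_subset (fun p hp => ?_) fun p hp hp' => ?_
    · rw [Finset.mem_filter] at hp
      rw [Finset.HasAntidiagonal.mem_antidiagonal]
      exact hp.2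
    · rw [Finset.HasAntidiagonal.mem_antidiagonal] at hp
      simp only [Finset.mem_filter, Finset.mem_product, Finset.mem_range, hp, and_true,
        not_and_or, not_lt] at hp'
      rcases hp' with h | h
      · exact h₁ _ _ h
      · exact h₂ _ _ h
  · intro p hp
    simp only [Finset.mem_product, Finset.mem_range] at hp ⊢
    omega

theorem nilEval_mul (p q : PowerSeries ℂ) {T : End ℂ V} (hT : IsNilpotent T) :
    nilEval (p * q) T = nilEval p T * nilEval q T := by
  obtain ⟨N, hN⟩ := hT
  have hN2 : T ^ (2 * N) = 0 := by rw [two_mul, pow_add, hN, zero_mul]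
  have hz (k : ℕ) (h : N ≤ k) : T ^ k = 0 := pow_eq_zero_of_le h hN
  rw [nilEval_eq_sum p hN, nilEval_eq_sum q hN, nilEval_eq_sum _ hN2, Finset.sum_mul_sum,
    ← sum_range_antidiagonal]
  · refine Finset.sum_congr rfl fun n _ => ?_
    rw [PowerSeries.coeff_mul, Finset.sum_smul]
    refine Finset.sum_congr rfl fun k hk => ?_
    rw [smul_mul_smul_comm, ← pow_add, Finset.HasAntidiagonal.mem_antidiagonal.1 hk]
  · intro k m h
    rw [hz k h, smul_zero, zero_mul]
  · intro k m h
    rw [hz m h, smul_zero, mul_zero]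

theorem nilEval_mem {T : End ℂ V} (q : PowerSeries ℂ) {N : Submodule ℂ V}
    (hN : ∀ v ∈ N, T v ∈ N) {v : V} (hv : v ∈ N) : nilEval q T v ∈ N := by
  have h (n : ℕ) : (T ^ n) v ∈ N := by
    induction n with
    | zero => simpa using hv
    | succ n ih => rw [pow_succ']; exact hN _ ih
  rw [nilEval, LinearMap.sum_apply]
  exact Submodule.sum_mem _ fun n _ => Submodule.smul_mem _ _ (h n)

/-- The power series `(1 - e ^ (- z)) / z`. -/
def toddInv : PowerSeries ℂ := PowerSeries.mk fun n => (-1) ^ n / ((n + 1).factorial : ℂ)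

theorem X_mul_toddInv :
    PowerSeries.X * toddInv = 1 - PowerSeries.evalNegHom (PowerSeries.exp ℂ) := by
  ext n
  rcases n with _ | n
  · rw [map_sub, PowerSeries.evalNegHom, PowerSeries.coeff_rescale]
    simp
  · rw [PowerSeries.coeff_succ_X_mul, toddInv, PowerSeries.coeff_mk, map_sub, PowerSeries.coeff_one,
      if_neg (Nat.succ_ne_zero n), zero_sub, PowerSeries.evalNegHom, PowerSeries.coeff_rescale,
      PowerSeries.coeff_exp, pow_succ]
    simp
    ring

theorem todd_mul_toddInv : todd * toddInv = 1 := by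
  have h0 := PowerSeries.exp_mul_exp_neg_eq_one (A := ℂ)
  have h1 : (PowerSeries.X * PowerSeries.exp ℂ) * (todd * toddInv) =
      (PowerSeries.X * PowerSeries.exp ℂ) * 1 := by
    calc (PowerSeries.X * PowerSeries.exp ℂ) * (todd * toddInv)
        = todd * (PowerSeries.exp ℂ * (PowerSeries.X * toddInv)) := by ring
      _ = todd * (PowerSeries.exp ℂ - PowerSeries.exp ℂ *
            PowerSeries.evalNegHom (PowerSeries.exp ℂ)) := by rw [X_mul_toddInv]; ring
      _ = _ := by rw [h0, todd_mul, mul_one]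
  refine mul_left_cancel₀ (mul_ne_zero PowerSeries.X_ne_zero ?_) h1
  intro h
  rw [h, zero_mul] at h0
  exact zero_ne_one h0

/-- Left multiplication by `T` is the sum of the commuting operators "commutator with `T`" and
"right multiplication by `T`"; this is the binomial theorem for that sum. -/
theorem pow_mul_eq_sum_ad {A : Type*} [Ring A] (T B : A) (n : ℕ) :
    T ^ n * B = ∑ k ∈ Finset.range (n + 1),
      n.choose k • ((fun Z => T * Z - Z * T)^[k] B * T ^ (n - k)) := by
  let δ : End ℤ A := LinearMap.mulLeft ℤ T - LinearMap.mulRight ℤ T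
  let ρ : End ℤ A := LinearMap.mulRight ℤ T
  have hδ (Z : A) : δ Z = T * Z - Z * T := rfl
  have hρ (Z : A) : ρ Z = Z * T := rfl
  have hc : Commute δ ρ := by
    refine LinearMap.ext fun Z => ?_
    rw [Module.End.mul_apply, Module.End.mul_apply, hδ, hρ, hδ, hρ]
    noncomm_ring
  have hs : δ + ρ = LinearMap.mulLeft ℤ T := sub_add_cancel _ _
  have h : ((δ + ρ) ^ n) B = T ^ n * B := by
    rw [hs, LinearMap.pow_mulLeft, LinearMap.mulLeft_apply]
  rw [← h, hc.add_pow, LinearMap.sum_apply]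
  refine Finset.sum_congr rfl fun k _ => ?_
  have hρk (m : ℕ) (Z : A) : (ρ ^ m) Z = Z * T ^ m := by
    rw [LinearMap.pow_mulRight, LinearMap.mulRight_apply]
  have hcρ (m : ℕ) : Commute (δ ^ k) (ρ ^ m) := hc.pow_pow _ _
  rw [(hcρ _).eq, Module.End.mul_apply, Module.End.mul_apply, Module.End.natCast_apply, map_nsmul,
    map_nsmul, hρk, Module.End.coe_pow]
  rfl

/-- In the inductive step `D T - T D` appears to the right of `T ^ n`; moving it to the left by
`pow_mul_eq_sum_ad` and adding binomial coefficients by Pascal's rule gives the next case. -/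
theorem mul_pow_sub_pow_mul_eq_sum_ad {A : Type*} [Ring A] (T D : A) (n : ℕ) :
    D * T ^ n - T ^ n * D = ∑ k ∈ Finset.range n,
      n.choose (k + 1) • ((fun Z => T * Z - Z * T)^[k] (D * T - T * D) * T ^ (n - 1 - k)) := by
  induction n with
  | zero => simp
  | succ n ih =>
    have h : D * T ^ (n + 1) - T ^ (n + 1) * D =
        (D * T ^ n - T ^ n * D) * T + T ^ n * (D * T - T * D) := by
      rw [pow_succ]; noncomm_ring
    rw [h, ih, pow_mul_eq_sum_ad, Finset.sum_mul]
    have h2 : ∑ k ∈ Finset.range n, n.choose (k + 1) •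
        ((fun Z => T * Z - Z * T)^[k] (D * T - T * D) * T ^ (n - 1 - k)) * T =
        ∑ k ∈ Finset.range (n + 1), n.choose (k + 1) •
          ((fun Z => T * Z - Z * T)^[k] (D * T - T * D) * T ^ (n - k)) := by
      rw [Finset.sum_range_succ, Nat.choose_succ_self, zero_smul, add_zero]
      refine Finset.sum_congr rfl fun k hk => ?_
      rw [smul_mul_assoc, mul_assoc, ← pow_succ]
      have := Finset.mem_range.1 hk
      congr 3
      omega
    rw [h2, ← Finset.sum_add_distrib]
    refine Finset.sum_congr rfl fun k _ => ?_
    rw [← add_smul, Nat.choose_succ_succ', add_comm (n.choose k), Nat.add_sub_cancel]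

/-- Duhamel's formula: [D, e^{-T}] equals -((1 - e^{-ad T}) / ad T)([D, T]) e^{-T}, compared degree
by degree. -/
theorem commutator_exp_neg {D T : End ℂ V} {N : ℕ} (hN : T ^ N = 0)
    (hδ : ∀ k, N ≤ k → (fun Z => T * Z - Z * T)^[k] (D * T - T * D) = 0) :
    D * nilEval (PowerSeries.exp ℂ) (-T) - nilEval (PowerSeries.exp ℂ) (-T) * D =
      -(∑ k ∈ Finset.range N, PowerSeries.coeff k toddInv •
        (fun Z => T * Z - Z * T)^[k] (D * T - T * D)) * nilEval (PowerSeries.exp ℂ) (-T) := by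
  have hz (k : ℕ) (h : N ≤ k) : T ^ k = 0 := pow_eq_zero_of_le h hN
  have hN1 : (-T) ^ N = 0 := by rw [neg_pow, hN, mul_zero]
  -- The constant term of the exponential commutes with `D`; truncating at `2 * N + 1` leaves `2 *
  -- N` terms once it is dropped.
  have hN2 : (-T) ^ (2 * N + 1) = 0 := by rw [neg_pow, hz _ (by omega), mul_zero]
  have hc (n : ℕ) : PowerSeries.coeff n (PowerSeries.exp ℂ) • (-T) ^ n =
      ((-1) ^ n / (n.factorial : ℂ)) • T ^ n := by
    rw [neg_pow, PowerSeries.coeff_exp, ← smul_eq_mul]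
    have : ((-1) ^ n : End ℂ V) • T ^ n = ((-1) ^ n : ℂ) • T ^ n := by
      rw [smul_eq_mul]
      rcases Nat.even_or_odd n with h | h <;> simp [h.neg_one_pow]
    rw [this, smul_smul]
    congr 1
    simp
    ring
  set F : ℕ → ℕ → End ℂ V := fun k m =>
    (PowerSeries.coeff k toddInv • (fun Z => T * Z - Z * T)^[k] (D * T - T * D)) *
      (((-1) ^ m / (m.factorial : ℂ)) • T ^ m) with hF
  have hL : D * nilEval (PowerSeries.exp ℂ) (-T) - nilEval (PowerSeries.exp ℂ) (-T) * D =
      -∑ n ∈ Finset.range (2 * N), ∑ p ∈ Finset.HasAntidiagonal.antidiagonal n, F p.1 p.2 := by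
    rw [nilEval_eq_sum _ hN2, Finset.mul_sum, Finset.sum_mul, ← Finset.sum_sub_distrib,
      Finset.sum_range_succ', ← Finset.sum_neg_distrib]
    simp only [hc]
    rw [pow_zero, pow_zero, mul_smul_comm, smul_mul_assoc, mul_one, one_mul, sub_self, add_zero]
    refine Finset.sum_congr rfl fun n _ => ?_
    rw [mul_smul_comm, smul_mul_assoc, ← smul_sub, mul_pow_sub_pow_mul_eq_sum_ad,
      Finset.Nat.sum_antidiagonal_eq_sum_range_succ F, Finset.smul_sum, ← Finset.sum_neg_distrib]
    refine Finset.sum_congr rfl fun k hk => ?_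
    have hk' : k ≤ n := Nat.lt_succ_iff.1 (Finset.mem_range.1 hk)
    rw [hF]
    dsimp only
    rw [smul_mul_smul_comm, ← Nat.cast_smul_eq_nsmul ℂ, smul_smul, ← neg_smul, toddInv,
      PowerSeries.coeff_mk, Nat.add_sub_cancel]
    congr 1
    -- With n = k + m, the claim is that binom(n+1, k+1) / (n+1)! = 1 / ((k+1)! m!), up to signs.
    obtain ⟨m, rfl⟩ := Nat.exists_eq_add_of_le hk'
    rw [Nat.add_sub_cancel_left]
    have h1 := Nat.choose_mul_factorial_mul_factorial (Nat.le_add_right (k + 1) m)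
    rw [Nat.add_sub_cancel_left] at h1
    have h2 : k + m + 1 = k + 1 + m := by ring
    rw [h2, ← h1]
    have := Nat.factorial_ne_zero (k + 1)
    have := Nat.factorial_ne_zero m
    have h3 : (k + 1 + m).choose (k + 1) ≠ 0 := (Nat.choose_pos (by omega)).ne'
    push_cast
    field_simp
    ring
  rw [hL, sum_range_antidiagonal N F, nilEval_eq_sum _ hN1, neg_mul, Finset.sum_mul_sum]
  · simp only [hc, hF]
  · intro k m h
    rw [hF]
    dsimp only
    rw [hδ k h, smul_zero, zero_mul]
  · intro k m h
    rw [hF]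
    dsimp only
    rw [hz m h, smul_zero, mul_zero]

end NilEval

/-! ### Exponentials of inner derivations of a Lie algebra. -/

section LieExp

variable {𝔤 : Type*} [LieRing 𝔤] [LieAlgebra ℂ 𝔤] {u : 𝔤}

/-- The exponential of a nilpotent derivation respects brackets: the Leibniz formula for powers,
divided by factorials, is a Cauchy product. -/
theorem lie_nilEval_exp (hu : IsNilpotent (LieAlgebra.ad ℂ 𝔤 u)) (y z : 𝔤) :
    nilEval (PowerSeries.exp ℂ) (-LieAlgebra.ad ℂ 𝔤 u) ⁅y, z⁆ =
      ⁅nilEval (PowerSeries.exp ℂ) (-LieAlgebra.ad ℂ 𝔤 u) y,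
        nilEval (PowerSeries.exp ℂ) (-LieAlgebra.ad ℂ 𝔤 u) z⁆ := by
  obtain ⟨N, hN⟩ := hu.neg
  let D : LieDerivation ℂ 𝔤 𝔤 := LieDerivation.ad ℂ 𝔤 (-u)
  set T := -LieAlgebra.ad ℂ 𝔤 u with hT
  have hD : ⇑D = ⇑T := by
    ext y
    simp [D, hT]
  have hz (k : ℕ) (h : N ≤ k) : T ^ k = 0 := pow_eq_zero_of_le h hN
  have hl (k : ℕ) (y z : 𝔤) : (T ^ k) ⁅y, z⁆ = ∑ p ∈ Finset.HasAntidiagonal.antidiagonal k,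
      k.choose p.1 • ⁅(T ^ p.1) y, (T ^ p.2) z⁆ := by
    simp only [Module.End.coe_pow, ← hD]
    exact D.iterate_apply_lie k y z
  have hL := nilEval_eq_sum (PowerSeries.exp ℂ) (hz (2 * N) (by omega))
  have hR := nilEval_eq_sum (PowerSeries.exp ℂ) hN
  conv_rhs => rw [hR]
  rw [hL]
  simp only [LinearMap.sum_apply]
  rw [_root_.sum_lie_sum, ← sum_range_antidiagonal N]
  · refine Finset.sum_congr rfl fun n _ => ?_
    rw [LinearMap.smul_apply, hl, Finset.smul_sum]
    refine Finset.sum_congr rfl fun p hp => ?_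
    rw [LinearMap.smul_apply, LinearMap.smul_apply, smul_lie, lie_smul, smul_smul,
      ← Nat.cast_smul_eq_nsmul ℂ, smul_smul]
    congr 1
    rw [Finset.HasAntidiagonal.mem_antidiagonal] at hp
    subst hp
    have h1 := Nat.choose_mul_factorial_mul_factorial (Nat.le_add_right p.1 p.2)
    rw [Nat.add_sub_cancel_left] at h1
    have := Nat.factorial_ne_zero p.1
    have := Nat.factorial_ne_zero p.2
    have := (Nat.choose_pos (Nat.le_add_right p.1 p.2)).ne'
    simp only [PowerSeries.coeff_exp, ← h1]
    push_cast
    field_simp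
  · intro k m h
    rw [hz k h, smul_zero, LinearMap.zero_apply, zero_lie]
  · intro k m h
    rw [hz m h, smul_zero, LinearMap.zero_apply, lie_zero]

/-- Duhamel's formula for `T = ad u`: here `D T - T D = ad (D u)`, and iterated commutators with `ad
u` are `ad` of iterated brackets, so the correction is an inner bracket. -/
theorem derivation_nilEval_exp (hu : IsNilpotent (LieAlgebra.ad ℂ 𝔤 u)) (D : End ℂ 𝔤)
    (hD : ∀ y z, D ⁅y, z⁆ = ⁅D y, z⁆ + ⁅y, D z⁆) (y : 𝔤) :
    D (nilEval (PowerSeries.exp ℂ) (-LieAlgebra.ad ℂ 𝔤 u) y) =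
      nilEval (PowerSeries.exp ℂ) (-LieAlgebra.ad ℂ 𝔤 u) (D y) -
        ⁅nilEval toddInv (LieAlgebra.ad ℂ 𝔤 u) (D u),
          nilEval (PowerSeries.exp ℂ) (-LieAlgebra.ad ℂ 𝔤 u) y⁆ := by
  obtain ⟨N, hN⟩ := hu
  set T := LieAlgebra.ad ℂ 𝔤 u with hT
  have hB : D * T - T * D = LieAlgebra.ad ℂ 𝔤 (D u) := by
    ext z
    simp [hT, hD]
  have hk (k : ℕ) : (fun Z => T * Z - Z * T)^[k] (D * T - T * D) =
      LieAlgebra.ad ℂ 𝔤 ((T ^ k) (D u)) := by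
    induction k with
    | zero => exact hB
    | succ k ih =>
      rw [Function.iterate_succ_apply', ih, pow_succ', Module.End.mul_apply]
      ext z
      simp [hT]
  have h := commutator_exp_neg hN (D := D) fun k h => by
    rw [hk, pow_eq_zero_of_le h hN]
    simp
  have h2 : ∑ k ∈ Finset.range N, PowerSeries.coeff k toddInv •
        (fun Z => T * Z - Z * T)^[k] (D * T - T * D) =
      LieAlgebra.ad ℂ 𝔤 (nilEval toddInv T (D u)) := by
    rw [nilEval_eq_sum _ hN, LinearMap.sum_apply, map_sum]
    refine Finset.sum_congr rfl fun k _ => ?_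
    rw [hk, LinearMap.smul_apply, map_smul]
  rw [h2] at h
  have h3 := LinearMap.congr_fun h y
  simp only [LinearMap.sub_apply, Module.End.mul_apply, neg_mul, LinearMap.neg_apply,
    LieAlgebra.ad_apply] at h3
  rw [sub_eq_iff_eq_add] at h3
  rw [h3]
  abel

end LieExp

/-! ### The level filtration of the Lie algebra. -/

section LevelFiltration

open LieAlgebra LieAlgebra.IsKilling LieModule

variable {L : Type*} [LieRing L] [LieAlgebra ℂ L] [FiniteDimensional ℂ L]
  [LieAlgebra.IsSemisimple ℂ L] {H : LieSubalgebra ℂ L} [H.IsCartanSubalgebra]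
  (b : (rootSystem H).Base) (S : Set b.support)

/-- The linear forms whose level is an integer at most `k`. -/
def levelForms (k : ℤ) : Set (H → ℂ) :=
  {χ | ∃ φ : Dual ℂ H, χ = φ ∧ ∃ n : ℤ, n ≤ k ∧ level b S φ = n}

/-- The sum of the weight spaces of level at most `k`. -/
def levelFil (k : ℤ) : LieSubmodule ℂ H L := ⨆ χ, ⨆ (_ : χ ∈ levelForms b S k), rootSpace H χ

theorem levelFil_lie {j k : ℤ} {x y : L} (hx : x ∈ levelFil b S j) (hy : y ∈ levelFil b S k) :
    ⁅x, y⁆ ∈ levelFil b S (j + k) := by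
  have h0 : ∀ χ₁ ∈ levelForms b S j, ∀ χ₂ ∈ levelForms b S k, χ₁ + χ₂ ∈ levelForms b S (j + k) := by
    rintro _ ⟨φ, rfl, m, hm, hm'⟩ _ ⟨ψ, rfl, n, hn, hn'⟩
    exact ⟨φ + ψ, rfl, m + n, add_le_add hm hn, by rw [map_add, hm', hn']; push_cast; rfl⟩
  rw [levelFil] at hx
  induction hx using LieSubmodule.iSup_induction' with
  | zero => rw [zero_lie]; exact zero_mem _
  | add _ _ _ _ hu hv => rw [add_lie]; exact add_mem hu hv
  | mem χ₁ u hu =>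
    by_cases hχ₁ : χ₁ ∈ levelForms b S j
    swap
    · simp only [hχ₁, iSup_false, LieSubmodule.mem_bot] at hu
      rw [hu, zero_lie]
      exact zero_mem _
    simp only [hχ₁, iSup_true] at hu
    rw [levelFil] at hy
    induction hy using LieSubmodule.iSup_induction' with
    | zero => rw [lie_zero]; exact zero_mem _
    | add _ _ _ _ hu hv => rw [lie_add]; exact add_mem hu hv
    | mem χ₂ v hv =>
      by_cases hχ₂ : χ₂ ∈ levelForms b S k
      swap
      · simp only [hχ₂, iSup_false, LieSubmodule.mem_bot] at hv
        rw [hv, lie_zero]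
        exact zero_mem _
      simp only [hχ₂, iSup_true] at hv
      have h1 : rootSpace H (χ₁ + χ₂) ≤ levelFil b S (j + k) :=
        le_iSup₂_of_le (f := fun χ _ => rootSpace H χ) _ (h0 _ hχ₁ _ hχ₂) le_rfl
      exact h1 (lie_mem_genWeightSpace_of_mem_genWeightSpace hu hv)

theorem exists_level_weight (χ : Weight ℂ H L) :
    ∃ φ : Dual ℂ H, (χ : H → ℂ) = φ ∧ ∃ n : ℤ, level b S φ = n := by
  rcases weight_cases b S χ with h | ⟨γ, hγ, rfl⟩ | ⟨γ, hγ, rfl⟩ | ⟨γ, hγ, h⟩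
  · exact ⟨0, h, 0, by simp⟩
  · obtain ⟨φ, hφ, n, hn⟩ := levi_mem b S hγ
    exact ⟨φ, hφ, n, by simpa using hn⟩
  · obtain ⟨φ, hφ, n, hn⟩ := nil_mem b S hγ
    exact ⟨φ, hφ, n, by simpa using hn⟩
  · obtain ⟨φ, hφ, n, hn⟩ := nil_mem b S hγ
    exact ⟨-φ, by rw [h, hφ]; rfl, -n, by rw [map_neg, hn]; push_cast; rfl⟩

/-- There are finitely many weights, all of integral level; the sum of the absolute values of their
levels bounds each of them. -/
theorem exists_levelFil_bounds :
    ∃ K : ℤ, levelFil b S K = ⊤ ∧ ∀ k < -K, levelFil b S k = ⊥ := by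
  choose φ hφ n hn using exists_level_weight b S
  have _ : Fintype (Weight ℂ H L) := Fintype.ofFinite _
  have hle (χ) : |n χ| ≤ ∑ χ, |n χ| :=
    Finset.single_le_sum (f := fun χ => |n χ|) (fun _ _ => abs_nonneg _) (Finset.mem_univ χ)
  refine ⟨∑ χ, |n χ|, ?_, fun k hk => ?_⟩
  · rw [eq_top_iff, ← iSup_genWeightSpace_eq_top' ℂ H L]
    exact iSup_le fun χ => le_iSup₂_of_le (f := fun χ _ => rootSpace H χ) _
      ⟨φ χ, hφ χ, n χ, (le_abs_self _).trans (hle χ), hn χ⟩ le_rfl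
  · rw [levelFil, eq_bot_iff]
    refine iSup₂_le ?_
    rintro χ ⟨ψ, hψ, m, hm, hm'⟩
    by_contra hne
    rw [le_bot_iff] at hne
    have h1 := hφ ⟨χ, hne⟩
    have h2 : ψ = φ ⟨χ, hne⟩ := DFunLike.coe_injective (hψ.symm.trans h1)
    rw [h2, hn, Int.cast_inj] at hm'
    have := hle ⟨χ, hne⟩
    have := neg_abs_le (n ⟨χ, hne⟩)
    omega

/-- The only weights of negative level are the negatives of the nilradical roots. Brackets add
levels, so this description gives closure under brackets and shows that each root vector `f γ`
lowers the filtration. -/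
theorem oppNilradical_eq_levelFil : oppNilradical b S = levelFil b S (-1) := by
  apply le_antisymm
  · refine iSup₂_le fun γ hγ => ?_
    obtain ⟨n, hn, hn0⟩ := level_pos b S hγ.1
    refine le_iSup₂_of_le (f := fun χ _ => rootSpace H χ) _
      ⟨-(rootSystem H).root γ, rfl, -n, ?_, by rw [map_neg, hn]; push_cast; rfl⟩ le_rfl
    have : n ≠ 0 := fun h => hγ.2 (hn0 h)
    omega
  · refine iSup₂_le ?_
    rintro χ ⟨ψ, hψ, m, hm, hm'⟩
    by_cases hne : rootSpace H χ = ⊥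
    · rw [hne]; exact bot_le
    have key (φ : Dual ℂ H) (h : χ = φ) (n : ℕ) : level b S φ ≠ n := by
      intro h1
      have : ψ = φ := DFunLike.coe_injective (hψ.symm.trans h)
      rw [← this, hm'] at h1
      have : m = n := by exact_mod_cast h1
      omega
    rcases weight_cases b S ⟨χ, hne⟩ with h | ⟨γ, hγ, h⟩ | ⟨γ, hγ, h⟩ | h
    · exact absurd (map_zero (level b S)) (by simpa using key 0 h 0)
    · obtain ⟨φ, hφ, n, hn⟩ := levi_mem b S hγ
      rw [h] at hφ
      exact absurd hn (key φ hφ n)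
    · obtain ⟨φ, hφ, n, hn⟩ := nil_mem b S hγ
      rw [h] at hφ
      exact absurd hn (key φ hφ n)
    · rw [oppNilradical_eq]
      exact le_iSup₂_of_le (f := fun χ _ => rootSpace H χ) _ h le_rfl

theorem oppNilradical_lie {x y : L} (hx : x ∈ oppNilradical b S) (hy : y ∈ oppNilradical b S) :
    ⁅x, y⁆ ∈ oppNilradical b S := by
  rw [oppNilradical_eq_levelFil] at *
  have h := levelFil_lie b S hx hy
  refine (biSup_mono ?_ : levelFil b S (-1 + -1) ≤ levelFil b S (-1)) h
  rintro _ ⟨φ, rfl, m, hm, hm'⟩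
  exact ⟨φ, rfl, m, by omega, hm'⟩

variable {b S} (f : NegRootVectors b S)

theorem NegRootVectors.vec_mem (γ : nilRoots b S) : f.vec γ ∈ oppNilradical b S := by
  rw [← f.basis_apply]
  exact (f.basis γ).2

end LevelFiltration

/-! ### Lie algebras with polynomial coefficients. -/

section PolyLie

variable {R L : Type*} [CommRing R] [Algebra ℂ R] [LieRing L] [LieAlgebra ℂ L]

/-- The elements of `R ⊗ L` with components in the subspace `N` of `L`. -/
def polySub (R : Type*) [CommRing R] [Algebra ℂ R] (N : Submodule ℂ L) : Submodule ℂ (R ⊗[ℂ] L) :=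
  LinearMap.range (LinearMap.lTensor R N.subtype)

theorem tmul_mem_polySub {N : Submodule ℂ L} (r : R) {y : L} (hy : y ∈ N) :
    r ⊗ₜ[ℂ] y ∈ polySub R N := ⟨r ⊗ₜ ⟨y, hy⟩, rfl⟩

theorem polySub_induction {Y : Type*} [AddCommGroup Y] [Module ℂ Y] {N : Submodule ℂ L}
    {φ : R ⊗[ℂ] L →ₗ[ℂ] Y} {N' : Submodule ℂ Y} (h : ∀ r, ∀ y ∈ N, φ (r ⊗ₜ y) ∈ N')
    {z : R ⊗[ℂ] L} (hz : z ∈ polySub R N) : φ z ∈ N' := by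
  obtain ⟨z, rfl⟩ := hz
  induction z using TensorProduct.induction_on with
  | zero => simp
  | tmul r y => exact h r y y.2
  | add z z' hz hz' => rw [map_add, map_add]; exact add_mem hz hz'

theorem polySub_lie {N N' N'' : Submodule ℂ L} (h : ∀ x ∈ N, ∀ y ∈ N', ⁅x, y⁆ ∈ N'')
    {x y : R ⊗[ℂ] L} (hx : x ∈ polySub R N) (hy : y ∈ polySub R N') : ⁅x, y⁆ ∈ polySub R N'' := by
  obtain ⟨x, rfl⟩ := hx
  obtain ⟨y, rfl⟩ := hy
  induction x using TensorProduct.induction_on with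
  | zero => rw [map_zero, zero_lie]; exact zero_mem _
  | add x x' hx hx' => rw [map_add, add_lie]; exact add_mem hx hx'
  | tmul r a =>
    induction y using TensorProduct.induction_on with
    | zero => rw [map_zero, lie_zero]; exact zero_mem _
    | add y y' hy hy' => rw [map_add, lie_add]; exact add_mem hy hy'
    | tmul s c =>
      rw [LinearMap.lTensor_tmul, LinearMap.lTensor_tmul, LieAlgebra.ExtendScalars.bracket_tmul]
      exact tmul_mem_polySub _ (h _ a.2 _ c.2)

theorem polySub_bot : polySub R (⊥ : Submodule ℂ L) = ⊥ := by
  rw [eq_bot_iff]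
  intro z hz
  refine polySub_induction (φ := LinearMap.id) (fun r y hy => ?_) hz
  rw [(Submodule.mem_bot ℂ).1 hy]
  simp

theorem polySub_top : polySub R (⊤ : Submodule ℂ L) = ⊤ := by
  rw [eq_top_iff]
  intro z h
  clear h
  induction z using TensorProduct.induction_on with
  | zero => exact zero_mem _
  | tmul r y => exact tmul_mem_polySub r Submodule.mem_top
  | add z z' hz hz' => exact add_mem hz hz'

/-- The action of a derivation on coefficients. -/
def polyDer (L : Type*) [LieRing L] [LieAlgebra ℂ L] (D : Derivation ℂ R R) : End ℂ (R ⊗[ℂ] L) :=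
  LinearMap.rTensor L (D : R →ₗ[ℂ] R)

theorem polyDer_tmul (D : Derivation ℂ R R) (r : R) (y : L) :
    polyDer L D (r ⊗ₜ y) = D r ⊗ₜ y := rfl

theorem polyDer_lie (D : Derivation ℂ R R) (y z : R ⊗[ℂ] L) :
    polyDer L D ⁅y, z⁆ = ⁅polyDer L D y, z⁆ + ⁅y, polyDer L D z⁆ := by
  induction y using TensorProduct.induction_on with
  | zero => simp
  | add y y' hy hy' => simp only [add_lie, map_add, hy, hy']; abel
  | tmul r a =>
    induction z using TensorProduct.induction_on with
    | zero => simp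
    | add z z' hz hz' => simp only [lie_add, map_add, hz, hz']; abel
    | tmul s c =>
      simp only [polyDer_tmul, LieAlgebra.ExtendScalars.bracket_tmul, Derivation.leibniz,
        TensorProduct.add_tmul, smul_eq_mul]
      rw [add_comm, mul_comm s]

theorem polyDer_lTensor {L' : Type*} [LieRing L'] [LieAlgebra ℂ L'] (D : Derivation ℂ R R)
    (φ : L →ₗ[ℂ] L') (y : R ⊗[ℂ] L) :
    polyDer L' D (LinearMap.lTensor R φ y) = LinearMap.lTensor R φ (polyDer L D y) := by
  induction y using TensorProduct.induction_on with
  | zero => simp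
  | add y y' hy hy' => simp only [map_add, hy, hy']
  | tmul r a => rfl

/-- A linear functional on the coefficients carries `z` into the centre of `L`, which is zero; the
coordinate functionals of a basis of `R` separate the points of `R ⊗ L`. -/
theorem eq_zero_of_lie_eq_zero (hL : LieAlgebra.center ℂ L = ⊥) {z : R ⊗[ℂ] L}
    (hz : ∀ c : L, ⁅z, (1 : R) ⊗ₜ[ℂ] c⁆ = 0) : z = 0 := by
  classical
  let B := Basis.ofVectorSpace ℂ R
  have key (φ : R →ₗ[ℂ] ℂ) (c : L) (z : R ⊗[ℂ] L) :
      TensorProduct.lid ℂ L (LinearMap.rTensor L φ ⁅z, (1 : R) ⊗ₜ[ℂ] c⁆) =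
        ⁅TensorProduct.lid ℂ L (LinearMap.rTensor L φ z), c⁆ := by
    induction z using TensorProduct.induction_on with
    | zero => simp
    | add y y' hy hy' => simp only [map_add, add_lie, hy, hy']
    | tmul r a => simp
  have hφ (φ : R →ₗ[ℂ] ℂ) : TensorProduct.lid ℂ L (LinearMap.rTensor L φ z) = 0 := by
    have : TensorProduct.lid ℂ L (LinearMap.rTensor L φ z) ∈ LieAlgebra.center ℂ L := by
      rw [LieModule.mem_maxTrivSubmodule]
      intro c
      rw [← lie_skew, ← key, hz, map_zero, map_zero, neg_zero]
    rwa [hL, LieSubmodule.mem_bot] at this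
  apply (TensorProduct.equivFinsuppOfBasisLeft B).injective
  rw [map_zero]
  ext i
  have h1 (z : R ⊗[ℂ] L) : TensorProduct.equivFinsuppOfBasisLeft B z i =
      TensorProduct.lid ℂ L (LinearMap.rTensor L (B.coord i) z) := by
    induction z using TensorProduct.induction_on with
    | zero => simp
    | add y y' hy hy' => simp only [map_add, Finsupp.add_apply, hy, hy']
    | tmul r a => simp
  rw [h1, hφ]
  rfl

end PolyLie

section NilEvalNeg

theorem nilEval_neg {V : Type*} [AddCommGroup V] [Module ℂ V] (q : PowerSeries ℂ) (T : End ℂ V) :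
    nilEval q (-T) = nilEval (PowerSeries.evalNegHom q) T := by
  have h (n : ℕ) : (-T) ^ n = ((-1) ^ n : ℂ) • T ^ n := by
    rw [← neg_one_smul ℂ T, smul_pow]
  have hc : nilpotencyClass (-T) = nilpotencyClass T := by
    unfold nilpotencyClass
    congr 1
    ext n
    simp [h]
  rw [nilEval, nilEval, hc]
  refine Finset.sum_congr rfl fun n _ => ?_
  rw [h, smul_smul, PowerSeries.evalNegHom, PowerSeries.coeff_rescale, mul_comm]

end NilEvalNeg

/-! ### The homomorphism from the enveloping algebra to the Weyl algebra. -/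

section VectorFields

attribute [local instance 100] LieRing.ofAssociativeRing

open LieAlgebra LieAlgebra.IsKilling LieModule

variable {L : Type*} [LieRing L] [LieAlgebra ℂ L] [FiniteDimensional ℂ L]
  [LieAlgebra.IsSemisimple ℂ L] {H : LieSubalgebra ℂ L} [H.IsCartanSubalgebra]
  {b : (rootSystem H).Base} {S : Set b.support} (f : NegRootVectors b S)

theorem PolyFun.add_lie (x y z : PolyFun b S ⊗[ℂ] L) : ⁅x + y, z⁆ = ⁅x, z⁆ + ⁅y, z⁆ :=
  _root_.add_lie x y z

theorem PolyFun.lie_add (x y z : PolyFun b S ⊗[ℂ] L) : ⁅x, y + z⁆ = ⁅x, y⁆ + ⁅x, z⁆ :=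
  _root_.lie_add x y z

theorem PolyFun.sub_lie (x y z : PolyFun b S ⊗[ℂ] L) : ⁅x - y, z⁆ = ⁅x, z⁆ - ⁅y, z⁆ :=
  _root_.sub_lie x y z

theorem PolyFun.lie_sub (x y z : PolyFun b S ⊗[ℂ] L) : ⁅x, y - z⁆ = ⁅x, y⁆ - ⁅x, z⁆ :=
  _root_.lie_sub x y z

theorem PolyFun.neg_lie (x y : PolyFun b S ⊗[ℂ] L) : ⁅-x, y⁆ = -⁅x, y⁆ :=
  _root_.neg_lie x y

theorem PolyFun.zero_lie (x : PolyFun b S ⊗[ℂ] L) : ⁅(0 : PolyFun b S ⊗[ℂ] L), x⁆ = 0 :=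
  _root_.zero_lie x

theorem PolyFun.lie_zero (x : PolyFun b S ⊗[ℂ] L) : ⁅x, (0 : PolyFun b S ⊗[ℂ] L)⁆ = 0 :=
  _root_.lie_zero x

theorem PolyFun.lie_skew (x y : PolyFun b S ⊗[ℂ] L) : -⁅y, x⁆ = ⁅x, y⁆ :=
  _root_.lie_skew x y

theorem PolyFun.lie_lie (x y z : PolyFun b S ⊗[ℂ] L) : ⁅⁅x, y⁆, z⁆ = ⁅x, ⁅y, z⁆⁆ - ⁅y, ⁅x, z⁆⁆ :=
  _root_.lie_lie x y z

theorem adGeneric_apply (y : PolyFun b S ⊗[ℂ] L) : adGeneric f y = ⁅genericElt f, y⁆ := rfl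

theorem adGeneric_tmul (p : PolyFun b S) (y : L) :
    adGeneric f (p ⊗ₜ y) = ∑ γ, (MvPolynomial.X γ * p) ⊗ₜ[ℂ] ⁅f.vec γ, y⁆ := by
  exact sum_lie (L := PolyFun b S ⊗[ℂ] L) (M := PolyFun b S ⊗[ℂ] L) Finset.univ
    (fun γ => MvPolynomial.X γ ⊗ₜ f.vec γ) (p ⊗ₜ y)

theorem adGeneric_mem_polySub {N N' : Submodule ℂ L} (h : ∀ γ, ∀ y ∈ N, ⁅f.vec γ, y⁆ ∈ N')
    {z : PolyFun b S ⊗[ℂ] L} (hz : z ∈ polySub (PolyFun b S) N) :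
    adGeneric f z ∈ polySub (PolyFun b S) N' := by
  refine polySub_induction (fun p y hy => ?_) hz
  rw [adGeneric_tmul]
  exact Submodule.sum_mem _ fun γ _ => tmul_mem_polySub _ (h γ y hy)

/-- Each `f γ` lowers the level by at least one, while levels are bounded on both sides. -/
theorem isNilpotent_adGeneric : IsNilpotent (adGeneric f) := by
  obtain ⟨K, hK, hK'⟩ := exists_levelFil_bounds b S
  have h (n : ℕ) (z : PolyFun b S ⊗[ℂ] L) :
      ((adGeneric f) ^ n) z ∈ polySub (PolyFun b S) (levelFil b S (K - n)).toSubmodule := by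
    induction n with
    | zero =>
      rw [Nat.cast_zero, sub_zero, hK, LieSubmodule.top_toSubmodule, polySub_top]
      exact Submodule.mem_top
    | succ n ih =>
      rw [pow_succ', Module.End.mul_apply]
      refine adGeneric_mem_polySub f (fun γ y hy => ?_) ih
      have h1 := f.vec_mem γ
      rw [oppNilradical_eq_levelFil] at h1
      have h2 := levelFil_lie b S h1 hy
      have h3 : (-1 : ℤ) + (K - n) = K - (n + 1 : ℕ) := by push_cast; ring
      rwa [h3] at h2
  -- Starting at level at most `K`, this many steps lead below `-K`, where the filtration is zero.
  refine ⟨(2 * K + 1).toNat, LinearMap.ext fun z => ?_⟩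
  have h1 := h (2 * K + 1).toNat z
  rw [hK' _ (by omega), LieSubmodule.bot_toSubmodule, polySub_bot] at h1
  exact h1

theorem polyProjOpp_apply_of_mem {z : PolyFun b S ⊗[ℂ] L}
    (hz : z ∈ polySub (PolyFun b S) (oppNilradical b S).toSubmodule) :
    polyProjOpp b S z = z := by
  have h : polyProjOpp b S z - z ∈ (⊥ : Submodule ℂ (PolyFun b S ⊗[ℂ] L)) := by
    refine polySub_induction (φ := polyProjOpp b S - LinearMap.id) (fun p y hy => ?_) hz
    have : projOpp b S y = ⟨y, hy⟩ := Submodule.projectionOnto_apply_left _ ⟨y, hy⟩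
    rw [LinearMap.sub_apply, polyProjOpp, LinearMap.lTensor_tmul, LinearMap.comp_apply, this]
    exact sub_self _
  exact sub_eq_zero.1 h

theorem polyProjOpp_mem (z : PolyFun b S ⊗[ℂ] L) :
    polyProjOpp b S z ∈ polySub (PolyFun b S) (oppNilradical b S).toSubmodule := by
  induction z using TensorProduct.induction_on with
  | zero => rw [map_zero]; exact zero_mem _
  | tmul p y => exact tmul_mem_polySub _ (projOpp b S y).2
  | add y z hy hz => rw [map_add]; exact add_mem hy hz

theorem sub_polyProjOpp_mem (z : PolyFun b S ⊗[ℂ] L) :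
    z - polyProjOpp b S z ∈ polySub (PolyFun b S) (parabolic b S).toSubmodule := by
  induction z using TensorProduct.induction_on with
  | zero => rw [map_zero, sub_zero]; exact zero_mem _
  | tmul p y =>
    have h : y - projOpp b S y ∈ parabolic b S := by
      refine (Submodule.projectionOnto_apply_eq_zero_iff
        (isCompl_oppNilradical_parabolic b S)).1 ?_
      rw [map_sub, Submodule.projectionOnto_apply_left, sub_eq_zero]
      rfl
    have h2 : p ⊗ₜ y - polyProjOpp b S (p ⊗ₜ y) = p ⊗ₜ[ℂ] (y - projOpp b S y) := by
      rw [TensorProduct.tmul_sub]; rfl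
    rw [h2]
    exact tmul_mem_polySub _ h
  | add y z hy hz =>
    rw [map_add, add_sub_add_comm]
    exact add_mem hy hz

theorem polyProjOpp_eq_zero_of_mem {z : PolyFun b S ⊗[ℂ] L}
    (hz : z ∈ polySub (PolyFun b S) (parabolic b S).toSubmodule) : polyProjOpp b S z = 0 := by
  rw [← Submodule.mem_bot ℂ]
  refine polySub_induction (φ := polyProjOpp b S) (fun p y hy => ?_) hz
  have : projOpp b S y = 0 := Submodule.projectionOnto_apply_right _ ⟨y, hy⟩
  rw [polyProjOpp, LinearMap.lTensor_tmul, LinearMap.comp_apply, this, map_zero,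
    TensorProduct.tmul_zero]
  exact zero_mem _

theorem polyCoord_tmul (γ : nilRoots b S) (p : PolyFun b S) (y : L) :
    polyCoord f γ (p ⊗ₜ y) = f.basis.coord γ (projOpp b S y) • p := by
  simp [polyCoord]

theorem sum_polyCoord (z : PolyFun b S ⊗[ℂ] L) :
    ∑ γ, polyCoord f γ z ⊗ₜ[ℂ] f.vec γ = polyProjOpp b S z := by
  induction z using TensorProduct.induction_on with
  | zero => simp
  | tmul p y =>
    have h : ∑ γ, f.basis.coord γ (projOpp b S y) • f.vec γ = projOpp b S y := by
      have := congrArg Subtype.val (f.basis.sum_repr (projOpp b S y))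
      rw [AddSubmonoidClass.coe_finsetSum] at this
      rw [← this]
      refine Finset.sum_congr rfl fun γ _ => ?_
      rw [← f.basis_apply]
      rfl
    have h2 : polyProjOpp b S (p ⊗ₜ y) = p ⊗ₜ[ℂ] (projOpp b S y : L) := rfl
    rw [h2, ← h, TensorProduct.tmul_sum]
    refine Finset.sum_congr rfl fun γ _ => ?_
    rw [polyCoord_tmul, TensorProduct.smul_tmul]
  | add y z hy hz => simp only [map_add, TensorProduct.add_tmul, Finset.sum_add_distrib, hy, hz]

theorem polyCoord_sum (p : nilRoots b S → PolyFun b S) (γ : nilRoots b S) :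
    polyCoord f γ (∑ δ, p δ ⊗ₜ[ℂ] f.vec δ) = p γ := by
  classical
  have h (δ) : projOpp b S (f.vec δ) = f.basis δ := by
    rw [← f.basis_apply]
    exact Submodule.projectionOnto_apply_left _ _
  rw [map_sum, Finset.sum_eq_single γ]
  · rw [polyCoord_tmul, h]
    simp
  · intro δ _ hδ
    rw [polyCoord_tmul, h, Basis.coord_apply, Basis.repr_self, Finsupp.single_apply, if_neg hδ,
      zero_smul]
  · simp

/-- The coefficient of `∂ γ` in `piFormula f F a`, up to sign. -/
def coeffD (a : L) (γ : nilRoots b S) : PolyFun b S :=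
  polyCoord f γ (nilEval todd (adGeneric f) (polyProjOpp b S (expTwist f a)))

/-- The vector field by which `a` acts on functions on the opposite nilradical. -/
def field (a : L) : Derivation ℂ (PolyFun b S) (PolyFun b S) :=
  MvPolynomial.mkDerivation ℂ fun γ => -coeffD f a γ

theorem field_X (a : L) (γ : nilRoots b S) : field f a (MvPolynomial.X γ) = -coeffD f a γ :=
  MvPolynomial.mkDerivation_X _ _ _

theorem polyDer_genericElt (D : Derivation ℂ (PolyFun b S) (PolyFun b S)) :
    polyDer L D (genericElt f) = ∑ γ, D (MvPolynomial.X γ) ⊗ₜ[ℂ] f.vec γ := by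
  rw [genericElt, map_sum]
  rfl

theorem nilEval_adGeneric_mem (q : PowerSeries ℂ) {z : PolyFun b S ⊗[ℂ] L}
    (hz : z ∈ polySub (PolyFun b S) (oppNilradical b S).toSubmodule) :
    nilEval q (adGeneric f) z ∈ polySub (PolyFun b S) (oppNilradical b S).toSubmodule :=
  nilEval_mem q (fun _ hv => adGeneric_mem_polySub f
    (fun γ _ hy => oppNilradical_lie b S (f.vec_mem γ) hy) hv) hz

/-- The opposite nilradical is closed under brackets, so it contains the right-hand side, which is
therefore recovered from its coordinates, the coefficients of the field. -/
theorem polyDer_field_genericElt (a : L) :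
    polyDer L (field f a) (genericElt f) =
      -nilEval todd (adGeneric f) (polyProjOpp b S (expTwist f a)) := by
  rw [polyDer_genericElt]
  simp only [field_X, TensorProduct.neg_tmul, Finset.sum_neg_distrib]
  rw [← polyProjOpp_apply_of_mem (nilEval_adGeneric_mem f todd (polyProjOpp_mem _)),
    ← sum_polyCoord f]
  rfl

theorem polyDer_expTwist (D : Derivation ℂ (PolyFun b S) (PolyFun b S)) (a : L) :
    polyDer L D (expTwist f a) =
      -⁅nilEval toddInv (adGeneric f) (polyDer L D (genericElt f)), expTwist f a⁆ := by
  have h := derivation_nilEval_exp (isNilpotent_adGeneric f) (polyDer L D) (polyDer_lie D)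
    ((1 : PolyFun b S) ⊗ₜ[ℂ] a)
  rw [polyDer_tmul, Derivation.map_one_eq_zero, TensorProduct.zero_tmul, map_zero, zero_sub] at h
  exact h

theorem nilEval_toddInv_todd (z : PolyFun b S ⊗[ℂ] L) :
    nilEval toddInv (adGeneric f) (nilEval todd (adGeneric f) z) = z := by
  have h := nilEval_mul toddInv todd (isNilpotent_adGeneric f)
  rw [mul_comm, todd_mul_toddInv, nilEval_one (isNilpotent_adGeneric f)] at h
  exact (LinearMap.congr_fun h z).symm

theorem nilEval_todd_toddInv (z : PolyFun b S ⊗[ℂ] L) :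
    nilEval todd (adGeneric f) (nilEval toddInv (adGeneric f) z) = z := by
  have h := nilEval_mul todd toddInv (isNilpotent_adGeneric f)
  rw [todd_mul_toddInv, nilEval_one (isNilpotent_adGeneric f)] at h
  exact (LinearMap.congr_fun h z).symm

/-- The Todd series in the definition of the field cancels the inverse series produced by
differentiating the exponential. This identity is all that is needed about the field to prove the
bracket relations. -/
theorem polyDer_field_expTwist (a c : L) :
    polyDer L (field f a) (expTwist f c) = ⁅polyProjOpp b S (expTwist f a), expTwist f c⁆ := by
  rw [polyDer_expTwist, polyDer_field_genericElt, map_neg, nilEval_toddInv_todd, PolyFun.neg_lie, neg_neg]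

theorem expTwist_lie (a c : L) : expTwist f ⁅a, c⁆ = ⁅expTwist f a, expTwist f c⁆ := by
  have h := lie_nilEval_exp (isNilpotent_adGeneric f) ((1 : PolyFun b S) ⊗ₜ[ℂ] a)
    ((1 : PolyFun b S) ⊗ₜ[ℂ] c)
  rw [LieAlgebra.ExtendScalars.bracket_tmul, one_mul] at h
  exact h

/-- Applying the inverse automorphism e^{ad u} turns the elements `expTwist f c` into the constants
`1 ⊗ c`, and 𝔤 has trivial centre. -/
theorem eq_zero_of_lie_expTwist {z : PolyFun b S ⊗[ℂ] L} (hz : ∀ c : L, ⁅z, expTwist f c⁆ = 0) :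
    z = 0 := by
  have hn := isNilpotent_adGeneric f
  have h1 : nilEval (PowerSeries.exp ℂ) (adGeneric f) *
      nilEval (PowerSeries.exp ℂ) (-adGeneric f) = 1 := by
    rw [nilEval_neg, ← nilEval_mul _ _ hn, PowerSeries.exp_mul_exp_neg_eq_one, nilEval_one hn]
  have h2 : nilEval (PowerSeries.exp ℂ) (-adGeneric f) *
      nilEval (PowerSeries.exp ℂ) (adGeneric f) = 1 := by
    rw [nilEval_neg, ← nilEval_mul _ _ hn, mul_comm, PowerSeries.exp_mul_exp_neg_eq_one,
      nilEval_one hn]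
  have h3 : -LieAlgebra.ad ℂ (PolyFun b S ⊗[ℂ] L) (-genericElt f) = adGeneric f := by
    rw [map_neg, neg_neg]; rfl
  have h4 : nilEval (PowerSeries.exp ℂ) (adGeneric f) z = 0 := by
    refine eq_zero_of_lie_eq_zero (center_eq_bot ℂ L) fun c => ?_
    -- The exponential lemma is stated for e^{-ad u}; replacing `u` by its negative gives e^{ad u}.
    have h5 := lie_nilEval_exp (u := -genericElt f)
      (by rw [← neg_neg (LieAlgebra.ad ℂ _ _), h3]; exact hn.neg) z (expTwist f c)
    rw [h3, hz, map_zero] at h5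
    have h6 : nilEval (PowerSeries.exp ℂ) (adGeneric f) (expTwist f c) = 1 ⊗ₜ c :=
      LinearMap.congr_fun h1 _
    rw [h6] at h5
    exact h5.symm
  have h7 := LinearMap.congr_fun h2 z
  rw [Module.End.mul_apply, h4, map_zero] at h7
  exact h7.symm

/-- The values on the twisted constants determine (1 - e^{-ad u}) / ad u applied to D u; that
operator is invertible, with inverse the Todd operator, so they determine D u and hence every D x_γ.
-/
theorem derivation_ext_of_expTwist {D₁ D₂ : Derivation ℂ (PolyFun b S) (PolyFun b S)}
    (h : ∀ c, polyDer L D₁ (expTwist f c) = polyDer L D₂ (expTwist f c)) : D₁ = D₂ := by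
  have h1 : nilEval toddInv (adGeneric f) (polyDer L D₁ (genericElt f)) -
      nilEval toddInv (adGeneric f) (polyDer L D₂ (genericElt f)) = 0 := by
    refine eq_zero_of_lie_expTwist f fun c => ?_
    have := h c
    rw [polyDer_expTwist, polyDer_expTwist, neg_inj] at this
    rw [PolyFun.sub_lie, this, sub_self]
  have h2 := congrArg (nilEval todd (adGeneric f)) (sub_eq_zero.1 h1)
  rw [nilEval_todd_toddInv, nilEval_todd_toddInv, polyDer_genericElt, polyDer_genericElt] at h2
  refine MvPolynomial.derivation_ext fun γ => ?_
  have h3 := congrArg (polyCoord f γ) h2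
  rwa [polyCoord_sum, polyCoord_sum] at h3

/-- The bracket of two twisted constants, split into components, using that the twist preserves
brackets. The first and third terms on the right lie in the opposite nilradical and in 𝔭, so each
disappears under the projection to the other side. -/
theorem lie_components (a c : L) :
    ⁅polyProjOpp b S (expTwist f a), expTwist f c⁆ - ⁅polyProjOpp b S (expTwist f c), expTwist f a⁆ =
      ⁅polyProjOpp b S (expTwist f a), polyProjOpp b S (expTwist f c)⁆ + expTwist f ⁅a, c⁆ -
        ⁅expTwist f a - polyProjOpp b S (expTwist f a),
          expTwist f c - polyProjOpp b S (expTwist f c)⁆ := by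
  rw [expTwist_lie]
  simp only [PolyFun.lie_sub, PolyFun.sub_lie]
  rw [← PolyFun.lie_skew (expTwist f a) (polyProjOpp b S (expTwist f c))]
  abel

theorem lie_polyProjOpp_mem (y z : PolyFun b S ⊗[ℂ] L) :
    ⁅polyProjOpp b S y, polyProjOpp b S z⁆ ∈
      polySub (PolyFun b S) (oppNilradical b S).toSubmodule :=
  polySub_lie (fun _ hx _ hy => oppNilradical_lie b S hx hy) (polyProjOpp_mem _) (polyProjOpp_mem _)

theorem lie_sub_polyProjOpp_mem (y z : PolyFun b S ⊗[ℂ] L) :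
    ⁅y - polyProjOpp b S y, z - polyProjOpp b S z⁆ ∈
      polySub (PolyFun b S) (parabolic b S).toSubmodule :=
  polySub_lie (fun _ hx _ hy => (parabolic b S).lie_mem hx hy) (sub_polyProjOpp_mem _)
    (sub_polyProjOpp_mem _)

/-- Compared on twisted constants, the iterated brackets combine by the Jacobi identity, and what is
left is the opposite component of `lie_components`. -/
theorem field_lie (a c : L) : field f ⁅a, c⁆ = ⁅field f a, field f c⁆ := by
  refine derivation_ext_of_expTwist f fun e => ?_
  have h0 (D₁ D₂ : Derivation ℂ (PolyFun b S) (PolyFun b S)) (z : PolyFun b S ⊗[ℂ] L) :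
      polyDer L ⁅D₁, D₂⁆ z = polyDer L D₁ (polyDer L D₂ z) - polyDer L D₂ (polyDer L D₁ z) := by
    induction z using TensorProduct.induction_on with
    | zero => simp
    | tmul p y =>
      simp only [polyDer_tmul, Derivation.commutator_apply, TensorProduct.sub_tmul]
    | add y z hy hz => simp only [map_add, hy, hz]; abel
  have h1 (D) (z : PolyFun b S ⊗[ℂ] L) :
      polyDer L D (polyProjOpp b S z) = polyProjOpp b S (polyDer L D z) := polyDer_lTensor D _ z
  rw [h0]
  simp only [polyDer_field_expTwist, polyDer_lie, h1]
  have h2 := congrArg (polyProjOpp b S) (lie_components f a c)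
  rw [map_sub, map_sub, map_add, polyProjOpp_apply_of_mem (lie_polyProjOpp_mem _ _),
    polyProjOpp_eq_zero_of_mem (lie_sub_polyProjOpp_mem _ _), sub_zero] at h2
  rw [← sub_eq_iff_eq_add'] at h2
  rw [← h2]
  simp only [PolyFun.sub_lie, PolyFun.lie_lie]
  abel

variable (F : Type*) [AddCommGroup F] [Module ℂ F] [LieRingModule (parabolic b S) F]
  [LieModule ℂ (parabolic b S) F]

theorem polySigma_tmul (p : PolyFun b S) (y : L) :
    polySigma F (p ⊗ₜ y) =
      Weyl.ofPoly p ⊗ₜ[ℂ] LieModule.toEnd ℂ (parabolic b S) F (projPar b S y) := rfl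

theorem polySigma_eq_zero_of_mem {z : PolyFun b S ⊗[ℂ] L}
    (hz : z ∈ polySub (PolyFun b S) (oppNilradical b S).toSubmodule) : polySigma F z = 0 := by
  rw [← Submodule.mem_bot ℂ]
  refine polySub_induction (φ := polySigma F) (fun p y hy => ?_) hz
  have : projPar b S y = 0 := Submodule.projectionOnto_apply_right _ ⟨y, hy⟩
  rw [polySigma_tmul, this, map_zero, TensorProduct.tmul_zero]
  exact zero_mem _

theorem polySigma_lie {y z : PolyFun b S ⊗[ℂ] L}
    (hy : y ∈ polySub (PolyFun b S) (parabolic b S).toSubmodule)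
    (hz : z ∈ polySub (PolyFun b S) (parabolic b S).toSubmodule) :
    polySigma F ⁅y, z⁆ = polySigma F y * polySigma F z - polySigma F z * polySigma F y := by
  obtain ⟨y, rfl⟩ := hy
  obtain ⟨z, rfl⟩ := hz
  have hσ (r : PolyFun b S) (a : parabolic b S) : polySigma F (r ⊗ₜ[ℂ] (a : L)) =
      Weyl.ofPoly r ⊗ₜ[ℂ] LieModule.toEnd ℂ (parabolic b S) F a := by
    have hp : projPar b S (a : L) = a := Submodule.projectionOnto_apply_left _ a
    rw [polySigma_tmul, hp]
  induction y using TensorProduct.induction_on with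
  | zero => rw [map_zero, PolyFun.zero_lie, map_zero, zero_mul, mul_zero, sub_zero]
  | add y y' hy hy' =>
    rw [map_add, PolyFun.add_lie, map_add, hy, hy', map_add, add_mul, mul_add]
    abel
  | tmul r a =>
    induction z using TensorProduct.induction_on with
    | zero => rw [map_zero, PolyFun.lie_zero, map_zero, zero_mul, mul_zero, sub_zero]
    | add z z' hz hz' =>
      rw [map_add, PolyFun.lie_add, map_add, hz, hz', map_add, add_mul, mul_add]
      abel
    | tmul s c =>
      let a' : parabolic b S := a
      let c' : parabolic b S := c
      have h : polySigma F ((r * s) ⊗ₜ[ℂ] ((⁅a', c'⁆ : parabolic b S) : L)) =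
          polySigma F (r ⊗ₜ[ℂ] (a' : L)) * polySigma F (s ⊗ₜ[ℂ] (c' : L)) -
          polySigma F (s ⊗ₜ[ℂ] (c' : L)) * polySigma F (r ⊗ₜ[ℂ] (a' : L)) := by
        rw [hσ, hσ, hσ, LieHom.map_lie, LieRing.of_associative_ring_bracket,
          Algebra.TensorProduct.tmul_mul_tmul, Algebra.TensorProduct.tmul_mul_tmul,
          ← map_mul Weyl.ofPoly, ← map_mul Weyl.ofPoly, mul_comm s, TensorProduct.tmul_sub]
      exact h

/-- The vector field commutes with the operators on `F` and differentiates the polynomial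
coefficients. -/
theorem vecField_lie_polySigma (D : Derivation ℂ (PolyFun b S) (PolyFun b S))
    (z : PolyFun b S ⊗[ℂ] L) :
    (Weyl.vecField D ⊗ₜ[ℂ] 1 : WeylU b S ⊗[ℂ] End ℂ F) * polySigma F z -
      polySigma F z * (Weyl.vecField D ⊗ₜ[ℂ] 1) = polySigma F (polyDer L D z) := by
  induction z using TensorProduct.induction_on with
  | zero => rw [map_zero, map_zero, map_zero, zero_mul, mul_zero, sub_zero]
  | add y y' hy hy' => rw [map_add, map_add, map_add, ← hy, ← hy', mul_add, add_mul]; abel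
  | tmul r a =>
    rw [polySigma_tmul, polyDer_tmul, polySigma_tmul,
      Algebra.TensorProduct.tmul_mul_tmul, Algebra.TensorProduct.tmul_mul_tmul, one_mul, mul_one,
      Weyl.vecField_mul_ofPoly, TensorProduct.add_tmul, add_sub_cancel_left]

theorem piFormula_eq (a : L) :
    piFormula f F a = Weyl.vecField (field f a) ⊗ₜ[ℂ] 1 + polySigma F (expTwist f a) := by
  rw [piFormula, Weyl.vecField]
  simp only [field_X, map_neg, neg_mul, Finset.sum_neg_distrib, TensorProduct.neg_tmul,
    TensorProduct.sum_tmul]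
  rfl

/-- The vector fields close by `field_lie`. By `polyDer_field_expTwist` the mixed commutators are
the left-hand side of `lie_components` under `polySigma`, and the commutator of the two `polySigma`
terms cancels its last bracket. -/
theorem piFormula_lie (a c : L) :
    piFormula f F ⁅a, c⁆ = piFormula f F a * piFormula f F c - piFormula f F c * piFormula f F a := by
  have h1 : (Weyl.vecField (field f a) ⊗ₜ[ℂ] 1 : WeylU b S ⊗[ℂ] End ℂ F) *
      (Weyl.vecField (field f c) ⊗ₜ[ℂ] 1) -
      (Weyl.vecField (field f c) ⊗ₜ[ℂ] 1) * (Weyl.vecField (field f a) ⊗ₜ[ℂ] 1) =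
      Weyl.vecField (field f ⁅a, c⁆) ⊗ₜ[ℂ] 1 := by
    rw [Algebra.TensorProduct.tmul_mul_tmul, Algebra.TensorProduct.tmul_mul_tmul, one_mul,
      ← TensorProduct.sub_tmul, Weyl.vecField_lie, field_lie]
  have h2 (a : L) : polySigma F (expTwist f a) =
      polySigma F (expTwist f a - polyProjOpp b S (expTwist f a)) := by
    rw [map_sub, polySigma_eq_zero_of_mem F (polyProjOpp_mem _), sub_zero]
  have h3 : polySigma F (expTwist f a) * polySigma F (expTwist f c) -
      polySigma F (expTwist f c) * polySigma F (expTwist f a) =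
      polySigma F ⁅expTwist f a - polyProjOpp b S (expTwist f a),
        expTwist f c - polyProjOpp b S (expTwist f c)⁆ := by
    rw [polySigma_lie F (sub_polyProjOpp_mem _) (sub_polyProjOpp_mem _), ← h2, ← h2]
  have h4 := congrArg (polySigma F) (lie_components f a c)
  rw [map_sub, map_sub, map_add, polySigma_eq_zero_of_mem F (lie_polyProjOpp_mem _ _), zero_add,
    ← polyDer_field_expTwist, ← polyDer_field_expTwist, ← vecField_lie_polySigma,
    ← vecField_lie_polySigma, ← h3, eq_sub_iff_add_eq] at h4
  rw [piFormula_eq, piFormula_eq, piFormula_eq, ← h1, ← h4]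
  simp only [mul_add, add_mul]
  abel

theorem expTwist_add (a c : L) : expTwist f (a + c) = expTwist f a + expTwist f c := by
  rw [expTwist, TensorProduct.tmul_add, map_add]; rfl

theorem expTwist_smul (r : ℂ) (a : L) : expTwist f (r • a) = r • expTwist f a := by
  rw [expTwist, TensorProduct.tmul_smul, map_smul]; rfl

/-- The homomorphism `𝔤 → A ⊗ End F`. -/
def piLieHom : L →ₗ⁅ℂ⁆ WeylU b S ⊗[ℂ] End ℂ F where
  toFun := piFormula f F
  map_add' a c := by
    simp only [piFormula, expTwist_add, map_add, add_mul, TensorProduct.add_tmul,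
      Finset.sum_add_distrib]
    abel
  map_smul' r a := by
    simp only [piFormula, expTwist_smul, map_smul, smul_mul_assoc, ← TensorProduct.smul_tmul',
      ← Finset.smul_sum, smul_add, smul_neg, RingHom.id_apply]
  map_lie' {a c} := piFormula_lie f F a c

/-- The homomorphism `U(𝔤) → A ⊗ End F`. -/
def piHom : Env L →ₐ[ℂ] WeylU b S ⊗[ℂ] End ℂ F :=
  UniversalEnvelopingAlgebra.lift ℂ (piLieHom f F)

theorem piHom_ι (a : L) : piHom f F (envι a) = piFormula f F a :=
  UniversalEnvelopingAlgebra.lift_ι_apply ℂ (piLieHom f F) a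

end VectorFields

/-! ### Action on the vacuum: first-order terms at the origin. -/

section NilEval

variable {V : Type*} [AddCommGroup V] [Module ℂ V]

theorem nilEval_eq_add (q : PowerSeries ℂ) {T : End ℂ V} (hT : IsNilpotent T) :
    nilEval q T = PowerSeries.coeff 0 q • 1 +
      T * nilEval (PowerSeries.mk fun n => PowerSeries.coeff (n + 1) q) T := by
  obtain ⟨N, hN⟩ := hT
  have hN' : T ^ (N + 1) = 0 := by rw [pow_succ, hN, zero_mul]
  rw [nilEval_eq_sum q hN', nilEval_eq_sum _ hN, Finset.sum_range_succ', add_comm, pow_zero,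
    Finset.mul_sum]
  congr 1
  refine Finset.sum_congr rfl fun n _ => ?_
  rw [PowerSeries.coeff_mk, mul_smul_comm, pow_succ']

/-- With constant term 1, the difference `q(T) - 1` is divisible by `T`, so only the image of `N`
under `T` matters. -/
theorem nilEval_sub_mem (q : PowerSeries ℂ) (hq : PowerSeries.coeff 0 q = 1) {T : End ℂ V}
    (hT : IsNilpotent T) {N G : Submodule ℂ V} (hGN : G ≤ N) (hN : ∀ v ∈ N, T v ∈ G) {v : V}
    (hv : v ∈ N) : nilEval q T v - v ∈ G := by
  rw [nilEval_eq_add q hT, hq, one_smul, LinearMap.add_apply, Module.End.one_apply,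
    add_sub_cancel_left]
  exact hN _ (nilEval_mem _ (fun v hv => hGN (hN v hv)) hv)

end NilEval

namespace Weyl

variable {σ : Type*}

theorem fockRep_empty_ofPoly_one (p : MvPolynomial σ ℂ) :
    fockRep ∅ (ofPoly p) 1 = MvPolynomial.C (MvPolynomial.constantCoeff p) := by
  classical
  induction p using MvPolynomial.induction_on with
  | C a =>
    rw [← MvPolynomial.algebraMap_eq, AlgHom.commutes, AlgHom.commutes, MvPolynomial.algebraMap_eq,
      MvPolynomial.constantCoeff_C, Module.algebraMap_end_apply, MvPolynomial.smul_eq_C_mul, mul_one]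
  | add p q hp hq => simp only [map_add, LinearMap.add_apply, hp, hq]
  | mul_X p i hp =>
    rw [map_mul, map_mul, Module.End.mul_apply, ofPoly_X, fockRep_x, fockX,
      if_neg (Set.notMem_empty i)]
    simp

/-- Reordering `p ∂` as `∂ p - ∂(p)` lets the polynomials hit the vacuum first, where only constant
terms survive. The derivative term is the source of the shift by 2ρ_𝔲. -/
theorem fockRep_empty_ofPoly_mul_d_one (p : MvPolynomial σ ℂ) (i : σ) :
    fockRep ∅ (ofPoly p * d i) 1 =
      MvPolynomial.constantCoeff p • MvPolynomial.X i -
        MvPolynomial.C (MvPolynomial.constantCoeff (MvPolynomial.pderiv i p)) := by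
  rw [← sub_eq_of_eq_add (d_mul_ofPoly i p), map_sub, map_mul, LinearMap.sub_apply,
    Module.End.mul_apply, fockRep_empty_ofPoly_one, fockRep_empty_ofPoly_one, fockRep_d, fockD,
    if_neg (Set.notMem_empty i), LinearMap.mulLeft_apply, mul_comm, MvPolynomial.smul_eq_C_mul]

end Weyl

section LowOrder

attribute [local instance 100] LieRing.ofAssociativeRing

open LieAlgebra LieAlgebra.IsKilling LieModule

variable {L : Type*} [LieRing L] [LieAlgebra ℂ L] [FiniteDimensional ℂ L]
  [LieAlgebra.IsSemisimple ℂ L] {H : LieSubalgebra ℂ L} [H.IsCartanSubalgebra]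
  {b : (rootSystem H).Base} {S : Set b.support} (f : NegRootVectors b S)

/-- The value at the origin of a polynomial function with values in `𝔤`. -/
def evalZero (b : (rootSystem H).Base) (S : Set b.support) : PolyFun b S ⊗[ℂ] L →ₗ[ℂ] L :=
  TensorProduct.lid ℂ L ∘ₗ
    LinearMap.rTensor L (MvPolynomial.aeval (fun _ => (0 : ℂ)) : PolyFun b S →ₐ[ℂ] ℂ).toLinearMap

theorem evalZero_tmul (p : PolyFun b S) (y : L) :
    evalZero b S (p ⊗ₜ y) = MvPolynomial.constantCoeff p • y := by
  simp [evalZero, MvPolynomial.aeval_zero']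

theorem evalZero_lie (y z : PolyFun b S ⊗[ℂ] L) :
    evalZero b S ⁅y, z⁆ = ⁅evalZero b S y, evalZero b S z⁆ := by
  induction y using TensorProduct.induction_on with
  | zero => rw [PolyFun.zero_lie, map_zero, zero_lie]
  | add y y' hy hy' => rw [PolyFun.add_lie, map_add, map_add, add_lie, hy, hy']
  | tmul r a =>
    induction z using TensorProduct.induction_on with
    | zero => rw [PolyFun.lie_zero, map_zero, lie_zero]
    | add z z' hz hz' => rw [PolyFun.lie_add, map_add, map_add, lie_add, hz, hz']
    | tmul s c =>
      rw [evalZero_tmul, evalZero_tmul, smul_lie, lie_smul, smul_smul, ← map_mul]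
      exact evalZero_tmul _ _

theorem evalZero_adGeneric (z : PolyFun b S ⊗[ℂ] L) : evalZero b S (adGeneric f z) = 0 := by
  rw [adGeneric_apply, evalZero_lie, genericElt, map_sum, Finset.sum_eq_zero, zero_lie]
  intro γ _
  rw [evalZero_tmul, MvPolynomial.constantCoeff_X, zero_smul]

/-- The derivative of index `γ` at the origin of a polynomial function with values in `𝔤`. -/
def derivZero (γ : nilRoots b S) : PolyFun b S ⊗[ℂ] L →ₗ[ℂ] L :=
  evalZero b S ∘ₗ polyDer L (MvPolynomial.pderiv γ)

/-- The generic element vanishes at the origin and its derivative of index `γ` is `f γ`. -/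
theorem derivZero_adGeneric (γ : nilRoots b S) (z : PolyFun b S ⊗[ℂ] L) :
    derivZero γ (adGeneric f z) = ⁅f.vec γ, evalZero b S z⁆ := by
  classical
  rw [derivZero, LinearMap.comp_apply, adGeneric_apply, polyDer_lie, map_add, evalZero_lie,
    ← adGeneric_apply, evalZero_adGeneric, add_zero, polyDer_genericElt, map_sum,
    Finset.sum_eq_single γ]
  · rw [evalZero_tmul, MvPolynomial.pderiv_X_self, map_one, one_smul]
  · intro δ _ hδ
    rw [evalZero_tmul, MvPolynomial.pderiv_X_of_ne hδ, map_zero, zero_smul]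
  · simp

theorem evalZero_nilEval (q : PowerSeries ℂ) (z : PolyFun b S ⊗[ℂ] L) :
    evalZero b S (nilEval q (adGeneric f) z) = PowerSeries.coeff 0 q • evalZero b S z := by
  rw [nilEval_eq_add q (isNilpotent_adGeneric f), LinearMap.add_apply, map_add,
    Module.End.mul_apply, evalZero_adGeneric, add_zero, LinearMap.smul_apply, map_smul,
    Module.End.one_apply]

theorem derivZero_nilEval (q : PowerSeries ℂ) (γ : nilRoots b S) (z : PolyFun b S ⊗[ℂ] L) :
    derivZero γ (nilEval q (adGeneric f) z) = PowerSeries.coeff 0 q • derivZero γ z +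
      PowerSeries.coeff 1 q • ⁅f.vec γ, evalZero b S z⁆ := by
  rw [nilEval_eq_add q (isNilpotent_adGeneric f), LinearMap.add_apply, map_add,
    Module.End.mul_apply, derivZero_adGeneric, evalZero_nilEval, LinearMap.smul_apply, map_smul,
    Module.End.one_apply, lie_smul, PowerSeries.coeff_mk]

theorem expTwist_eq_nilEval (a : L) :
    expTwist f a = nilEval (PowerSeries.evalNegHom (PowerSeries.exp ℂ)) (adGeneric f) (1 ⊗ₜ a) := by
  rw [expTwist, nilEval_neg]

theorem coeff_evalNegHom_exp_zero :
    PowerSeries.coeff 0 (PowerSeries.evalNegHom (PowerSeries.exp ℂ)) = 1 := by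
  simp [PowerSeries.evalNegHom]

theorem coeff_todd_zero : PowerSeries.coeff 0 todd = 1 := by
  simp [todd, bernoulli'PowerSeries]

theorem evalZero_expTwist (a : L) : evalZero b S (expTwist f a) = a := by
  rw [expTwist_eq_nilEval, evalZero_nilEval, coeff_evalNegHom_exp_zero, evalZero_tmul, map_one,
    one_smul, one_smul]

theorem derivZero_expTwist (γ : nilRoots b S) (a : L) :
    derivZero γ (expTwist f a) = -⁅f.vec γ, a⁆ := by
  have h : PowerSeries.coeff 1 (PowerSeries.evalNegHom (PowerSeries.exp ℂ)) = -1 := by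
    simp [PowerSeries.evalNegHom, PowerSeries.coeff_exp]
  rw [expTwist_eq_nilEval, derivZero_nilEval, h, evalZero_tmul, map_one, one_smul, neg_one_smul,
    derivZero, LinearMap.comp_apply, polyDer_tmul, Derivation.map_one_eq_zero,
    TensorProduct.zero_tmul, map_zero, smul_zero, zero_add]

theorem evalZero_polyProjOpp (z : PolyFun b S ⊗[ℂ] L) :
    evalZero b S (polyProjOpp b S z) = projOpp b S (evalZero b S z) := by
  induction z using TensorProduct.induction_on with
  | zero => simp
  | add y z hy hz => simp only [map_add, hy, hz, Submodule.coe_add]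
  | tmul p y =>
    rw [evalZero_tmul, map_smul]
    exact evalZero_tmul _ _

theorem derivZero_polyProjOpp (γ : nilRoots b S) (z : PolyFun b S ⊗[ℂ] L) :
    derivZero γ (polyProjOpp b S z) = projOpp b S (derivZero γ z) := by
  rw [derivZero, LinearMap.comp_apply, polyProjOpp, polyDer_lTensor]
  exact evalZero_polyProjOpp _

theorem constantCoeff_polyCoord (γ : nilRoots b S) (z : PolyFun b S ⊗[ℂ] L) :
    MvPolynomial.constantCoeff (polyCoord f γ z) =
      f.basis.coord γ (projOpp b S (evalZero b S z)) := by
  induction z using TensorProduct.induction_on with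
  | zero => simp
  | add y z hy hz => simp only [map_add, hy, hz]
  | tmul p y =>
    rw [polyCoord_tmul, evalZero_tmul, MvPolynomial.smul_eq_C_mul, map_mul,
      MvPolynomial.constantCoeff_C, map_smul, map_smul, smul_eq_mul, mul_comm]

theorem pderiv_polyCoord (γ δ : nilRoots b S) (z : PolyFun b S ⊗[ℂ] L) :
    MvPolynomial.pderiv δ (polyCoord f γ z) =
      polyCoord f γ (polyDer L (MvPolynomial.pderiv δ) z) := by
  induction z using TensorProduct.induction_on with
  | zero => simp
  | add y z hy hz => simp only [map_add, hy, hz]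
  | tmul p y => rw [polyCoord_tmul, polyDer_tmul, polyCoord_tmul, Derivation.map_smul]

theorem projOpp_projOpp (y : L) : projOpp b S (projOpp b S y) = projOpp b S y :=
  Submodule.projectionOnto_apply_left _ _

theorem projOpp_eq_zero {a : L} (ha : a ∈ parabolic b S) : projOpp b S a = 0 :=
  Submodule.projectionOnto_apply_right _ ⟨a, ha⟩

theorem constantCoeff_coeffD (a : L) (γ : nilRoots b S) :
    MvPolynomial.constantCoeff (coeffD f a γ) = f.basis.coord γ (projOpp b S a) := by
  rw [coeffD, constantCoeff_polyCoord, evalZero_nilEval, coeff_todd_zero, one_smul,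
    evalZero_polyProjOpp, evalZero_expTwist, projOpp_projOpp]

/-- For `a` in 𝔭 the opposite component of the twist vanishes at the origin, so the linear term of
the Todd series does not contribute and only the first derivative of the twist counts. -/
theorem constantCoeff_pderiv_coeffD {a : L} (ha : a ∈ parabolic b S) (γ : nilRoots b S) :
    MvPolynomial.constantCoeff (MvPolynomial.pderiv γ (coeffD f a γ)) =
      -f.basis.coord γ (projOpp b S ⁅f.vec γ, a⁆) := by
  rw [coeffD, pderiv_polyCoord, constantCoeff_polyCoord]
  change f.basis.coord γ (projOpp b S (derivZero γ _)) = _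
  rw [derivZero_nilEval, evalZero_polyProjOpp, evalZero_expTwist, projOpp_eq_zero ha,
    Submodule.coe_zero, lie_zero, smul_zero, add_zero, coeff_todd_zero, one_smul,
    derivZero_polyProjOpp, derivZero_expTwist, projOpp_projOpp, map_neg, map_neg]

/-- The trace of the adjoint action on `𝔤 / 𝔭`, up to sign. -/
def nilTrace (a : L) : ℂ := ∑ γ, f.basis.coord γ (projOpp b S ⁅f.vec γ, a⁆)

theorem fockRep_vecField_one {a : L} (ha : a ∈ parabolic b S) :
    Weyl.fockRep ∅ (Weyl.vecField (field f a)) 1 = MvPolynomial.C (-nilTrace f a) := by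
  rw [Weyl.vecField, map_sum, LinearMap.sum_apply, nilTrace, ← Finset.sum_neg_distrib, map_sum]
  refine Finset.sum_congr rfl fun γ _ => ?_
  rw [field_X, Weyl.fockRep_empty_ofPoly_mul_d_one, map_neg, map_neg, map_neg,
    constantCoeff_coeffD, projOpp_eq_zero ha, map_zero, neg_zero, zero_smul, zero_sub,
    constantCoeff_pderiv_coeffD f ha, neg_neg, map_neg]

variable (F : Type*) [AddCommGroup F] [Module ℂ F] [LieRingModule (parabolic b S) F]
  [LieModule ℂ (parabolic b S) F]

theorem tensorRep_polySigma_one (z : PolyFun b S ⊗[ℂ] L) (w : F) :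
    tensorRep (Weyl.fockRep ∅) F (polySigma F z) (1 ⊗ₜ w) =
      1 ⊗ₜ[ℂ] ⁅projPar b S (evalZero b S z), w⁆ := by
  induction z using TensorProduct.induction_on with
  | zero => simp
  | add y z hy hz =>
    simp only [map_add, LinearMap.add_apply, hy, hz, add_lie, TensorProduct.tmul_add]
  | tmul p y =>
    rw [polySigma_tmul, tensorRep_tmul, Weyl.fockRep_empty_ofPoly_one, evalZero_tmul, map_smul,
      smul_lie, ← TensorProduct.smul_tmul, MvPolynomial.smul_eq_C_mul, mul_one]
    rfl

/-- At the origin the twist of `a` is `a` itself, giving the action on `F`; the vector field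
contributes the scalar `-nilTrace`. -/
theorem tensorRep_piFormula_one (a : parabolic b S) (w : F) :
    tensorRep (Weyl.fockRep ∅) F (piFormula f F a) (1 ⊗ₜ w) =
      1 ⊗ₜ[ℂ] (⁅a, w⁆ - nilTrace f a • w) := by
  have hp : projPar b S (a : L) = a := Submodule.projectionOnto_apply_left _ a
  rw [piFormula_eq, map_add, LinearMap.add_apply, tensorRep_tmul, fockRep_vecField_one f a.2,
    tensorRep_polySigma_one, evalZero_expTwist, hp, Module.End.one_apply,
    ← mul_one (MvPolynomial.C _), ← MvPolynomial.smul_eq_C_mul, TensorProduct.smul_tmul,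
    ← TensorProduct.tmul_add, neg_smul, neg_add_eq_sub]

theorem cartan_mem_parabolic (h : H) : (h : L) ∈ parabolic b S := by
  change (h : L) ∈ (parabolicSpace b S : LieSubmodule ℂ H L)
  have h1 : H.toLieSubmodule ≤ parabolicSpace b S := le_sup_of_le_left le_sup_left
  exact h1 h.2

theorem lie_vec (h : H) (γ : nilRoots b S) :
    ⁅(h : L), f.vec γ⁆ = -((γ : H.root) : Weight ℂ H L) h • f.vec γ :=
  lie_eq_smul_of_mem_rootSpace (f.mem γ) h

theorem projOpp_vec (γ : nilRoots b S) : projOpp b S (f.vec γ) = f.basis γ := by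
  rw [← f.basis_apply]
  exact Submodule.projectionOnto_apply_left _ _

theorem coord_projOpp_lie (h : H) (γ : nilRoots b S) (y : L) :
    f.basis.coord γ (projOpp b S ⁅(h : L), y⁆) =
      -((γ : H.root) : Weight ℂ H L) h * f.basis.coord γ (projOpp b S y) := by
  obtain ⟨u, hu, p, hp, rfl⟩ := Submodule.mem_sup.1
    ((isCompl_oppNilradical_parabolic b S).sup_eq_top ▸ Submodule.mem_top (x := y))
  rw [lie_add, map_add, map_add (projOpp b S) u p, projOpp_eq_zero hp,
    projOpp_eq_zero ((parabolic b S).lie_mem (cartan_mem_parabolic h) hp), add_zero, add_zero]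
  clear hp p
  rw [← f.span_eq] at hu
  induction hu using Submodule.span_induction with
  | mem u hu =>
    obtain ⟨δ, rfl⟩ := hu
    rw [lie_vec, map_smul, projOpp_vec, map_smul, smul_eq_mul, Basis.coord_apply, Basis.repr_self]
    by_cases hδ : δ = γ
    · rw [hδ]
    · rw [Finsupp.single_eq_of_ne' hδ, mul_zero, mul_zero]
  | zero => simp
  | add u v _ _ hu hv => simp only [lie_add, map_add, hu, hv, mul_add]
  | smul c u _ hu => rw [lie_smul, map_smul, map_smul, map_smul, map_smul, hu, smul_eq_mul,
      smul_eq_mul, mul_left_comm]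

/-- For `a` of nonzero weight χ, the bracket with `f γ` has weight χ - γ, different from -γ, so its
coordinate along `f γ` is zero. -/
theorem nilTrace_root {χ : H → ℂ} (hχ : χ ≠ 0) {a : L} (ha : a ∈ rootSpace H χ) :
    nilTrace f a = 0 := by
  obtain ⟨h, hh⟩ := Function.ne_iff.1 hχ
  refine Finset.sum_eq_zero fun γ _ => ?_
  have h1 : ⁅(h : L), ⁅f.vec γ, a⁆⁆ =
      (-((γ : H.root) : Weight ℂ H L) h + χ h) • ⁅f.vec γ, a⁆ := by
    have h2 : ⁅(h : L), a⁆ = χ h • a := lie_eq_smul_of_mem_rootSpace ha h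
    rw [leibniz_lie, lie_vec, h2, smul_lie, lie_smul, add_smul]
  have h3 := coord_projOpp_lie f h γ ⁅f.vec γ, a⁆
  rw [h1, map_smul, map_smul, smul_eq_mul, add_mul, add_eq_left] at h3
  exact (mul_eq_zero.1 h3).resolve_left hh

theorem nilTrace_cartan (h : H) :
    nilTrace f h = ((2 : ℂ) • rhoU b S) h := by
  have h1 : (2 : ℂ) • rhoU b S = ∑ γ : nilRoots b S, (rootSystem H).root γ := by
    rw [rhoU, smul_smul]; norm_num
  rw [h1, LinearMap.sum_apply, nilTrace]
  refine Finset.sum_congr rfl fun γ _ => ?_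
  rw [← lie_skew, lie_vec, ← neg_smul, neg_neg, map_smul, map_smul, projOpp_vec]
  simp

/-! ### Leading terms of the vector fields of root vectors. -/

/-- The level of a root of the nilradical, as a natural number. -/
def natLevel (γ : nilRoots b S) : ℕ := (level_pos b S γ.2.1).choose

theorem level_eq_natLevel (γ : nilRoots b S) : level b S ((rootSystem H).root γ) = natLevel γ :=
  (level_pos b S γ.2.1).choose_spec.1

theorem natLevel_pos (γ : nilRoots b S) : 0 < natLevel γ :=
  Nat.pos_of_ne_zero fun h => γ.2.2 ((level_pos b S γ.2.1).choose_spec.2 h)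

/-- A linear form on the dual of the Cartan subalgebra is evaluation at an element; this one is a
grading element, whose eigenvalues read off levels. -/
theorem exists_levelElt (b : (rootSystem H).Base) (S : Set b.support) :
    ∃ h : H, ∀ φ : Dual ℂ H, φ h = level b S φ :=
  ⟨(Module.evalEquiv ℂ H).symm (level b S), fun φ => Module.apply_evalEquiv_symm_apply ℂ H φ (level b S)⟩

theorem mem_span_vec {y : L} (hy : y ∈ oppNilradical b S) {P : nilRoots b S → Prop}
    (h : ∀ γ, f.basis.coord γ (projOpp b S y) ≠ 0 → P γ) :
    y ∈ Submodule.span ℂ (f.vec '' {γ | P γ}) := by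
  have h1 : ∑ γ, f.basis.coord γ (projOpp b S y) • f.vec γ = y := by
    have h2 : (projOpp b S y : L) = y := congrArg Subtype.val
      (Submodule.projectionOnto_apply_left (isCompl_oppNilradical_parabolic b S) ⟨y, hy⟩)
    have := congrArg Subtype.val (f.basis.sum_repr (projOpp b S y))
    rw [AddSubmonoidClass.coe_finsetSum, h2] at this
    conv_rhs => rw [← this]
    refine Finset.sum_congr rfl fun γ _ => ?_
    rw [← f.basis_apply]
    rfl
  rw [← h1]
  refine Submodule.sum_mem _ fun γ _ => ?_
  by_cases hγ : f.basis.coord γ (projOpp b S y) = 0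
  · rw [hγ, zero_smul]; exact zero_mem _
  · exact Submodule.smul_mem _ _ (Submodule.subset_span ⟨γ, h γ hγ, rfl⟩)

/-- Only root vectors with the same eigenvalue under the grading element as the bracket can occur in
its expansion. -/
theorem lie_vec_mem_span (γ δ : nilRoots b S) : ⁅f.vec γ, f.vec δ⁆ ∈
    Submodule.span ℂ (f.vec '' {ε | natLevel ε = natLevel γ + natLevel δ}) := by
  refine mem_span_vec f (oppNilradical_lie b S (f.vec_mem γ) (f.vec_mem δ)) fun ε hε => ?_
  obtain ⟨h, hh⟩ := exists_levelElt b S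
  have h0 (γ : nilRoots b S) : ((γ : H.root) : Weight ℂ H L) h = (natLevel γ : ℂ) := by
    rw [← level_eq_natLevel, ← hh]
    rfl
  have h1 := coord_projOpp_lie f h ε ⁅f.vec γ, f.vec δ⁆
  rw [leibniz_lie, lie_vec, lie_vec, smul_lie, lie_smul, ← add_smul, map_smul, map_smul, smul_eq_mul]
    at h1
  have h2 := mul_right_cancel₀ hε h1
  rw [h0, h0, h0] at h2
  have h3 : ((natLevel γ + natLevel δ : ℕ) : ℂ) = natLevel ε := by
    push_cast
    linear_combination -h2
  exact_mod_cast h3.symm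

/-- The span of the products of a monomial and a root vector whose weights with respect to `w`
differ by at least `j`. -/
def weightSub (w : nilRoots b S → ℤ) (j : ℤ) : Submodule ℂ (PolyFun b S ⊗[ℂ] L) :=
  Submodule.span ℂ {z | ∃ (m : nilRoots b S →₀ ℕ) (γ : nilRoots b S),
    w γ + j ≤ Finsupp.weight w m ∧ z = MvPolynomial.monomial m 1 ⊗ₜ[ℂ] f.vec γ}

theorem tmul_mem_weightSub {w : nilRoots b S → ℤ} {j k : ℤ} {m : nilRoots b S →₀ ℕ} {y : L}
    (hy : y ∈ Submodule.span ℂ (f.vec '' {ε | w ε ≤ k})) (hm : k + j ≤ Finsupp.weight w m) :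
    MvPolynomial.monomial m (1 : ℂ) ⊗ₜ[ℂ] y ∈ weightSub f w j := by
  induction hy using Submodule.span_induction with
  | mem y hy =>
    obtain ⟨ε, hε, rfl⟩ := hy
    exact Submodule.subset_span ⟨m, ε, le_trans (by simpa using hε) hm, rfl⟩
  | zero => rw [TensorProduct.tmul_zero]; exact zero_mem _
  | add y z _ _ hy hz => rw [TensorProduct.tmul_add]; exact add_mem hy hz
  | smul c y _ hy => rw [TensorProduct.tmul_smul]; exact Submodule.smul_mem _ _ hy

/-- The factor `x γ` that comes with each `f γ` raises the weight of the monomial by `w γ`, enough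
to pay for the largest possible weight of the new root vector. -/
theorem adGeneric_mem_weightSub {w : nilRoots b S → ℤ} {j : ℤ}
    (hw : ∀ γ δ, ⁅f.vec γ, f.vec δ⁆ ∈ Submodule.span ℂ (f.vec '' {ε | w ε ≤ w γ + w δ}))
    {z : PolyFun b S ⊗[ℂ] L} (hz : z ∈ weightSub f w j) : adGeneric f z ∈ weightSub f w j := by
  induction hz using Submodule.span_induction with
  | mem z hz =>
    obtain ⟨m, δ, h, rfl⟩ := hz
    rw [adGeneric_tmul]
    refine Submodule.sum_mem _ fun γ _ => ?_
    rw [MvPolynomial.X, MvPolynomial.monomial_mul, one_mul]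
    refine tmul_mem_weightSub f (hw γ δ) ?_
    rw [map_add, Finsupp.weight_single, one_smul]
    omega
  | zero => rw [map_zero]; exact zero_mem _
  | add y z _ _ hy hz => rw [map_add]; exact add_mem hy hz
  | smul c y _ hy => rw [map_smul]; exact Submodule.smul_mem _ _ hy

theorem polyCoord_mem_polyHigh {w : nilRoots b S → ℤ} {j : ℤ} {z : PolyFun b S ⊗[ℂ] L}
    (hz : z ∈ weightSub f w j) (γ : nilRoots b S) :
    polyCoord f γ z ∈ Weyl.polyHigh w (w γ + j) := by
  induction hz using Submodule.span_induction with
  | mem z hz =>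
    obtain ⟨m, δ, h, rfl⟩ := hz
    rw [polyCoord_tmul, projOpp_vec, Basis.coord_apply, Basis.repr_self]
    by_cases hδ : δ = γ
    · rw [← hδ, Finsupp.single_eq_same, one_smul]
      exact Submodule.subset_span ⟨m, h, rfl⟩
    · rw [Finsupp.single_eq_of_ne' hδ, zero_smul]
      exact zero_mem _
  | zero => rw [map_zero]; exact zero_mem _
  | add y z _ _ hy hz => rw [map_add]; exact add_mem hy hz
  | smul c y _ hy => rw [map_smul]; exact Submodule.smul_mem _ _ hy

theorem expTwist_vec_mem (α : nilRoots b S) :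
    expTwist f (f.vec α) ∈ polySub (PolyFun b S) (oppNilradical b S).toSubmodule := by
  rw [expTwist_eq_nilEval]
  exact nilEval_adGeneric_mem f _ (tmul_mem_polySub _ (f.vec_mem α))

/-- Both power series have constant term 1, and `ad u(x)` sends `1 ⊗ f α` into the subspace of terms
with excess `j`, which it preserves. -/
theorem nilEval_todd_expTwist_vec_sub_mem {w : nilRoots b S → ℤ} {j : ℤ} (α : nilRoots b S)
    (hw : ∀ γ δ, ⁅f.vec γ, f.vec δ⁆ ∈ Submodule.span ℂ (f.vec '' {ε | w ε ≤ w γ + w δ}))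
    (hα : ∀ γ, ⁅f.vec γ, f.vec α⁆ ∈ Submodule.span ℂ (f.vec '' {ε | w ε ≤ w γ - j})) :
    nilEval todd (adGeneric f) (polyProjOpp b S (expTwist f (f.vec α))) - 1 ⊗ₜ f.vec α ∈
      weightSub f w j := by
  let N : Submodule ℂ (PolyFun b S ⊗[ℂ] L) :=
    Submodule.span ℂ {1 ⊗ₜ f.vec α} ⊔ weightSub f w j
  have hGN : weightSub f w j ≤ N := le_sup_right
  have h1 : (1 : PolyFun b S) ⊗ₜ f.vec α ∈ N :=
    Submodule.mem_sup_left (Submodule.mem_span_singleton_self _)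
  have hN : ∀ v ∈ N, adGeneric f v ∈ weightSub f w j := by
    suffices N ≤ (weightSub f w j).comap (adGeneric f) from this
    refine sup_le ?_ fun z hz => adGeneric_mem_weightSub f hw hz
    rw [Submodule.span_singleton_le_iff_mem, Submodule.mem_comap, adGeneric_tmul]
    refine Submodule.sum_mem _ fun γ _ => ?_
    rw [mul_one, MvPolynomial.X]
    refine tmul_mem_weightSub f (hα γ) ?_
    rw [Finsupp.weight_single, one_smul]
    omega
  have h2 : expTwist f (f.vec α) - 1 ⊗ₜ f.vec α ∈ weightSub f w j := by
    rw [expTwist_eq_nilEval]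
    exact nilEval_sub_mem _ coeff_evalNegHom_exp_zero (isNilpotent_adGeneric f) hGN hN h1
  have h3 : expTwist f (f.vec α) ∈ N := by
    rw [← sub_add_cancel (expTwist f (f.vec α)) (1 ⊗ₜ f.vec α)]
    exact add_mem (hGN h2) h1
  rw [polyProjOpp_apply_of_mem (expTwist_vec_mem f α), ← sub_add_sub_cancel]
  exact add_mem (nilEval_sub_mem _ coeff_todd_zero (isNilpotent_adGeneric f) hGN hN h3) h2

/-- The weight `w` is left open for two uses: constant weight with `j = 0` for words in the induced
module, and a level-dependent weight with `j = 1` for localization at one root vector. -/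
theorem exists_vecField_vec_eq {w : nilRoots b S → ℤ} {j : ℤ} (α : nilRoots b S)
    (hw : ∀ γ δ, ⁅f.vec γ, f.vec δ⁆ ∈ Submodule.span ℂ (f.vec '' {ε | w ε ≤ w γ + w δ}))
    (hα : ∀ γ, ⁅f.vec γ, f.vec α⁆ ∈ Submodule.span ℂ (f.vec '' {ε | w ε ≤ w γ - j})) :
    ∃ p : nilRoots b S → PolyFun b S, (∀ γ, p γ ∈ Weyl.polyHigh w (w γ + j)) ∧
      Weyl.vecField (field f (f.vec α)) = -Weyl.d α + ∑ γ, Weyl.ofPoly (p γ) * Weyl.d γ := by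
  classical
  refine ⟨fun γ => -polyCoord f γ (nilEval todd (adGeneric f)
    (polyProjOpp b S (expTwist f (f.vec α))) - 1 ⊗ₜ f.vec α), fun γ => neg_mem
      (polyCoord_mem_polyHigh f (nilEval_todd_expTwist_vec_sub_mem f α hw hα) γ), ?_⟩
  have h (γ : nilRoots b S) : polyCoord f γ (1 ⊗ₜ f.vec α) = if γ = α then 1 else 0 := by
    rw [polyCoord_tmul, projOpp_vec, Basis.coord_apply, Basis.repr_self]
    by_cases hγ : γ = α
    · rw [hγ, Finsupp.single_eq_same, one_smul, if_pos rfl]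
    · rw [Finsupp.single_eq_of_ne hγ, zero_smul, if_neg hγ]
  simp only [Weyl.vecField, field_X, coeffD, map_sub, h, map_neg, neg_sub, sub_mul,
    Finset.sum_sub_distrib, neg_mul, Finset.sum_neg_distrib]
  simp only [apply_ite Weyl.ofPoly, map_one, map_zero, ite_mul, one_mul, zero_mul,
    Finset.sum_ite_eq', Finset.mem_univ, if_true]
  abel

theorem piFormula_vec (α : nilRoots b S) :
    piFormula f F (f.vec α) = Weyl.vecField (field f (f.vec α)) ⊗ₜ 1 := by
  rw [piFormula_eq, polySigma_eq_zero_of_mem F (expTwist_vec_mem f α), add_zero]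

theorem exists_vecField_vec_eq_of_degree (α : nilRoots b S) :
    ∃ p : nilRoots b S → PolyFun b S, (∀ γ, p γ ∈ Weyl.polyHigh (fun _ => 1) (1 + 0)) ∧
      Weyl.vecField (field f (f.vec α)) = -Weyl.d α + ∑ γ, Weyl.ofPoly (p γ) * Weyl.d γ :=
  exists_vecField_vec_eq f (w := fun _ => 1) α
    (fun γ δ => mem_span_vec f (oppNilradical_lie b S (f.vec_mem γ) (f.vec_mem δ)) (by simp))
    (fun γ => mem_span_vec f (oppNilradical_lie b S (f.vec_mem γ) (f.vec_mem α)) (by simp))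

/-- Bracketing with `f α` raises the level of the root, so a weight that decreases with the level
makes every correction to `-∂ α` strictly lowering. -/
theorem exists_vecField_vec_eq_of_level (α : nilRoots b S) :
    ∃ w : nilRoots b S → ℤ, (∀ γ, 0 ≤ w γ) ∧ w α = 0 ∧
      ∃ p : nilRoots b S → PolyFun b S, (∀ γ, p γ ∈ Weyl.polyHigh w (w γ + 1)) ∧
        Weyl.vecField (field f (f.vec α)) = -Weyl.d α + ∑ γ, Weyl.ofPoly (p γ) * Weyl.d γ := by
  classical
  let K : ℕ := ∑ γ : nilRoots b S, natLevel γ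
  have hK (γ : nilRoots b S) : natLevel γ ≤ K :=
    Finset.single_le_sum (f := natLevel) (fun _ _ => Nat.zero_le _) (Finset.mem_univ γ)
  -- `K` bounds all levels, so `w` is nonnegative. The value zero at `α` lets `x α` act by
  -- multiplication in the filtered modules; it is harmless because `f α` commutes with itself.
  let w (γ : nilRoots b S) : ℤ := if γ = α then 0 else K - natLevel γ
  have hwα : w α = 0 := if_pos rfl
  have hwne (γ) (h : γ ≠ α) : w γ = K - natLevel γ := if_neg h
  have hw0 (γ) : 0 ≤ w γ := by
    have := hK γ
    by_cases h : γ = α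
    · rw [h, hwα]
    · rw [hwne γ h]; omega
  have hwle (γ) : w γ ≤ K - natLevel γ := by
    have := hK γ
    by_cases h : γ = α
    · rw [h, hwα]
      rw [h] at this
      omega
    · rw [hwne γ h]
  have key (γ : nilRoots b S) :
      ⁅f.vec γ, f.vec α⁆ ∈ Submodule.span ℂ (f.vec '' {ε | w ε ≤ w γ - 1}) := by
    by_cases h : γ = α
    · rw [h, lie_self]; exact zero_mem _
    refine Submodule.span_mono (Set.image_mono fun ε hε => ?_) (lie_vec_mem_span f γ α)
    have h1 : natLevel ε = natLevel γ + natLevel α := hε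
    have h2 := natLevel_pos α
    have h3 := hwle ε
    change w ε ≤ w γ - 1
    rw [hwne γ h]
    omega
  refine ⟨w, hw0, hwα, exists_vecField_vec_eq f α (fun γ δ => ?_) key⟩
  by_cases h : δ = α
  · rw [h, hwα]
    refine Submodule.span_mono (Set.image_mono fun ε hε => ?_) (key γ)
    have h1 : w ε ≤ w γ - 1 := hε
    change w ε ≤ w γ + 0
    omega
  · refine Submodule.span_mono (Set.image_mono fun ε hε => ?_) (lie_vec_mem_span f γ δ)
    have h1 : natLevel ε = natLevel γ + natLevel δ := hε
    have h3 := hwle ε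
    have h4 := hw0 γ
    change w ε ≤ w γ + w δ
    rw [hwne δ h]
    omega

end LowOrder

/-! ### Uniqueness of irreducible highest weight modules. -/

section HighestWeight

variable {Q V : Type*} [LieRing Q] [LieAlgebra ℂ Q] [AddCommGroup V] [Module ℂ V]
  {ρ : Q →ₗ[ℂ] End ℂ V} {B N : Set Q}

/-- The smallest subspace that contains `v` and is stable under the operators of `N`. -/
def generatedSub (ρ : Q →ₗ[ℂ] End ℂ V) (N : Set Q) (v : V) : Submodule ℂ V :=
  sInf {M | v ∈ M ∧ ∀ n ∈ N, ∀ m ∈ M, ρ n m ∈ M}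

theorem mem_generatedSub_self (v : V) : v ∈ generatedSub ρ N v :=
  Submodule.mem_sInf.2 fun _ h => h.1

theorem generatedSub_stable {v : V} {n : Q} (hn : n ∈ N) {m : V} (hm : m ∈ generatedSub ρ N v) :
    ρ n m ∈ generatedSub ρ N v :=
  Submodule.mem_sInf.2 fun M h => h.2 n hn m (Submodule.mem_sInf.1 hm M h)

theorem generatedSub_le {v : V} {M : Submodule ℂ V} (hv : v ∈ M)
    (hM : ∀ n ∈ N, ∀ m ∈ M, ρ n m ∈ M) : generatedSub ρ N v ≤ M :=
  sInf_le ⟨hv, hM⟩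

/-- Since x n m = [x, n] m + n x m, stability under all of `Q` propagates along the lowering
operators; at `v` itself it follows from the eigenvector condition. -/
theorem apply_mem_generatedSub (hρ : ∀ x y, ρ ⁅x, y⁆ = ρ x * ρ y - ρ y * ρ x)
    (hBN : Submodule.span ℂ (B ∪ N) = ⊤) {v : V} (hv : ∀ x ∈ B, ∃ c : ℂ, ρ x v = c • v) (x : Q)
    {m : V} (hm : m ∈ generatedSub ρ N v) : ρ x m ∈ generatedSub ρ N v := by
  -- The stability is required for all `x` at once, because the commutator `[x, n]` is a new,
  -- arbitrary element.
  let P : Submodule ℂ V :=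
    { carrier := {m | m ∈ generatedSub ρ N v ∧ ∀ x, ρ x m ∈ generatedSub ρ N v}
      zero_mem' := ⟨zero_mem _, fun x => by rw [map_zero]; exact zero_mem _⟩
      add_mem' := fun h h' => ⟨add_mem h.1 h'.1, fun x => by
        rw [map_add]; exact add_mem (h.2 x) (h'.2 x)⟩
      smul_mem' := fun c _ h => ⟨Submodule.smul_mem _ _ h.1, fun x => by
        rw [map_smul]; exact Submodule.smul_mem _ _ (h.2 x)⟩ }
  suffices generatedSub ρ N v ≤ P from (this hm).2 x
  refine generatedSub_le ⟨mem_generatedSub_self v, fun x => ?_⟩ fun n hn m hm =>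
    ⟨generatedSub_stable hn hm.1, fun x => ?_⟩
  · have hx : x ∈ Submodule.span ℂ (B ∪ N) := hBN ▸ Submodule.mem_top
    induction hx using Submodule.span_induction with
    | mem x hx =>
      rcases hx with hx | hx
      · obtain ⟨c, hc⟩ := hv x hx
        rw [hc]
        exact Submodule.smul_mem _ _ (mem_generatedSub_self v)
      · exact generatedSub_stable hx (mem_generatedSub_self v)
    | zero => rw [map_zero]; exact zero_mem _
    | add x y _ _ hx hy => rw [map_add]; exact add_mem hx hy
    | smul c x _ hx => rw [map_smul]; exact Submodule.smul_mem _ _ hx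
  · have h : ρ x (ρ n m) = ρ ⁅x, n⁆ m + ρ n (ρ x m) := by
      rw [hρ, LinearMap.sub_apply, Module.End.mul_apply, Module.End.mul_apply, sub_add_cancel]
    rw [h]
    exact add_mem (hm.2 _) (generatedSub_stable hn (hm.2 x))

/-- Every operator in `N` lowers the eigenvalue of `h` by a positive integer, so only multiples of
`v` keep the eigenvalue `c`. -/
theorem generatedSub_le_sup (hρ : ∀ x y, ρ ⁅x, y⁆ = ρ x * ρ y - ρ y * ρ x) {h : Q}
    (hN : ∀ n ∈ N, ∃ j : ℕ, 0 < j ∧ ⁅h, n⁆ = -(j : ℂ) • n) {v : V} {c : ℂ} (hv : ρ h v = c • v) :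
    generatedSub ρ N v ≤ Submodule.span ℂ {v} ⊔ ⨆ a, ⨆ _ : a ≠ c, (ρ h).eigenspace a := by
  let K : Submodule ℂ V := ⨆ j : ℕ, (ρ h).eigenspace (c - (j + 1))
  have hshift {n : Q} {j : ℕ} {a : ℂ} {m : V} (hn : ⁅h, n⁆ = -(j : ℂ) • n) (hm : ρ h m = a • m) :
      ρ h (ρ n m) = (a - j) • ρ n m := by
    have h1 : ρ h (ρ n m) = ρ ⁅h, n⁆ m + ρ n (ρ h m) := by
      rw [hρ, LinearMap.sub_apply, Module.End.mul_apply, Module.End.mul_apply, sub_add_cancel]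
    rw [h1, hn, hm, map_smul, map_smul, LinearMap.smul_apply, ← add_smul]
    congr 1
    ring
  have hK : K ≤ ⨆ a, ⨆ _ : a ≠ c, (ρ h).eigenspace a := by
    refine iSup_le fun j => le_iSup₂_of_le (c - (j + 1)) ?_ le_rfl
    intro h1
    have h2 : ((j + 1 : ℕ) : ℂ) = 0 := by push_cast; linear_combination -h1
    exact Nat.succ_ne_zero j (by exact_mod_cast h2)
  have hmem (j : ℕ) (hj : 0 < j) {m : V} (hm : ρ h m = (c - j) • m) : m ∈ K := by
    obtain ⟨i, rfl⟩ : ∃ i, j = i + 1 := ⟨j - 1, by omega⟩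
    refine Submodule.mem_iSup_of_mem i (Module.End.mem_eigenspace_iff.2 ?_)
    rw [hm]
    push_cast
    rfl
  refine le_trans (generatedSub_le (M := Submodule.span ℂ {v} ⊔ K)
    (Submodule.mem_sup_left (Submodule.mem_span_singleton_self v)) fun n hn => ?_)
    (sup_le_sup_left hK _)
  obtain ⟨j, hj, hnj⟩ := hN n hn
  suffices Submodule.span ℂ {v} ⊔ K ≤ (Submodule.span ℂ {v} ⊔ K).comap (ρ n) from this
  refine sup_le ?_ (iSup_le fun i m hm => ?_)
  · rw [Submodule.span_singleton_le_iff_mem]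
    exact Submodule.mem_sup_right (hmem j hj (hshift hnj hv))
  · refine Submodule.mem_sup_right (hmem (j + (i + 1)) (by omega) ?_)
    rw [hshift hnj (Module.End.mem_eigenspace_iff.1 hm)]
    congr 1
    push_cast
    ring

/-- The submodule generated by `(v₁, v₂)` in the direct sum is the graph of an isomorphism: both
projections restricted to it are bijective. -/
theorem exists_equiv_of_highest_weight {V₁ V₂ : Type*} [AddCommGroup V₁] [Module ℂ V₁]
    [AddCommGroup V₂] [Module ℂ V₂] {ρ₁ : Q →ₗ[ℂ] End ℂ V₁} {ρ₂ : Q →ₗ[ℂ] End ℂ V₂}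
    (hρ₁ : ∀ x y, ρ₁ ⁅x, y⁆ = ρ₁ x * ρ₁ y - ρ₁ y * ρ₁ x)
    (hρ₂ : ∀ x y, ρ₂ ⁅x, y⁆ = ρ₂ x * ρ₂ y - ρ₂ y * ρ₂ x)
    (hV₁ : ∀ M : Submodule ℂ V₁, (∀ x, ∀ m ∈ M, ρ₁ x m ∈ M) → M = ⊥ ∨ M = ⊤)
    (hV₂ : ∀ M : Submodule ℂ V₂, (∀ x, ∀ m ∈ M, ρ₂ x m ∈ M) → M = ⊥ ∨ M = ⊤)
    (hBN : Submodule.span ℂ (B ∪ N) = ⊤) {h : Q} (hB : h ∈ B)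
    (hN : ∀ n ∈ N, ∃ j : ℕ, 0 < j ∧ ⁅h, n⁆ = -(j : ℂ) • n) {v₁ : V₁} {v₂ : V₂} (hv₁ : v₁ ≠ 0)
    (hv₂ : v₂ ≠ 0) (hv : ∀ x ∈ B, ∃ c : ℂ, ρ₁ x v₁ = c • v₁ ∧ ρ₂ x v₂ = c • v₂) :
    ∃ ψ : V₁ ≃ₗ[ℂ] V₂, ∀ x m, ψ (ρ₁ x m) = ρ₂ x (ψ m) := by
  let ρ : Q →ₗ[ℂ] End ℂ (V₁ × V₂) :=
    { toFun x := (ρ₁ x).prodMap (ρ₂ x)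
      map_add' x y := by rw [map_add, map_add]; rfl
      map_smul' c x := by rw [map_smul, map_smul]; rfl }
  have hρa (x : Q) (m : V₁ × V₂) : ρ x m = (ρ₁ x m.1, ρ₂ x m.2) := rfl
  have hρ (x y : Q) : ρ ⁅x, y⁆ = ρ x * ρ y - ρ y * ρ x := by
    refine LinearMap.ext fun m => ?_
    rw [hρa, hρ₁, hρ₂]
    rfl
  have hv' : ∀ x ∈ B, ∃ c : ℂ, ρ x (v₁, v₂) = c • (v₁, v₂) := fun x hx => by
    obtain ⟨c, h1, h2⟩ := hv x hx
    exact ⟨c, by rw [hρa, h1, h2]; rfl⟩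
  let M := generatedSub ρ N (v₁, v₂)
  have hM (x : Q) {m} (hm : m ∈ M) : ρ x m ∈ M := apply_mem_generatedSub hρ hBN hv' x hm
  have hvM : (v₁, v₂) ∈ M := mem_generatedSub_self _
  obtain ⟨c, hc₁, hc₂⟩ := hv h hB
  -- The generated submodule lies in the line of `(v₁, v₂)` plus the other eigenspaces of `h`.
  -- Independence of eigenspaces leaves only that line for eigenvalue `c`.
  have key (a₁ a₂ : ℂ) (ha : (a₁ • v₁, a₂ • v₂) ∈ M) : a₁ = a₂ := by
    obtain ⟨y, hy, z, hz, hyz⟩ := Submodule.mem_sup.1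
      (generatedSub_le_sup hρ hN (c := c) (by rw [hρa, hc₁, hc₂]; rfl) ha)
    obtain ⟨a, rfl⟩ := Submodule.mem_span_singleton.1 hy
    have h1 : z = ((a₁ - a) • v₁, (a₂ - a) • v₂) := by
      rw [← sub_eq_of_eq_add' hyz.symm, sub_smul, sub_smul]
      rfl
    have h2 : z ∈ (ρ h).eigenspace c := by
      rw [Module.End.mem_eigenspace_iff, h1, hρa]
      dsimp only
      rw [map_smul, map_smul, hc₁, hc₂, smul_comm _ c, smul_comm _ c]
      rfl
    have h3 : z = 0 := Submodule.disjoint_def.1 (Module.End.eigenspaces_iSupIndep (ρ h) c) z h2 hz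
    rw [h1, Prod.mk_eq_zero, smul_eq_zero_iff_left hv₁, smul_eq_zero_iff_left hv₂] at h3
    rw [sub_eq_zero.1 h3.1, sub_eq_zero.1 h3.2]
  -- The kernel is a submodule of the other factor, so zero or everything; the latter would put `(0,
  -- v₂)` into `M`, against `key`. The image is a submodule containing `v₁`.
  have hfst : Function.Bijective (LinearMap.fst ℂ V₁ V₂ ∘ₗ M.subtype) := by
    constructor
    · rw [← LinearMap.ker_eq_bot, LinearMap.ker_eq_bot']
      rintro ⟨⟨m₁, m₂⟩, hm⟩ (rfl : m₁ = 0)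
      rcases hV₂ (M.comap (LinearMap.inr ℂ V₁ V₂)) fun x m hm => by
          have := hM x hm
          rw [hρa] at this
          change (0, ρ₂ x m) ∈ M
          simpa using this with h1 | h1
      · have h2 : m₂ ∈ M.comap (LinearMap.inr ℂ V₁ V₂) := hm
        rw [h1, Submodule.mem_bot] at h2
        simp [h2]
      · have h2 : v₂ ∈ M.comap (LinearMap.inr ℂ V₁ V₂) := h1 ▸ Submodule.mem_top
        have h3 : ((0 : V₁), v₂) ∈ M := h2
        exact absurd (key 0 1 (by simpa using h3)) zero_ne_one
    · rw [← LinearMap.range_eq_top, LinearMap.range_comp, Submodule.range_subtype]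
      refine (hV₁ _ ?_).resolve_left fun h1 => ?_
      · rintro x _ ⟨m, hm, rfl⟩
        exact ⟨ρ x m, hM x hm, rfl⟩
      · have : v₁ ∈ M.map (LinearMap.fst ℂ V₁ V₂) := ⟨_, hvM, rfl⟩
        rw [h1] at this
        exact hv₁ this
  have hsnd : Function.Bijective (LinearMap.snd ℂ V₁ V₂ ∘ₗ M.subtype) := by
    constructor
    · rw [← LinearMap.ker_eq_bot, LinearMap.ker_eq_bot']
      rintro ⟨⟨m₁, m₂⟩, hm⟩ (rfl : m₂ = 0)
      rcases hV₁ (M.comap (LinearMap.inl ℂ V₁ V₂)) fun x m hm => by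
          have := hM x hm
          rw [hρa] at this
          change (ρ₁ x m, 0) ∈ M
          simpa using this with h1 | h1
      · have h2 : m₁ ∈ M.comap (LinearMap.inl ℂ V₁ V₂) := hm
        rw [h1, Submodule.mem_bot] at h2
        simp [h2]
      · have h2 : v₁ ∈ M.comap (LinearMap.inl ℂ V₁ V₂) := h1 ▸ Submodule.mem_top
        have h3 : (v₁, (0 : V₂)) ∈ M := h2
        exact absurd (key 1 0 (by simpa using h3)) one_ne_zero
    · rw [← LinearMap.range_eq_top, LinearMap.range_comp, Submodule.range_subtype]
      refine (hV₂ _ ?_).resolve_left fun h1 => ?_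
      · rintro x _ ⟨m, hm, rfl⟩
        exact ⟨ρ x m, hM x hm, rfl⟩
      · have : v₂ ∈ M.map (LinearMap.snd ℂ V₁ V₂) := ⟨_, hvM, rfl⟩
        rw [h1] at this
        exact hv₂ this
  let e₁ := LinearEquiv.ofBijective _ hfst
  let e₂ := LinearEquiv.ofBijective _ hsnd
  refine ⟨e₁.symm.trans e₂, fun x m => ?_⟩
  obtain ⟨m, rfl⟩ := e₁.surjective m
  have h1 : ρ₁ x (e₁ m) = e₁ ⟨ρ x m, hM x m.2⟩ := rfl
  rw [h1, LinearEquiv.trans_apply, LinearEquiv.trans_apply, e₁.symm_apply_apply,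
    e₁.symm_apply_apply]
  rfl

end HighestWeight

theorem one_tmul_injective (σ F : Type*) [AddCommGroup F] [Module ℂ F] :
    Function.Injective fun w : F => (1 : MvPolynomial σ ℂ) ⊗ₜ[ℂ] w := by
  intro w w' h
  have := congrArg ((TensorProduct.lid ℂ F).toLinearMap ∘ₗ LinearMap.rTensor F
    (MvPolynomial.aeval (fun _ => (0 : ℂ)) : MvPolynomial σ ℂ →ₐ[ℂ] ℂ).toLinearMap) h
  simpa using this

/-! ### The shift by 2ρ_𝔲 on modules of the parabolic subalgebra. -/

section TwistedModule

attribute [local instance 100] LieRing.ofAssociativeRing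

open LieAlgebra LieAlgebra.IsKilling LieModule

variable {L : Type*} [LieRing L] [LieAlgebra ℂ L] [FiniteDimensional ℂ L]
  [LieAlgebra.IsSemisimple ℂ L] {H : LieSubalgebra ℂ L} [H.IsCartanSubalgebra]
  (b : (rootSystem H).Base) (S : Set b.support)

/-- The elements of the parabolic subalgebra in the Cartan subalgebra or in a positive root space. -/
def borelSet : Set (parabolic b S) :=
  {a | (a : L) ∈ H ∨ ∃ γ : H.root, b.IsPos γ ∧ (a : L) ∈ rootSpace H ((γ : Weight ℂ H L) : H → ℂ)}

/-- The elements of the parabolic subalgebra in a negative root space. -/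
def negativeSet : Set (parabolic b S) :=
  {a | ∃ γ : H.root, ¬b.IsPos γ ∧ (a : L) ∈ rootSpace H ((γ : Weight ℂ H L) : H → ℂ)}

theorem span_borelSet_union_negativeSet :
    Submodule.span ℂ (borelSet b S ∪ negativeSet b S) = ⊤ := by
  rw [eq_top_iff]
  rintro ⟨a, ha⟩ -
  suffices h : (parabolicSpace b S).toSubmodule ≤
      (Submodule.span ℂ (borelSet b S ∪ negativeSet b S)).map (parabolic b S).toSubmodule.subtype by
    obtain ⟨⟨a', _⟩, h1, rfl⟩ := h ha
    exact h1
  have hroot (γ : H.root) (h : rootSpace H ((γ : Weight ℂ H L) : H → ℂ) ≤ parabolicSpace b S) :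
      (rootSpace H ((γ : Weight ℂ H L) : H → ℂ)).toSubmodule ≤
        (Submodule.span ℂ (borelSet b S ∪ negativeSet b S)).map
          (parabolic b S).toSubmodule.subtype := fun a ha =>
    ⟨⟨a, h ha⟩, Submodule.subset_span (by
      by_cases hγ : b.IsPos γ
      · exact .inl (.inr ⟨γ, hγ, ha⟩)
      · exact .inr ⟨γ, hγ, ha⟩), rfl⟩
  rw [parabolicSpace]
  simp only [LieSubmodule.sup_toSubmodule, LieSubmodule.iSup_toSubmodule]
  refine sup_le (sup_le ?_ ?_) ?_
  · exact fun a ha => ⟨⟨a, cartan_mem_parabolic ⟨a, ha⟩⟩, Submodule.subset_span (.inl (.inl ha)), rfl⟩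
  · refine iSup₂_le fun γ hγ => hroot γ ?_
    exact le_sup_of_le_left (le_sup_of_le_right
      (le_iSup₂_of_le (f := fun (γ : H.root) (_ : γ ∈ leviRoots b S) =>
        rootSpace H ((γ : Weight ℂ H L) : H → ℂ)) γ hγ le_rfl))
  · refine iSup₂_le fun γ hγ => hroot γ ?_
    exact le_sup_of_le_right
      (le_iSup₂_of_le (f := fun (γ : H.root) (_ : γ ∈ nilRoots b S) =>
        rootSpace H ((γ : Weight ℂ H L) : H → ℂ)) γ hγ le_rfl)

/-- For the empty set of simple roots the level is the height, and level zero would force a root to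
be zero. -/
theorem exists_height_neg {γ : H.root} (hγ : ¬b.IsPos γ) :
    ∃ j : ℕ, 0 < j ∧ level b ∅ ((rootSystem H).root γ) = -(j : ℂ) := by
  let _ := (rootSystem H).indexNeg
  have hp : b.IsPos (-γ) := (RootPairing.Base.IsPos.or_neg b γ).resolve_left hγ
  have hr : (rootSystem H).root (-γ) = -(rootSystem H).root γ := by
    change (rootSystem H).root ((rootSystem H).reflectionPerm γ γ) = _
    rw [RootPairing.root_reflectionPerm, RootPairing.reflection_apply_self]
  obtain ⟨n, hn, h0⟩ := level_pos b ∅ hp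
  refine ⟨n, Nat.pos_of_ne_zero fun h => ?_, ?_⟩
  · have h1 := h0 h
    change _ ∈ Submodule.span ℤ _ at h1
    rw [Set.image_empty, Submodule.span_empty, Submodule.mem_bot] at h1
    exact (rootSystem H).ne_zero _ h1
  · rw [← hn, hr, map_neg, neg_neg]

variable {b S}

theorem eq_bot_or_eq_top_of_isIrreducible {F : Type*} [AddCommGroup F] [Module ℂ F]
    [LieRingModule (parabolic b S) F] [LieModule ℂ (parabolic b S) F]
    (hF : LieModule.IsIrreducible ℂ (parabolic b S) F) (M : Submodule ℂ F)
    (hM : ∀ x : parabolic b S, ∀ m ∈ M, ⁅x, m⁆ ∈ M) : M = ⊥ ∨ M = ⊤ := by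
  let M' : LieSubmodule ℂ (parabolic b S) F := { M with lie_mem := fun {x m} hm => hM x m hm }
  rcases eq_bot_or_eq_top M' with h | h
  · exact .inl (congrArg LieSubmodule.toSubmodule h)
  · exact .inr (congrArg LieSubmodule.toSubmodule h)

variable (f : NegRootVectors b S) (F : Type*) [AddCommGroup F] [Module ℂ F]
  [LieRingModule (parabolic b S) F] [LieModule ℂ (parabolic b S) F]

/-- `nilTrace` as a linear form. -/
def nilTraceForm : L →ₗ[ℂ] ℂ where
  toFun := nilTrace f
  map_add' x y := by simp only [nilTrace, lie_add, map_add, Finset.sum_add_distrib]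
  map_smul' c x := by
    simp only [nilTrace, lie_smul, map_smul, Finset.smul_sum, RingHom.id_apply]

/-- The operators by which the parabolic subalgebra acts on `1 ⊗ F` through `piFormula`. -/
def shiftedRep : parabolic b S →ₗ[ℂ] End ℂ F :=
  (LieModule.toEnd ℂ (parabolic b S) F : parabolic b S →ₗ[ℂ] End ℂ F) -
    ((nilTraceForm f).comp (parabolic b S).toSubmodule.subtype).smulRight 1

theorem shiftedRep_apply (a : parabolic b S) (w : F) :
    shiftedRep f F a w = ⁅a, w⁆ - nilTrace f a • w := rfl

/-- Inherited from `piFormula_lie` through the embedding `w ↦ 1 ⊗ w`, so no separate proof that the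
trace vanishes on brackets is needed. -/
theorem shiftedRep_lie (a c : parabolic b S) :
    shiftedRep f F ⁅a, c⁆ = shiftedRep f F a * shiftedRep f F c - shiftedRep f F c * shiftedRep f F a := by
  refine LinearMap.ext fun w => one_tmul_injective (nilRoots b S) F ?_
  have h (a : parabolic b S) (w : F) :
      tensorRep (Weyl.fockRep ∅) F (piFormula f F a) (1 ⊗ₜ w) = 1 ⊗ₜ[ℂ] shiftedRep f F a w :=
    tensorRep_piFormula_one f F a w
  dsimp only
  rw [← h, LieSubalgebra.coe_bracket, piFormula_lie, map_sub, map_mul, map_mul,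
    LinearMap.sub_apply, Module.End.mul_apply, Module.End.mul_apply, h, h, h, h,
    LinearMap.sub_apply, TensorProduct.tmul_sub]
  rfl

/-- Subtracting the trace changes the highest weight λ + 2ρ_𝔲 of `F'` to λ, and leaves the
submodules and the annihilation by positive root vectors unchanged; uniqueness then applies. The
height element grades the lowering operators. -/
theorem exists_equiv_shiftedRep {lam : Dual ℂ H} (hF : IsSimpleHighestWeight b S lam F)
    (F' : Type*) [AddCommGroup F'] [Module ℂ F'] [LieRingModule (parabolic b S) F']
    [LieModule ℂ (parabolic b S) F']
    (hF' : IsSimpleHighestWeight b S (lam + (2 : ℂ) • rhoU b S) F') :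
    ∃ ψ : F ≃ₗ[ℂ] F', ∀ (a : parabolic b S) (w : F), ψ ⁅a, w⁆ = shiftedRep f F' a (ψ w) := by
  obtain ⟨h, hh⟩ := exists_levelElt b (∅ : Set b.support)
  obtain ⟨v, hv, hvH, hvN⟩ := hF.exists_highest
  obtain ⟨v', hv', hvH', hvN'⟩ := hF'.exists_highest
  refine exists_equiv_of_highest_weight
    (ρ₁ := (LieModule.toEnd ℂ (parabolic b S) F : parabolic b S →ₗ[ℂ] End ℂ F))
    (ρ₂ := shiftedRep f F') (fun x y => LieHom.map_lie _ x y) (shiftedRep_lie f F')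
    (fun M hM => eq_bot_or_eq_top_of_isIrreducible hF.irreducible M hM)
    (fun M hM => eq_bot_or_eq_top_of_isIrreducible hF'.irreducible M fun x m hm => ?_)
    (span_borelSet_union_negativeSet b S) (h := ⟨h, cartan_mem_parabolic h⟩) (.inl h.2)
    ?_ hv hv' ?_
  · have h1 := add_mem (hM x m hm) (Submodule.smul_mem M (nilTrace f x) hm)
    rwa [shiftedRep_apply, sub_add_cancel] at h1
  · rintro n ⟨γ, hγ, hn⟩
    obtain ⟨j, hj, hj'⟩ := exists_height_neg b hγ
    refine ⟨j, hj, Subtype.ext ?_⟩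
    have h1 : ⁅(h : L), (n : L)⁆ = ((γ : Weight ℂ H L) : H → ℂ) h • (n : L) :=
      lie_eq_smul_of_mem_rootSpace hn h
    rw [← hh] at hj'
    have h2 : ((γ : Weight ℂ H L) : H → ℂ) h = -(j : ℂ) := hj'
    rw [h2] at h1
    exact h1
  · rintro x (hx | ⟨γ, hγ, hx⟩)
    · refine ⟨lam ⟨x, hx⟩, hvH x hx, ?_⟩
      have h1 := nilTrace_cartan f ⟨x, hx⟩
      rw [shiftedRep_apply, hvH' x hx, h1, ← sub_smul, LinearMap.add_apply, add_sub_cancel_right]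
    · refine ⟨0, ?_, ?_⟩
      · rw [zero_smul]; exact hvN γ hγ x hx
      · rw [shiftedRep_apply, hvN' γ hγ x hx, nilTrace_root f _ hx, zero_smul, sub_zero]
        exact LieSubalgebra.isNonZero_coe_root γ

end TwistedModule

/-! ### The spanning half of the Poincaré-Birkhoff-Witt theorem. -/

section Words

variable {ι F N : Type*} [AddCommGroup F] [Module ℂ F] [AddCommGroup N] [Module ℂ N]

/-- The product of the operators `t i` along a word. -/
def wordEnd (t : ι → End ℂ N) (l : List ι) : End ℂ N := (l.map t).prod

theorem wordEnd_nil (t : ι → End ℂ N) (m : N) : wordEnd t [] m = m := rfl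

theorem wordEnd_cons (t : ι → End ℂ N) (i : ι) (l : List ι) (m : N) :
    wordEnd t (i :: l) m = t i (wordEnd t l m) := by
  rw [wordEnd, List.map_cons, List.prod_cons]
  rfl

/-- The span of the vectors obtained from `j v` by applying words of length less than `n`. -/
def wordSub (t : ι → End ℂ N) (j : F →ₗ[ℂ] N) (n : ℕ) : Submodule ℂ N :=
  Submodule.span ℂ {m | ∃ (l : List ι) (v : F), l.length < n ∧ m = wordEnd t l (j v)}

theorem wordEnd_mem_wordSub (t : ι → End ℂ N) (j : F →ₗ[ℂ] N) {n : ℕ} {l : List ι}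
    (h : l.length < n) (v : F) : wordEnd t l (j v) ∈ wordSub t j n :=
  Submodule.subset_span ⟨l, v, h, rfl⟩

theorem apply_mem_wordSub (t : ι → End ℂ N) (j : F →ₗ[ℂ] N) {n : ℕ} (i : ι) {m : N}
    (hm : m ∈ wordSub t j n) : t i m ∈ wordSub t j (n + 1) := by
  suffices wordSub t j n ≤ (wordSub t j (n + 1)).comap (t i) from this hm
  refine Submodule.span_le.2 ?_
  rintro _ ⟨l, v, hl, rfl⟩
  rw [SetLike.mem_coe, Submodule.mem_comap, ← wordEnd_cons]
  exact wordEnd_mem_wordSub t j (by simpa using hl) v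

/-- Exchanging two adjacent letters costs their commutator, a combination of single letters, hence
words shorter by one. -/
theorem wordEnd_sub_mem_of_perm {t : ι → End ℂ N} {j : F →ₗ[ℂ] N}
    (ht : ∀ i k, t i * t k - t k * t i ∈ Submodule.span ℂ (Set.range t)) {l l' : List ι}
    (h : l.Perm l') (v : F) :
    wordEnd t l (j v) - wordEnd t l' (j v) ∈ wordSub t j l.length := by
  induction h with
  | nil => rw [sub_self]; exact zero_mem _
  | cons i _ ih =>
    rw [wordEnd_cons, wordEnd_cons, ← map_sub]
    exact apply_mem_wordSub t j i ih
  | swap i k l =>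
    have h1 : ∀ T ∈ Submodule.span ℂ (Set.range t),
        T (wordEnd t l (j v)) ∈ wordSub t j (i :: k :: l).length := fun T hT => by
      induction hT using Submodule.span_induction with
      | mem T hT =>
        obtain ⟨a, rfl⟩ := hT
        rw [← wordEnd_cons]
        exact wordEnd_mem_wordSub t j (by simp) v
      | zero => exact zero_mem _
      | add T T' _ _ hT hT' => exact add_mem hT hT'
      | smul c T _ hT => exact Submodule.smul_mem _ _ hT
    simp only [wordEnd_cons]
    exact h1 _ (ht k i)
  | trans h₁ h₂ ih₁ ih₂ =>
    rw [← h₁.length_eq] at ih₂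
    rw [← sub_add_sub_cancel]
    exact add_mem ih₁ ih₂

theorem wordEnd_mem_of_sorted {t : ι → End ℂ N} {j : F →ₗ[ℂ] N}
    (ht : ∀ i k, t i * t k - t k * t i ∈ Submodule.span ℂ (Set.range t)) {M : Submodule ℂ N}
    (hM : ∀ (m : ι →₀ ℕ) v, wordEnd t (Finsupp.toMultiset m).toList (j v) ∈ M) (n : ℕ) :
    wordSub t j n ≤ M := by
  classical
  induction n with
  | zero =>
    refine Submodule.span_le.2 ?_
    rintro _ ⟨l, v, hl, -⟩
    exact absurd hl (Nat.not_lt_zero _)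
  | succ n ih =>
    refine Submodule.span_le.2 ?_
    rintro _ ⟨l, v, hl, rfl⟩
    -- The normal form of a word is the chosen listing of its multiset of letters; no order on the
    -- index set is required.
    let m : ι →₀ ℕ := Multiset.toFinsupp (l : Multiset ι)
    have h1 : l.Perm (Finsupp.toMultiset m).toList := by
      rw [← Multiset.coe_eq_coe, Multiset.coe_toList, Multiset.toFinsupp_toMultiset]
    have h2 := ih ((Submodule.span_mono fun z ⟨l', v, h, hz⟩ => ⟨l', v, by omega, hz⟩ :
      wordSub t j l.length ≤ wordSub t j n) (wordEnd_sub_mem_of_perm ht h1 v))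
    have h3 := add_mem h2 (hM m v)
    rwa [sub_add_cancel] at h3

/-- An arbitrary `x` is moved to the right past the letters, each commutator acting on a shorter
word; at the end it meets `j v`, which `P` maps into the range of `j`. -/
theorem apply_mem_iSup_wordSub {Q : Type*} [LieRing Q] [LieAlgebra ℂ Q] {r : Q →ₗ[ℂ] End ℂ N}
    (hr : ∀ x y, r ⁅x, y⁆ = r x * r y - r y * r x) {f : ι → Q} {P : Set Q}
    (hP : Submodule.span ℂ (Set.range f ∪ P) = ⊤) {j : F →ₗ[ℂ] N}
    (hj : ∀ p ∈ P, ∀ v, ∃ v', r p (j v) = j v') (x : Q) (l : List ι) (v : F) :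
    r x (wordEnd (fun i => r (f i)) l (j v)) ∈ ⨆ n, wordSub (fun i => r (f i)) j n := by
  set t : ι → End ℂ N := fun i => r (f i) with ht
  have hdir : Monotone (wordSub t j) := fun n n' h =>
    Submodule.span_mono fun z ⟨l', v, h', hz⟩ => ⟨l', v, h'.trans_le h, hz⟩
  have hstab (i : ι) {m : N} (hm : m ∈ ⨆ n, wordSub t j n) : t i m ∈ ⨆ n, wordSub t j n := by
    obtain ⟨n, hn⟩ := (Submodule.mem_iSup_of_directed _ hdir.directed_le).1 hm
    exact Submodule.mem_iSup_of_mem (n + 1) (apply_mem_wordSub t j i hn)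
  have hword (l : List ι) (v : F) : wordEnd t l (j v) ∈ ⨆ n, wordSub t j n :=
    Submodule.mem_iSup_of_mem (l.length + 1) (wordEnd_mem_wordSub t j (Nat.lt_succ_self _) v)
  induction l generalizing x v with
  | nil =>
    have hx : x ∈ Submodule.span ℂ (Set.range f ∪ P) := hP ▸ Submodule.mem_top
    induction hx using Submodule.span_induction with
    | mem x hx =>
      rcases hx with ⟨i, rfl⟩ | hx
      · exact hstab i (hword [] v)
      · obtain ⟨v', hv'⟩ := hj x hx v
        rw [wordEnd_nil, hv']
        exact hword [] v'
    | zero => rw [map_zero]; exact zero_mem _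
    | add x y _ _ hx hy => rw [map_add]; exact add_mem hx hy
    | smul c x _ hx => rw [map_smul]; exact Submodule.smul_mem _ _ hx
  | cons i l ih =>
    have h1 : r x (wordEnd t (i :: l) (j v)) =
        r ⁅x, f i⁆ (wordEnd t l (j v)) + t i (r x (wordEnd t l (j v))) := by
      rw [wordEnd_cons, hr, LinearMap.sub_apply, Module.End.mul_apply, Module.End.mul_apply,
        sub_add_cancel]
    rw [h1]
    exact add_mem (ih _ _) (hstab i (ih _ _))

end Words

/-! ### Leading terms of words acting on the vacuum. -/

namespace Weyl

variable {σ : Type*} {t : σ → End ℂ (MvPolynomial σ ℂ)}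

theorem prod_map_X_mem_polyFil (l : List σ) :
    (l.map (MvPolynomial.X (R := ℂ))).prod ∈ polyFil (fun _ : σ => 1) l.length := by
  induction l with
  | nil => exact monomial_mem_polyFil (by simp) 1
  | cons i l ih =>
    rw [List.map_cons, List.prod_cons, List.length_cons, Nat.cast_succ]
    exact X_mul_mem_polyFil i ih

/-- Each letter is multiplication by minus its variable, up to an operator that does not raise
degree, so errors stay below the top degree. -/
theorem wordEnd_one_sub_mem
    (ht : ∀ i k, ∀ y ∈ polyFil (fun _ : σ => 1) k,
      t i y + MvPolynomial.X i * y ∈ polyFil (fun _ : σ => 1) k) (l : List σ) :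
    wordEnd t l 1 - (-1 : ℂ) ^ l.length • (l.map MvPolynomial.X).prod ∈
      polyFil (fun _ : σ => 1) (l.length - 1) := by
  induction l with
  | nil =>
    rw [wordEnd_nil, List.length_nil, pow_zero, one_smul, List.map_nil, List.prod_nil, sub_self]
    exact zero_mem _
  | cons i l ih =>
    have h1 : wordEnd t l 1 ∈ polyFil (fun _ : σ => 1) l.length := by
      have h2 := add_mem (polyFil_mono (fun _ : σ => 1) (by omega) ih) (Submodule.smul_mem
        (polyFil (fun _ : σ => 1) l.length) ((-1 : ℂ) ^ l.length) (prod_map_X_mem_polyFil l))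
      rwa [sub_add_cancel] at h2
    have h3 := X_mul_mem_polyFil i ih
    have h4 := sub_mem (ht i _ _ h1) (by rwa [sub_add_cancel] at h3)
    rw [wordEnd_cons, List.length_cons, Nat.cast_succ, add_sub_cancel_right, List.map_cons,
      List.prod_cons]
    convert h4 using 1
    rw [mul_sub, pow_succ, mul_neg_one, neg_smul, mul_smul_comm]
    abel

theorem prod_map_X_toList (m : σ →₀ ℕ) :
    ((Finsupp.toMultiset m).toList.map (MvPolynomial.X (R := ℂ))).prod =
      MvPolynomial.monomial m 1 := by
  rw [← Multiset.prod_coe, ← Multiset.map_coe, Multiset.coe_toList]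
  induction m using Finsupp.induction_linear with
  | zero => simp
  | add m m' h h' =>
    rw [map_add, Multiset.map_add, Multiset.prod_add, h, h', MvPolynomial.monomial_mul, one_mul]
  | single i n =>
    rw [Finsupp.toMultiset_single, Multiset.map_nsmul, Multiset.map_singleton,
      Multiset.prod_nsmul, Multiset.prod_singleton, MvPolynomial.X_pow_eq_monomial]

theorem length_toList_toMultiset (m : σ →₀ ℕ) :
    ((Finsupp.toMultiset m).toList.length : ℤ) = Finsupp.weight (fun _ : σ => (1 : ℤ)) m := by
  rw [Multiset.length_toList, Finsupp.card_toMultiset, Finsupp.weight_apply, Finsupp.sum,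
    Finsupp.sum, Nat.cast_sum]
  simp

/-- The linear map sending each monomial to the corresponding word applied to `1`. -/
def wordMap (t : σ → End ℂ (MvPolynomial σ ℂ)) : End ℂ (MvPolynomial σ ℂ) :=
  (MvPolynomial.basisMonomials σ ℂ).constr ℂ fun m => wordEnd t (Finsupp.toMultiset m).toList 1

theorem wordMap_monomial (m : σ →₀ ℕ) :
    wordMap t (MvPolynomial.monomial m 1) = wordEnd t (Finsupp.toMultiset m).toList 1 := by
  have := (MvPolynomial.basisMonomials σ ℂ).constr_basis ℂ
    (fun m => wordEnd t (Finsupp.toMultiset m).toList 1) m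
  rwa [MvPolynomial.coe_basisMonomials] at this

theorem bijective_wordMap
    (ht : ∀ i k, ∀ y ∈ polyFil (fun _ : σ => 1) k,
      t i y + MvPolynomial.X i * y ∈ polyFil (fun _ : σ => 1) k) :
    Function.Bijective (wordMap t) := by
  -- The leading part of `wordMap` is a diagonal matrix of signs, an involution preserving the
  -- degree filtration; the rest strictly lowers degree.
  let B : End ℂ (MvPolynomial σ ℂ) := (MvPolynomial.basisMonomials σ ℂ).constr ℂ fun m =>
    (-1 : ℂ) ^ (Finsupp.toMultiset m).toList.length • MvPolynomial.monomial m 1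
  have hB (m : σ →₀ ℕ) : B (MvPolynomial.monomial m 1) =
      (-1 : ℂ) ^ (Finsupp.toMultiset m).toList.length • MvPolynomial.monomial m 1 := by
    have := (MvPolynomial.basisMonomials σ ℂ).constr_basis ℂ (fun m =>
      (-1 : ℂ) ^ (Finsupp.toMultiset m).toList.length • MvPolynomial.monomial m (1 : ℂ)) m
    rwa [MvPolynomial.coe_basisMonomials] at this
  have hBB : B * B = 1 := by
    refine (MvPolynomial.basisMonomials σ ℂ).ext fun m => ?_
    rw [MvPolynomial.coe_basisMonomials, Module.End.mul_apply, hB, map_smul, hB, smul_smul,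
      ← mul_pow, neg_one_mul, neg_neg, one_pow, one_smul]
    rfl
  have h := bijective_add_of_lowering (Fil := polyFil fun _ : σ => 1) (B := B)
    (D := wordMap t - B) (fun k => polyFil_eq_bot fun _ => zero_le_one) (exists_mem_polyFil _)
    (Function.LeftInverse.injective (g := B) fun y => LinearMap.congr_fun hBB y)
    (fun k y hy => ⟨B y, polyFil_induction (φ := B) (fun m hm => by
      rw [hB]
      exact Submodule.smul_mem _ _ (monomial_mem_polyFil hm 1)) hy, LinearMap.congr_fun hBB y⟩)
    (fun k y hy => polyFil_induction (φ := wordMap t - B) (fun m hm => by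
      have h1 := wordEnd_one_sub_mem ht (Finsupp.toMultiset m).toList
      rw [prod_map_X_toList, length_toList_toMultiset] at h1
      rw [LinearMap.sub_apply, wordMap_monomial, hB]
      exact polyFil_mono _ (by omega) h1) hy)
  rwa [add_sub_cancel] at h

end Weyl

namespace Via

variable {R V N : Type*} [Ring R] [Algebra ℂ R] [AddCommGroup V] [Module ℂ V] [AddCommGroup N]
  [Module R N] [Module ℂ N] [IsScalarTower ℂ R N] {θ : R →ₐ[ℂ] End ℂ V}

/-- The underlying `ℂ`-linear map of an `R`-linear map. -/
def toLinearMap (Φ : N →ₗ[R] Via θ.toRingHom) : N →ₗ[ℂ] V where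
  toFun y := (Via.of θ.toRingHom).symm (Φ y)
  map_add' y z := by rw [map_add, map_add]
  map_smul' c y := by
    rw [← algebraMap_smul R c y, map_smul]
    change θ (algebraMap ℂ R c) _ = _
    rw [AlgHom.commutes]
    rfl

theorem toLinearMap_smul (Φ : N →ₗ[R] Via θ.toRingHom) (r : R) (y : N) :
    toLinearMap Φ (r • y) = θ r (toLinearMap Φ y) :=
  Φ.map_smul r y

end Via

section EnvInduction

attribute [local instance 100] LieRing.ofAssociativeRing

variable {Q : Type*} [LieRing Q] [LieAlgebra ℂ Q]

theorem Env.induction {P : Env Q → Prop} (algebraMap : ∀ c, P (algebraMap ℂ (Env Q) c))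
    (ι : ∀ x, P (envι x)) (mul : ∀ r s, P r → P s → P (r * s))
    (add : ∀ r s, P r → P s → P (r + s)) (r : Env Q) : P r := by
  obtain ⟨r, rfl⟩ : ∃ r', UniversalEnvelopingAlgebra.mkAlgHom ℂ Q r' = r :=
    RingCon.mkₐ_surjective _ r
  induction r using TensorAlgebra.induction with
  | algebraMap c => rw [AlgHom.commutes]; exact algebraMap c
  | ι x => exact ι x
  | mul r s hr hs => rw [map_mul]; exact mul _ _ hr hs
  | add r s hr hs => rw [map_add]; exact add _ _ hr hs

theorem Env.map_lie_eq {A : Type*} [Ring A] [Algebra ℂ A] (θ : Env Q →ₐ[ℂ] A) (x y : Q) :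
    θ (envι ⁅x, y⁆) = θ (envι x) * θ (envι y) - θ (envι y) * θ (envι x) := by
  rw [← map_mul θ, ← map_mul θ, ← map_sub θ]
  exact congrArg θ (LieHom.map_lie (UniversalEnvelopingAlgebra.ι ℂ) x y)

end EnvInduction

/-! ### The induced module as a Fock module. -/

section GenVerma

attribute [local instance 100] LieRing.ofAssociativeRing

open LieAlgebra LieAlgebra.IsKilling LieModule

variable {L : Type*} [LieRing L] [LieAlgebra ℂ L] [FiniteDimensional ℂ L]
  [LieAlgebra.IsSemisimple ℂ L] {H : LieSubalgebra ℂ L} [H.IsCartanSubalgebra]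
  (b : (rootSystem H).Base) (S : Set b.support)
  (F : Type*) [AddCommGroup F] [Module ℂ F] [LieRingModule (parabolic b S) F]
  [LieModule ℂ (parabolic b S) F]

theorem envIncl_ι (a : parabolic b S) : envIncl b S (envι a) = envι (a : L) :=
  UniversalEnvelopingAlgebra.lift_ι_apply ℂ
    ((UniversalEnvelopingAlgebra.ι ℂ).comp (parabolic b S).incl) a

theorem envLeft_ι (a : parabolic b S) (v : F) : envLeft b S F (envι a) v = ⁅a, v⁆ := by
  have h := UniversalEnvelopingAlgebra.lift_ι_apply ℂ (LieModule.toEnd ℂ (parabolic b S) F) a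
  exact LinearMap.congr_fun h v

theorem envLeft_algebraMap (c : ℂ) (v : F) :
    envLeft b S F (algebraMap ℂ (Env (parabolic b S)) c) v = c • v := by
  have h := AlgHom.commutes
    (UniversalEnvelopingAlgebra.lift ℂ (LieModule.toEnd ℂ (parabolic b S) F)) c
  exact LinearMap.congr_fun h v

theorem genVerma_mk_eq (e : Env L) (a : Env (parabolic b S)) (v : F) :
    (Submodule.Quotient.mk ((e * envIncl b S a) ⊗ₜ[ℤ] v) : GenVerma b S F) =
      Submodule.Quotient.mk (e ⊗ₜ[ℤ] envLeft b S F a v) :=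
  (Submodule.Quotient.eq _).2 (Submodule.subset_span ⟨e, a, v, rfl⟩)

/-- The canonical map from a module to the induced module. -/
def genVermaMk : F →ₗ[ℂ] GenVerma b S F where
  toFun v := Submodule.Quotient.mk ((1 : Env L) ⊗ₜ[ℤ] v)
  map_add' v w := by rw [TensorProduct.tmul_add]; rfl
  map_smul' c v := by
    have h := genVerma_mk_eq b S F 1 (algebraMap ℂ _ c) v
    rw [envLeft_algebraMap, AlgHom.commutes, one_mul, Algebra.algebraMap_eq_smul_one] at h
    exact h.symm

theorem smul_genVermaMk (e : Env L) (v : F) :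
    e • genVermaMk b S F v = Submodule.Quotient.mk (e ⊗ₜ[ℤ] v) := by
  change e • (Submodule.Quotient.mk ((1 : Env L) ⊗ₜ[ℤ] v) : GenVerma b S F) = _
  rw [← Submodule.Quotient.mk_smul, TensorProduct.smul_tmul', smul_eq_mul, mul_one]

theorem ι_smul_genVermaMk (a : parabolic b S) (v : F) :
    envι (a : L) • genVermaMk b S F v = genVermaMk b S F ⁅a, v⁆ := by
  have h := genVerma_mk_eq b S F 1 (envι a) v
  rw [envLeft_ι, envIncl_ι, one_mul] at h
  rw [smul_genVermaMk]
  exact h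

variable {b S F}

/-- Frobenius reciprocity: compatibility with 𝔭 extends to its enveloping algebra, which is exactly
the balancing relation of the tensor product. -/
theorem exists_genVerma_lift {V : Type*} [AddCommGroup V] [Module ℂ V] (θ : Env L →ₐ[ℂ] End ℂ V)
    (φ : F →ₗ[ℂ] V) (hφ : ∀ (a : parabolic b S) v, θ (envι (a : L)) (φ v) = φ ⁅a, v⁆) :
    ∃ Φ : GenVerma b S F →ₗ[Env L] Via θ.toRingHom, ∀ v, Φ (genVermaMk b S F v) = Via.of _ (φ v) := by
  have hφ' (a : Env (parabolic b S)) : ∀ v, θ (envIncl b S a) (φ v) = φ (envLeft b S F a v) := by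
    induction a using Env.induction with
    | algebraMap c =>
      intro v
      rw [envLeft_algebraMap, AlgHom.commutes, AlgHom.commutes, map_smul]
      rfl
    | ι x => intro v; rw [envIncl_ι, envLeft_ι, hφ]
    | mul r s hr hs =>
      intro v
      rw [map_mul, map_mul, map_mul, Module.End.mul_apply, hs, hr]
      rfl
    | add r s hr hs =>
      intro v
      rw [map_add, map_add, map_add, LinearMap.add_apply, hr, hs, ← map_add]
      rfl
  let g : Env L →ₗ[Env L] F →ₗ[ℤ] Via θ.toRingHom :=
    { toFun e := ((Via.of θ.toRingHom).toAddMonoidHom.comp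
        ((θ e).toAddMonoidHom.comp φ.toAddMonoidHom)).toIntLinearMap
      map_add' e e' := by
        ext v
        change Via.of θ.toRingHom (θ (e + e') (φ v)) = Via.of _ (θ e (φ v)) + Via.of _ (θ e' (φ v))
        rw [map_add, LinearMap.add_apply, map_add]
      map_smul' e e' := by
        ext v
        change Via.of θ.toRingHom (θ (e * e') (φ v)) = Via.of θ.toRingHom (θ e (θ e' (φ v)))
        rw [map_mul]
        rfl }
  have hg (e v) : g e v = Via.of θ.toRingHom (θ e (φ v)) := rfl
  let Φ : GenVerma b S F →ₗ[Env L] Via θ.toRingHom :=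
    Submodule.liftQ _ (TensorProduct.AlgebraTensorModule.lift g) <| by
      rw [Submodule.span_le]
      rintro _ ⟨e, a, v, rfl⟩
      rw [SetLike.mem_coe, LinearMap.mem_ker, map_sub, sub_eq_zero]
      change g (e * envIncl b S a) v = g e (envLeft b S F a v)
      rw [hg, hg, map_mul, Module.End.mul_apply, hφ']
  refine ⟨Φ, fun v => ?_⟩
  change g 1 v = _
  rw [hg, map_one]
  rfl

theorem span_vec_union_parabolic (f : NegRootVectors b S) :
    Submodule.span ℂ (Set.range f.vec ∪ (parabolic b S : Set L)) = ⊤ := by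
  rw [Submodule.span_union, f.span_eq]
  have : Submodule.span ℂ (parabolic b S : Set L) = (parabolic b S).toSubmodule :=
    Submodule.span_eq (parabolic b S).toSubmodule
  rw [this]
  exact (isCompl_oppNilradical_parabolic b S).sup_eq_top

/-- Words in the `f γ` applied to the canonical image of `F` span a submodule, because 𝔭 preserves
that image; reordering words costs only shorter ones. -/
theorem genVerma_sorted_span (f : NegRootVectors b S) {M : Submodule ℂ (GenVerma b S F)}
    (hM : ∀ (m : nilRoots b S →₀ ℕ) v,
      wordEnd (fun γ => Algebra.lsmul ℂ ℂ (GenVerma b S F) (envι (f.vec γ)))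
        (Finsupp.toMultiset m).toList (genVermaMk b S F v) ∈ M) : M = ⊤ := by
  let r : L →ₗ[ℂ] End ℂ (GenVerma b S F) :=
    (Algebra.lsmul ℂ ℂ (GenVerma b S F)).toLinearMap ∘ₗ
      (UniversalEnvelopingAlgebra.ι ℂ : L →ₗ⁅ℂ⁆ Env L).toLinearMap
  have hr (x y : L) : r ⁅x, y⁆ = r x * r y - r y * r x :=
    Env.map_lie_eq (Algebra.lsmul ℂ ℂ (GenVerma b S F)) x y
  let W : Submodule ℂ (GenVerma b S F) :=
    ⨆ n, wordSub (fun γ => r (f.vec γ)) (genVermaMk b S F) n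
  have hWM : W ≤ M := by
    refine iSup_le fun n => wordEnd_mem_of_sorted (fun γ δ => ?_) hM n
    change r (f.vec γ) * r (f.vec δ) - r (f.vec δ) * r (f.vec γ) ∈
      Submodule.span ℂ (Set.range fun γ => r (f.vec γ))
    rw [← hr]
    have h1 := oppNilradical_lie b S (f.vec_mem γ) (f.vec_mem δ)
    change _ ∈ (oppNilradical b S).toSubmodule at h1
    rw [← f.span_eq] at h1
    have h2 := Submodule.mem_map_of_mem (f := r) h1
    rw [Submodule.map_span, ← Set.range_comp] at h2
    exact h2
  have hW (x : L) {m} (hm : m ∈ W) : envι x • m ∈ W := by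
    suffices W ≤ W.comap (r x) from this hm
    refine iSup_le fun n => Submodule.span_le.2 ?_
    rintro _ ⟨l, v, -, rfl⟩
    exact apply_mem_iSup_wordSub hr (span_vec_union_parabolic f)
      (fun p hp v => ⟨_, ι_smul_genVermaMk b S F ⟨p, hp⟩ v⟩) x l v
  have hW' (e : Env L) : ∀ m ∈ W, e • m ∈ W := by
    induction e using Env.induction with
    | algebraMap c => intro m hm; rw [algebraMap_smul]; exact Submodule.smul_mem _ _ hm
    | ι x => exact fun m hm => hW x hm
    | mul r s hr hs => intro m hm; rw [mul_smul]; exact hr _ (hs _ hm)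
    | add r s hr hs => intro m hm; rw [add_smul]; exact add_mem (hr _ hm) (hs _ hm)
  rw [eq_top_iff]
  rintro y -
  refine hWM ?_
  obtain ⟨y, rfl⟩ := Submodule.Quotient.mk_surjective _ y
  induction y using TensorProduct.induction_on with
  | zero => exact zero_mem _
  | tmul e v =>
    rw [← smul_genVermaMk]
    exact hW' e _ (Submodule.mem_iSup_of_mem 1 (wordEnd_mem_wordSub _ _ (l := []) zero_lt_one v))
  | add y z hy hz => rw [Submodule.Quotient.mk_add]; exact add_mem hy hz

variable (f : NegRootVectors b S) {F' : Type*} [AddCommGroup F'] [Module ℂ F']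
  [LieRingModule (parabolic b S) F'] [LieModule ℂ (parabolic b S) F']

theorem tensorRep_piHom_vec {V : Type*} [AddCommGroup V] [Module ℂ V]
    (ρ : WeylU b S →ₐ[ℂ] End ℂ V) (γ : nilRoots b S) :
    tensorRep ρ F' (piHom f F' (envι (f.vec γ))) =
      LinearMap.rTensor F' (ρ (Weyl.vecField (field f (f.vec γ)))) := by
  rw [piHom_ι, piFormula_vec]
  exact TensorProduct.ext' fun v w => tensorRep_tmul _ _ _ _ _ _

theorem fockRep_vecField_vec_mem (γ : nilRoots b S) (k : ℤ) (y : PolyFun b S)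
    (hy : y ∈ Weyl.polyFil (fun _ => 1) k) :
    Weyl.fockRep ∅ (Weyl.vecField (field f (f.vec γ))) y + MvPolynomial.X γ * y ∈
      Weyl.polyFil (fun _ => 1) k := by
  obtain ⟨p, hp, hpγ⟩ := exists_vecField_vec_eq_of_degree f γ
  have h1 := (Weyl.isFiltered_fockRep (∅ : Set (nilRoots b S)) (w := fun _ => 1)
    (fun _ => zero_le_one) (by simp)).sum_mem hp k y hy
  rw [sub_zero] at h1
  rw [hpγ, map_add, LinearMap.add_apply, map_neg, LinearMap.neg_apply, Weyl.fockRep_d, Weyl.fockD,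
    if_neg (Set.notMem_empty γ), LinearMap.mulLeft_apply]
  convert h1 using 1
  abel

/-- Normally ordered words define a surjection `s` from ℂ[∂] ⊗ F onto the induced module. Its
composite with the induced map is `wordMap` tensored with `ψ`, which is bijective, so the induced
map is bijective, and the words turn out to be independent. -/
theorem nonempty_genVerma_equiv (ψ : F ≃ₗ[ℂ] F')
    (hψ : ∀ (a : parabolic b S) (v : F), ψ ⁅a, v⁆ = shiftedRep f F' a (ψ v)) :
    Nonempty (GenVerma b S F ≃ₗ[Env L]
      Via ((tensorRep (Weyl.fockRep (∅ : Set (nilRoots b S))) F').comp (piHom f F')).toRingHom) := by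
  set θ := (tensorRep (Weyl.fockRep (∅ : Set (nilRoots b S))) F').comp (piHom f F') with hθ
  let φ : F →ₗ[ℂ] PolyFun b S ⊗[ℂ] F' := TensorProduct.mk ℂ (PolyFun b S) F' 1 ∘ₗ ψ.toLinearMap
  obtain ⟨Φ, hΦ⟩ := exists_genVerma_lift θ φ fun a v => by
    have h1 := tensorRep_piFormula_one f F' a (ψ v)
    rw [← piHom_ι] at h1
    rw [hθ, AlgHom.comp_apply]
    refine h1.trans ?_
    change _ = 1 ⊗ₜ ψ ⁅a, v⁆
    rw [hψ]
    rfl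
  let s : PolyFun b S ⊗[ℂ] F →ₗ[ℂ] GenVerma b S F := TensorProduct.lift
    ((MvPolynomial.basisMonomials (nilRoots b S) ℂ).constr ℂ fun m =>
      wordEnd (fun γ => Algebra.lsmul ℂ ℂ (GenVerma b S F) (envι (f.vec γ)))
        (Finsupp.toMultiset m).toList ∘ₗ genVermaMk b S F)
  have hs (m : nilRoots b S →₀ ℕ) (v : F) : s (MvPolynomial.monomial m 1 ⊗ₜ v) =
      wordEnd (fun γ => Algebra.lsmul ℂ ℂ (GenVerma b S F) (envι (f.vec γ)))
        (Finsupp.toMultiset m).toList (genVermaMk b S F v) := by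
    have := (MvPolynomial.basisMonomials (nilRoots b S) ℂ).constr_basis ℂ (fun m =>
      wordEnd (fun γ => Algebra.lsmul ℂ ℂ (GenVerma b S F) (envι (f.vec γ)))
        (Finsupp.toMultiset m).toList ∘ₗ genVermaMk b S F) m
    rw [MvPolynomial.coe_basisMonomials] at this
    exact LinearMap.congr_fun this v
  have hsurj : Function.Surjective s := by
    rw [← LinearMap.range_eq_top]
    exact genVerma_sorted_span f fun m v => ⟨_, hs m v⟩
  let Φ' : GenVerma b S F →ₗ[ℂ] PolyFun b S ⊗[ℂ] F' := Via.toLinearMap Φ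
  let t (γ : nilRoots b S) : End ℂ (PolyFun b S) :=
    Weyl.fockRep ∅ (Weyl.vecField (field f (f.vec γ)))
  have hword (l : List (nilRoots b S)) (v : F) :
      Φ' (wordEnd (fun γ => Algebra.lsmul ℂ ℂ (GenVerma b S F) (envι (f.vec γ))) l
        (genVermaMk b S F v)) = wordEnd t l 1 ⊗ₜ ψ v := by
    induction l with
    | nil => exact hΦ v
    | cons γ l ih =>
      rw [wordEnd_cons, wordEnd_cons]
      have h1 (y : GenVerma b S F) : Φ' (envι (f.vec γ) • y) =
          tensorRep (Weyl.fockRep ∅) F' (piHom f F' (envι (f.vec γ))) (Φ' y) :=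
        Via.toLinearMap_smul Φ _ y
      refine (h1 _).trans ?_
      rw [ih, tensorRep_piHom_vec, LinearMap.rTensor_tmul]
  have hcomp : Φ' ∘ₗ s = TensorProduct.map (Weyl.wordMap t) ψ.toLinearMap := by
    refine TensorProduct.ext ((MvPolynomial.basisMonomials (nilRoots b S) ℂ).ext fun m =>
      LinearMap.ext fun v => ?_)
    rw [MvPolynomial.coe_basisMonomials]
    change Φ' (s (_ ⊗ₜ v)) = Weyl.wordMap t _ ⊗ₜ ψ v
    rw [hs, hword, Weyl.wordMap_monomial]
  have hbij : Function.Bijective (Φ' ∘ s) := by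
    have h1 := TensorProduct.map_bijective
      (Weyl.bijective_wordMap (t := t) fun γ k y hy => fockRep_vecField_vec_mem f γ k y hy) ψ.bijective
    have h2 := congrArg DFunLike.coe hcomp
    rw [LinearMap.coe_comp] at h2
    rw [h2]
    exact h1
  have hΦ'inj : Function.Injective Φ' := by
    intro y z hyz
    obtain ⟨y, rfl⟩ := hsurj y
    obtain ⟨z, rfl⟩ := hsurj z
    rw [hbij.1 hyz]
  exact ⟨LinearEquiv.ofBijective Φ ⟨hΦ'inj, hbij.2.of_comp⟩⟩

end GenVerma

theorem Function.Exact.comp_surjective {M M' E W : Type*} [Zero W] {e : M → M'} {i : M' → E}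
    {p : E → W} (h : Function.Exact i p) (he : Function.Surjective e) :
    Function.Exact (i ∘ e) p := fun y => by
  rw [h y, he.range_comp]

theorem neg_pow_apply_eq_zero {V : Type*} [AddCommGroup V] [Module ℂ V] {T : End ℂ V} {n : ℕ}
    {v : V} (h : (T ^ n) v = 0) : ((-T) ^ n) v = 0 := by
  rw [neg_pow, Module.End.mul_apply, h, map_zero]

/-! ### Functoriality of the tensor product with a finite-dimensional factor. -/

section TensorRep

variable {A V W : Type*} [Ring A] [Algebra ℂ A] [AddCommGroup V] [Module ℂ V] [AddCommGroup W]
  [Module ℂ W] {ρ : A →ₐ[ℂ] End ℂ V} {τ : A →ₐ[ℂ] End ℂ W}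
  (F : Type*) [AddCommGroup F] [Module ℂ F]

theorem rTensor_tensorRep {g : V →ₗ[ℂ] W} (hg : ∀ a v, g (ρ a v) = τ a (g v))
    (z : A ⊗[ℂ] End ℂ F) (y : V ⊗[ℂ] F) :
    LinearMap.rTensor F g (tensorRep ρ F z y) = tensorRep τ F z (LinearMap.rTensor F g y) := by
  induction z using TensorProduct.induction_on with
  | zero => simp
  | add z z' hz hz' => simp only [map_add, LinearMap.add_apply, hz, hz']
  | tmul a T =>
    induction y using TensorProduct.induction_on with
    | zero => simp
    | add y y' hy hy' => simp only [map_add, hy, hy']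
    | tmul v w =>
      rw [tensorRep_tmul, LinearMap.rTensor_tmul, LinearMap.rTensor_tmul, tensorRep_tmul, hg]

/-- The homomorphism of modules over `R` induced by a homomorphism of modules over `A`. -/
def Via.rTensor {R : Type*} [Ring R] [Algebra ℂ R] (π : R →ₐ[ℂ] A ⊗[ℂ] End ℂ F) {g : V →ₗ[ℂ] W}
    (hg : ∀ a v, g (ρ a v) = τ a (g v)) :
    Via ((tensorRep ρ F).comp π).toRingHom →ₗ[R] Via ((tensorRep τ F).comp π).toRingHom where
  toFun := LinearMap.rTensor F g
  map_add' y z := map_add (LinearMap.rTensor F g) y z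
  map_smul' r y := rTensor_tensorRep F hg (π r) y

theorem rTensor_bijective {g : V →ₗ[ℂ] W} (hg : Function.Bijective g) :
    Function.Bijective (LinearMap.rTensor F g) :=
  TensorProduct.map_bijective hg Function.bijective_id

theorem exists_rTensor_pow_eq_zero {Q : End ℂ V} (hQ : ∀ v, ∃ n : ℕ, (Q ^ n) v = 0)
    (y : V ⊗[ℂ] F) : ∃ n : ℕ, (LinearMap.rTensor F Q ^ n) y = 0 := by
  induction y using TensorProduct.induction_on with
  | zero => exact ⟨0, rfl⟩
  | tmul v w =>
    obtain ⟨n, hn⟩ := hQ v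
    exact ⟨n, by rw [LinearMap.rTensor_pow, LinearMap.rTensor_tmul, hn, TensorProduct.zero_tmul]⟩
  | add y z hy hz =>
    obtain ⟨m, hm⟩ := hy
    obtain ⟨n, hn⟩ := hz
    refine ⟨n + m, ?_⟩
    rw [map_add, pow_add, Module.End.mul_apply, hm, map_zero, zero_add, ← pow_add, add_comm,
      pow_add, Module.End.mul_apply, hn, map_zero]

theorem nonempty_via_equiv_of_quotient {I : Submodule A A}
    (c : (A ⧸ I) ≃ₗ[A] Via ρ.toRingHom) {R : Type*} [Ring R] [Algebra ℂ R]
    (π : R →ₐ[ℂ] A ⊗[ℂ] End ℂ F) :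
    Nonempty (Via ((tensorRep ρ F).comp π).toRingHom ≃ₗ[R]
      Via ((tensorRep (Algebra.lsmul ℂ ℂ (A ⧸ I)) F).comp π).toRingHom) :=
  ⟨(LinearEquiv.ofBijective (Via.rTensor F π (ρ := Algebra.lsmul ℂ ℂ (A ⧸ I))
    (g := Via.toLinearMap c.toLinearMap) fun a v => Via.toLinearMap_smul c.toLinearMap a v)
      (rTensor_bijective F c.bijective)).symm⟩

end TensorRep

namespace Weyl

theorem exists_quotient_idealV_equiv (σ : Type*) :
    ∃ c : (Weyl σ ⧸ idealV σ) ≃ₗ[Weyl σ] Via (fockRep (∅ : Set σ)).toRingHom,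
      ∀ q, c (Submodule.Quotient.mk (ofFock ∅ q)) = Via.of _ q := by
  rw [← idealFock_empty]
  exact exists_quotient_equiv ∅

theorem exists_quotient_idealGT_equiv {σ : Type*} (α : σ) :
    ∃ c : (Weyl σ ⧸ idealGT α) ≃ₗ[Weyl σ] Via (fockRep ({α} : Set σ)).toRingHom,
      ∀ q, c (Submodule.Quotient.mk (ofFock {α} q)) = Via.of _ q := by
  rw [← idealFock_singleton]
  exact exists_quotient_equiv {α}

end Weyl

/-! ### The twisted induced module. -/

section TwistedVerma

open LieAlgebra LieAlgebra.IsKilling LieModule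

variable {L : Type*} [LieRing L] [LieAlgebra ℂ L] [FiniteDimensional ℂ L]
  [LieAlgebra.IsSemisimple ℂ L] {H : LieSubalgebra ℂ L} [H.IsCartanSubalgebra]
  {b : (rootSystem H).Base} {S : Set b.support} (f : NegRootVectors b S)

/-- On the localization `-∂ α` is bijective compatibly with the filtration, and the level weight
makes all other terms strictly lowering. -/
theorem extRep_vecField_bijective (α : nilRoots b S) :
    Function.Bijective (Weyl.extRep α (Weyl.vecField (field f (f.vec α)))) := by
  obtain ⟨w, hw, hwα, p, hp, h⟩ := exists_vecField_vec_eq_of_level f α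
  have hfil := Weyl.isFiltered_extRep α hw hwα
  rw [h, map_add, map_neg, Weyl.extRep_d]
  refine bijective_add_of_lowering hfil.eq_bot hfil.exists_mem
    (fun y z hyz => Weyl.extD_injective α (neg_injective hyz)) (fun k y hy => ?_)
    (fun k y hy => hfil.sum_mem hp k y hy)
  obtain ⟨z, hz, hzy⟩ := Weyl.exists_extD_eq α hwα k y hy
  exact ⟨-z, neg_mem hz, by rw [LinearMap.neg_apply, map_neg, neg_neg, hzy]⟩

theorem exists_fockRep_vecField_pow_eq_zero (α : nilRoots b S) (y : PolyFun b S) :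
    ∃ n : ℕ, (Weyl.fockRep {α} (Weyl.vecField (field f (f.vec α))) ^ n) y = 0 := by
  obtain ⟨w, hw, hwα, p, hp, h⟩ := exists_vecField_vec_eq_of_level f α
  have hfil := Weyl.isFiltered_fockRep {α} hw (by simpa using hwα)
  rw [h, map_add, map_neg, Weyl.fockRep_d]
  refine exists_pow_add_apply_eq_zero hfil.mono hfil.eq_bot hfil.exists_mem (fun k y hy => ?_)
    (fun k y hy => hfil.sum_mem hp k y hy) (fun y => ?_) y
  · have h1 := hfil.d_mem α k y hy
    rw [hwα, add_zero, Weyl.fockRep_d] at h1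
    exact neg_mem h1
  · obtain ⟨n, hn⟩ := Weyl.exists_fockD_pow_eq_zero α y
    exact ⟨n, neg_pow_apply_eq_zero hn⟩

variable {F F' : Type*} [AddCommGroup F] [Module ℂ F] [LieRingModule (parabolic b S) F]
  [LieModule ℂ (parabolic b S) F] [AddCommGroup F'] [Module ℂ F']
  [LieRingModule (parabolic b S) F'] [LieModule ℂ (parabolic b S) F']

/-- The sequence ℂ[∂] → localization → ℂ[x_α, ∂_γ, γ ≠ α] stays exact after tensoring with `F'`;
there `f α` acts bijectively in the middle and locally nilpotently on the right, so the twist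
criterion applies. -/
theorem nonempty_gtModule_equiv (α : nilRoots b S)
    (Φ : GenVerma b S F ≃ₗ[Env L]
      Via ((tensorRep (Weyl.fockRep (∅ : Set (nilRoots b S))) F').comp (piHom f F')).toRingHom) :
    Nonempty (GTModule f α F ≃ₗ[Env L]
      Via ((tensorRep (Weyl.fockRep ({α} : Set (nilRoots b S))) F').comp
        (piHom f F')).toRingHom) := by
  let i := Via.rTensor F' (piHom f F') (ρ := Weyl.fockRep ∅) (τ := Weyl.extRep α)
    (g := LinearMap.inl ℂ _ _) fun a v => (Weyl.extRep_inl α a v).symm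
  let p := Via.rTensor F' (piHom f F') (ρ := Weyl.extRep α) (τ := Weyl.fockRep {α})
    (g := LinearMap.snd ℂ _ _) (Weyl.snd_extRep α)
  have hi : Function.Injective i :=
    Module.Flat.rTensor_preserves_injective_linearMap (M := F') (LinearMap.inl ℂ _ _)
      LinearMap.inl_injective
  have hip : Function.Exact i p :=
    rTensor_exact F' (f := LinearMap.inl ℂ (PolyFun b S) (PolyFun b S))
      (g := LinearMap.snd ℂ _ _) Function.Exact.inl_snd LinearMap.snd_surjective
  have hp : Function.Surjective p := LinearMap.rTensor_surjective F' LinearMap.snd_surjective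
  refine nonempty_twist_equiv (envι (f.vec α)) (i ∘ₗ Φ.toLinearMap) p (hi.comp Φ.injective) hp
    (hip.comp_surjective Φ.surjective) ?_ fun y => ?_
  · have h := rTensor_bijective F' (extRep_vecField_bijective f α)
    rw [← tensorRep_piHom_vec] at h
    exact h
  · obtain ⟨n, hn⟩ := exists_rTensor_pow_eq_zero F' (exists_fockRep_vecField_pow_eq_zero f α)
      ((Via.of _).symm y)
    let θ : Env L →ₐ[ℂ] End ℂ (PolyFun b S ⊗[ℂ] F') :=
      (tensorRep (Weyl.fockRep {α}) F').comp (piHom f F')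
    have h : θ (envι (f.vec α) ^ n) =
        LinearMap.rTensor F' (Weyl.fockRep {α} (Weyl.vecField (field f (f.vec α)))) ^ n := by
      rw [map_pow θ]
      exact congrArg (· ^ n) (tensorRep_piHom_vec f _ α)
    refine ⟨n, ?_⟩
    change Via.of θ.toRingHom (θ (envι (f.vec α) ^ n) ((Via.of θ.toRingHom).symm y)) = 0
    rw [h, hn, map_zero]

end TwistedVerma

end

theorem mainTheorem4 {L : Type*} [LieRing L] [LieAlgebra ℂ L] [FiniteDimensional ℂ L]
    [LieAlgebra.IsSemisimple ℂ L] (H : LieSubalgebra ℂ L) [H.IsCartanSubalgebra]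
    (b : (LieAlgebra.IsKilling.rootSystem H).Base) (S : Set b.support) (f : NegRootVectors b S)
    (lam : Module.Dual ℂ H) (hlam : lam ∈ dominantWeights b S)
    (F : Type*) [AddCommGroup F] [Module ℂ F] [LieRingModule (parabolic b S) F]
    [LieModule ℂ (parabolic b S) F] (hF : IsSimpleHighestWeight b S lam F)
    (F' : Type*) [AddCommGroup F'] [Module ℂ F'] [LieRingModule (parabolic b S) F']
    [LieModule ℂ (parabolic b S) F']
    (hF' : IsSimpleHighestWeight b S (lam + (2 : ℂ) • rhoU b S) F') :
    ∃ π : Env L →ₐ[ℂ] WeylU b S ⊗[ℂ] Module.End ℂ F',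
      (∀ a : L, π (envι a) = piFormula f F' a) ∧
      (Nonempty (GenVerma b S F ≃ₗ[Env L]
          Via ((tensorRep (Algebra.lsmul ℂ ℂ (WeylU b S ⧸ Weyl.idealV (nilRoots b S))) F').comp
            π).toRingHom) ∧
        (∃ c : (WeylU b S ⧸ Weyl.idealV (nilRoots b S)) ≃ₗ[WeylU b S]
            Via (Weyl.fockRep (∅ : Set (nilRoots b S))).toRingHom,
          ∀ q, c (Submodule.Quotient.mk (Weyl.ofFock ∅ q)) = Via.of _ q) ∧
        Nonempty (GenVerma b S F ≃ₗ[Env L]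
          Via ((tensorRep (Weyl.fockRep (∅ : Set (nilRoots b S))) F').comp π).toRingHom)) ∧
      ∀ α : nilRoots b S,
        Nonempty (GTModule f α F ≃ₗ[Env L]
          Via ((tensorRep (Algebra.lsmul ℂ ℂ (WeylU b S ⧸ Weyl.idealGT α)) F').comp
            π).toRingHom) ∧
        (∃ c : (WeylU b S ⧸ Weyl.idealGT α) ≃ₗ[WeylU b S]
            Via (Weyl.fockRep ({α} : Set (nilRoots b S))).toRingHom,
          ∀ q, c (Submodule.Quotient.mk (Weyl.ofFock {α} q)) = Via.of _ q) ∧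
        Nonempty (GTModule f α F ≃ₗ[Env L]
          Via ((tensorRep (Weyl.fockRep ({α} : Set (nilRoots b S))) F').comp π).toRingHom) := by
  -- The highest weight hypotheses enter only here; the rest holds for any pair of 𝔭-modules related
  -- by the trace shift.
  obtain ⟨ψ, hψ⟩ := exists_equiv_shiftedRep f F hF F' hF'
  have Φ := (nonempty_genVerma_equiv f ψ hψ).some
  refine ⟨piHom f F', piHom_ι f F', ?_, fun α => ?_⟩
  · have hc := Weyl.exists_quotient_idealV_equiv (nilRoots b S)
    exact ⟨⟨Φ.trans (nonempty_via_equiv_of_quotient F' hc.choose (piHom f F')).some⟩, hc, ⟨Φ⟩⟩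
  · have Ψ := (nonempty_gtModule_equiv f α Φ).some
    have hc := Weyl.exists_quotient_idealGT_equiv α
    exact ⟨⟨Ψ.trans (nonempty_via_equiv_of_quotient F' hc.choose (piHom f F')).some⟩, hc, ⟨Ψ⟩⟩
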